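/- **Conventions.** All spaces are over $\mathbb C$. A *vertex algebra* is a nonzero space $V$ with a vector $\mathbf 1$ and bilinear products $a(n)b$ ($n\in\mathbb Z$), $Y(a,z)b=\sum_n a(n)b\,z^{-n-1}$, such that $a(n)b=0$ for $n\gg0$, $a(n)\mathbf 1=0$ for $n\ge0$, $a(-1)\mathbf 1=a$, and the Borcherds identity holds. A *vertex subalgebra* is a subspace containing $\mathbf 1$ and closed under all products. Put $T_Va=a(-2)\mathbf 1$. *VH pairs.* A *VH pair* $(V,H)$ is a vertex algebra $V$ with a finite-dimensional subspace $H$ (a Heisenberg subspace) such that for $h,h'\in H$: $h(0)h'=0$, $h(1)h'=(h,h')\mathbf 1$ with $(\cdot,\cdot)$ a non-degenerate bilinear form on $H$, and $h(n)h'=0$ for $n\ge2$. A VH pair homomorphism $(V,H_V)\to(W,H_W)$ is a vertex algebra homomorphism $f$ with $f(H_V)=H_W$. A *subVH pair* of $(V,H)$ is a pair $(W,H)$ with $W$ a vertex subalgebra containing $H$. *AH pairs.* An *AH pair* $(A,H)$ is a finite-dimensional space $H$ with a non-degenerate symmetric bilinear form and a unital associative algebra $A=\bigoplus_{\alpha\in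 H}A^\alpha$, $1\neq0$, $1\in A^0$, $A^\alpha A^\beta\subset A^{\alpha+\beta}$, such that $A^\alpha A^\beta\ne0$ implies $(\alpha,\beta)\in\mathbb Z$, and $vw=(-1)^{(\alpha,\beta)}wv$ for $v\in A^\alpha$, $w\in A^\beta$ when $(\alpha,\beta)\in\mathbb Z$. A homomorphism $(A,H_A)\to(B,H_B)$ is a pair $(f,f')$ of a unital algebra homomorphism $f:A\to B$ and a bijective linear isometry $f':H_A\to H_B$ with $f(A^\alpha)\subset B^{f'(\alpha)}$. $(A,H)$ is *good* if $A^0=\mathbb C1$ and the product of nonzero homogeneous elements is nonzero; then $L_{A,H}=\{\alpha: A^\alpha\ne0\ne A^{-\alpha}\}$ is a subgroup of $H$, and $A^{\mathrm{lat}}=\bigoplus_{\alpha\in L_{A,H}}A^\alpha$. *Lattices.* An *even $H$-lattice* is a subgroup $L\subset H$ with $(\alpha,\beta)\in\mathbb Z$ and $(\alpha,\alpha)\in2\mathbb Z$ for $\alpha,\beta\in L$. The AH pair $A_{L,H}=\bigoplus_{\alpha\in L}\mathbb Ce_\alpha$ is the twisted group algebra $e_\alpha e_\beta=\varepsilon(\alpha,\beta)e_{\alpha+\beta}$,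 for a 2-cocycle $\varepsilon$ with $\varepsilon(\alpha,\beta)\varepsilon(\beta,\alpha)^{-1}=(-1)^{(\alpha,\beta)}$; it is unique up to isomorphism. *The functor $\mathcal V$.* $\mathcal V(A,H)=(V_{A,H},H)$ with $V_{A,H}=M_H(0)\otimes A$, where $M_H(0)$ is the Heisenberg vertex algebra of $H$, and $h\in H$ is identified with $h(-1)\mathbf 1\otimes1$. Its structure is generated by the fields $Y(h\otimes1,z)=\sum_n h(n)z^{-n-1}$, where $h(0)$ acts on $M_H(0)\otimes A^\alpha$ as $(h,\alpha)$, and, for $a\in A^\alpha$, $Y(\mathbf 1\otimes a,z)=\exp\bigl(\sum_{n\ge1}\tfrac{\alpha(-n)}{n}z^n\bigr)\exp\bigl(-\sum_{n\ge1}\tfrac{\alpha(n)}{n}z^{-n}\bigr)\otimes l_az^\alpha$ with $l_az^\alpha\, b=z^{(\alpha,\beta)}ab$ for $b\in A^\beta$. Write $V_{L,H}=V_{A_{L,H},H}$; an *$H$-lattice vertex algebra* is a VH pair isomorphic to some $(V_{L,H},H)$. *The functor $\Omega$.* For a VH pair $(V,H)$ let $\omega_H=\frac12\sum_ih_i(-1)h^i$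 for dual bases $h_i,h^i$ of $H$, and let $\Omega_{V,H}^\alpha$ ($\alpha\in H$) be the set of $v\in V$ with $T_Vv=\omega_H(0)v$, $h(n)v=0$ for $n\ge1$, and $h(0)v=(h,\alpha)v$ for all $h\in H$. Then $\Omega(V,H)=\bigoplus_\alpha\Omega_{V,H}^\alpha$ is an AH pair with the product $vw=v(-(\alpha,\beta)-1)w$ for $v\in\Omega^\alpha_{V,H}$, $w\in\Omega^\beta_{V,H}$ ($0$ if $(\alpha,\beta)\notin\mathbb Z$). $(V,H)$ is *good* if $\Omega(V,H)$ is good, and then $L_{V,H}:=L_{\Omega(V,H),H}$ is its *maximal lattice*. **Theorem.** Let $(V,H)$ be a good VH pair. There is an injective VH pair homomorphism $\iota:\mathcal V(\Omega(V,H)^{\mathrm{lat}})\to(V,H)$ with $\iota(h)=h$ for $h\in H$ and $\iota(\mathbf 1\otimes a)=a$ for $a\in\Omega^\alpha_{V,H}$, $\alpha\in L_{V,H}$. Identify $\mathcal V(\Omega(V,H)^{\mathrm{lat}})$ with its image, a subVH pair of $(V,H)$. 1. $\mathcal V(\Omega(V,H)^{\mathrm{lat}})$ is an $H$-lattice vertex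 algebra; indeed it is isomorphic to $V_{L_{V,H},H}$ as a VH pair, by an isomorphism that is the identity on $H$. 2. For any finite-dimensional space $H'$ with a non-degenerate symmetric bilinear form, any even $H'$-lattice $L$ and any VH pair homomorphism $f:(V_{L,H'},H')\to(V,H)$, the image of $f$ lies in $\mathcal V(\Omega(V,H)^{\mathrm{lat}})$. These two properties characterize it: a subVH pair $(W,H)$ of $(V,H)$ that is an $H$-lattice vertex algebra and contains the image of every such $f$ is equal to $\mathcal V(\Omega(V,H)^{\mathrm{lat}})$. Furthermore, there is a natural bijection $$\operatorname{Hom}_{\mathrm{VH}}\bigl((V_{L,H'},H'),(V,H)\bigr)\;\cong\;\operatorname{Hom}_{\mathrm{AH}}\bigl((A_{L,H'},H'),(A_{L_{V,H},H},H)\bigr),$$ namely: there is an isomorphism of AH pairs $\Phi:\Omega(V,H)^{\mathrm{lat}}\to A_{L_{V,H},H}$ over $\mathrm{id}_H$, independent of $(L,H')$, such that for all $(L,H')$ the homomorphism $F$ corresponds to the $(f,f')$ with $F(h)=f'(h)$ for $h\in H'$ and $F(\mathbf 1\otimes x)=\iota\bigl(\mathbf 1\otimes\Phi^{-1}(f(x))\bigr)$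 for $x\in A_{L,H'}$. -/

import Mathlib

open scoped DirectSum TensorProduct Classical

universe u v w x

noncomputable section

namespace VHPairs

/-- The data of a vertex algebra over `ℂ`: a vector `vac = 𝟏` and bilinear products
`nprod n a b = a(n)b`, `n ∈ ℤ`, i.e. `Y(a, z)b = ∑ a(n)b z^(-n-1)`. -/
class PreVertexAlgebra (V : Type u) [AddCommGroup V] [Module ℂ V] where
  vac : V
  nprod : ℤ → V →ₗ[ℂ] V →ₗ[ℂ] V

open PreVertexAlgebra

/-- A (nonzero) vertex algebra over `ℂ`: `a(n)b = 0` for `n` large, `a(n)𝟏 = 0` for `n ≥ 0`,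
`a(-1)𝟏 = a`, and the Borcherds identity.  (All the sums are finite, by `trunc`.) -/
class VertexAlgebra (V : Type u) [AddCommGroup V] [Module ℂ V] extends PreVertexAlgebra V where
  vac_ne_zero : vac ≠ 0
  trunc : ∀ a b : V, ∃ N : ℤ, ∀ n : ℤ, N ≤ n → nprod n a b = 0
  nprod_vac_of_nonneg : ∀ (a : V) (n : ℤ), 0 ≤ n → nprod n a vac = 0
  nprod_neg_one_vac : ∀ a : V, nprod (-1) a vac = a
  borcherds : ∀ (a b c : V) (p q r : ℤ),
    ∑ᶠ i : ℕ, Ring.choose p i • nprod (p + q - i) (nprod (r + i) a b) c =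
      ∑ᶠ i : ℕ, ((-1) ^ i * Ring.choose r i) •
        (nprod (p + r - i) a (nprod (q + i) b c) -
          (Int.negOnePow r : ℤ) • nprod (q + r - i) b (nprod (p + i) a c))

section Basic

variable {V : Type u} [AddCommGroup V] [Module ℂ V] [VertexAlgebra V]

open VertexAlgebra

theorem nprod_iterate (a b c : V) (q r : ℤ) :
    nprod q (nprod r a b) c = ∑ᶠ i : ℕ, ((-1) ^ i * Ring.choose r i) •
        (nprod (r - i) a (nprod (q + i) b c) -
          (Int.negOnePow r : ℤ) • nprod (q + r - i) b (nprod (i : ℤ) a c)) := by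
  have h := borcherds a b c 0 q r
  rw [finsum_eq_single _ 0] at h
  · simpa using h
  · intro i hi
    rw [Ring.choose_zero_pos _ (Nat.pos_of_ne_zero hi), zero_smul]

theorem nprod_comm (a b c : V) (p q : ℤ) :
    nprod p a (nprod q b c) - nprod q b (nprod p a c) =
      ∑ᶠ i : ℕ, Ring.choose p i • nprod (p + q - i) (nprod (i : ℤ) a b) c := by
  have h := borcherds a b c p q 0
  rw [eq_comm, finsum_eq_single _ 0] at h
  · simpa using h
  · intro i hi
    rw [Ring.choose_zero_pos _ (Nat.pos_of_ne_zero hi), mul_zero, zero_smul]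

theorem neg_one_pow_mul_choose (r : ℤ) (i : ℕ) :
    (-1) ^ i * Ring.choose (-r) i = Ring.multichoose r i := by
  rw [Ring.choose_neg', Units.smul_def, Int.coe_negOnePow_natCast, smul_eq_mul, ← mul_assoc,
    ← mul_pow]
  simp

theorem neg_one_pow_mul_choose_one (i : ℕ) : (-1) ^ i * Ring.choose (-1 : ℤ) i = 1 := by
  rw [neg_one_pow_mul_choose, Ring.multichoose_one]

theorem neg_one_pow_mul_choose_two (i : ℕ) : (-1) ^ i * Ring.choose (-2 : ℤ) i = i + 1 := by
  rw [neg_one_pow_mul_choose, Ring.multichoose_two]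

theorem skew (a b : V) (r : ℤ) :
    nprod r b a = (Int.negOnePow (r + 1) : ℤ) •
      ∑ᶠ i : ℕ, ((-1) ^ i : ℤ) • nprod (-1 - i) (nprod (r + i) a b) (vac : V) := by
  have h := borcherds a b vac (-1) 0 r
  have h2 : ∀ i : ℕ, (Ring.choose (-1 : ℤ) i) = (-1) ^ i := by
    intro i
    have := neg_one_pow_mul_choose_one i
    rcases neg_one_pow_eq_or ℤ i with h | h <;> rw [h] at this ⊢ <;> linarith
  rw [eq_comm, finsum_eq_single _ 0] at h
  · simp only [h2] at h
    simp [nprod_neg_one_vac, nprod_vac_of_nonneg] at h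
    rw [← h, Int.negOnePow_succ]
    simp [smul_smul]
  · intro i hi
    rw [nprod_vac_of_nonneg b _ (by positivity), nprod_vac_of_nonneg a (-1 + i) (by omega)]
    simp

theorem vac_nprod_nonneg (a : V) (n : ℤ) (hn : 0 ≤ n) : nprod n (vac : V) a = 0 := by
  rw [skew]
  rw [finsum_eq_zero_of_forall_eq_zero, smul_zero]
  intro i
  rw [nprod_vac_of_nonneg a _ (by omega)]
  simp

theorem vac_nprod_neg_one (a : V) : nprod (-1) (vac : V) a = a := by
  rw [skew, finsum_eq_single _ 0]
  · simp [nprod_neg_one_vac]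
  · intro i hi
    rw [nprod_vac_of_nonneg a _ (by omega)]
    simp

theorem vac_nprod_of_le (a : V) (k : ℕ) : nprod (-2 - k) (vac : V) a = 0 := by
  induction k using Nat.strong_induction_on generalizing a with
  | _ k ih =>
  have h := nprod_iterate (vac : V) vac a (-2 - k) (-1)
  rw [nprod_neg_one_vac, finsum_eq_sum_of_support_subset (s := {0, k + 1})] at h
  · rw [Finset.sum_pair (by omega)] at h
    rw [neg_one_pow_mul_choose_one, neg_one_pow_mul_choose_one] at h
    have e1 : (-2 - (k : ℤ)) + ((k + 1 : ℕ) : ℤ) = -1 := by push_cast; ring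
    have e2 : (-1 : ℤ) - ((k + 1 : ℕ) : ℤ) = -2 - k := by push_cast; ring
    rw [vac_nprod_nonneg _ ((0 : ℕ) : ℤ) (by simp),
      vac_nprod_nonneg _ ((k + 1 : ℕ) : ℤ) (by positivity), e1, e2, vac_nprod_neg_one] at h
    simp [vac_nprod_neg_one] at h
    exact h
  · intro i hi
    by_contra hne
    simp only [Finset.coe_insert, Finset.coe_singleton, Set.mem_insert_iff,
      Set.mem_singleton_iff, not_or] at hne
    apply hi
    dsimp only
    rw [vac_nprod_nonneg _ (i : ℤ) (by positivity)]
    rcases Nat.lt_or_ge i (k + 1) with hlt | hge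
    · have := ih (i - 1) (by omega) (nprod (-2 - (k : ℤ) + i) (vac : V) a)
      rw [show (-1 : ℤ) - i = -2 - ((i - 1 : ℕ) : ℤ) by omega, this]
      simp
    · rw [vac_nprod_nonneg _ (-2 - (k : ℤ) + i) (by omega)]
      simp

theorem vac_nprod (a : V) (n : ℤ) : nprod n (vac : V) a = if n = -1 then a else 0 := by
  split_ifs with h
  · rw [h, vac_nprod_neg_one]
  · rcases lt_or_ge n 0 with h0 | h0
    · have := vac_nprod_of_le a (-2 - n).toNat
      rwa [show (-2 : ℤ) - ((-2 - n).toNat : ℤ) = n by omega] at this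
    · exact vac_nprod_nonneg a n h0

/-- The canonical derivation `T_V a = a(-2)𝟏`. -/
def translation : V →ₗ[ℂ] V := (nprod (-2)).flip (vac : V)

theorem translation_apply (a : V) : translation a = nprod (-2) a vac := rfl

theorem translation_nprod' (a b : V) (n : ℤ) :
    translation (nprod n a b) = nprod n a (translation b) - n • nprod (n - 1) a b := by
  rw [translation_apply, nprod_iterate, finsum_eq_sum_of_support_subset (s := {0, 1})]
  · rw [Finset.sum_pair (by omega)]
    simp [nprod_vac_of_nonneg, nprod_neg_one_vac, translation_apply]
    rw [← sub_eq_add_neg]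
  · intro i hi
    by_contra hne
    simp only [Finset.coe_insert, Finset.coe_singleton, Set.mem_insert_iff,
      Set.mem_singleton_iff, not_or] at hne
    apply hi
    dsimp only
    rw [nprod_vac_of_nonneg _ _ (by omega), nprod_vac_of_nonneg _ _ (by positivity)]
    simp

theorem nprod_translation (a b : V) (n : ℤ) :
    nprod n (translation a) b = -n • nprod (n - 1) a b := by
  rw [translation_apply, nprod_iterate]
  rcases lt_or_ge n 0 with h0 | h0
  · rw [finsum_eq_single _ (-1 - n).toNat]
    · rw [neg_one_pow_mul_choose_two, vac_nprod, vac_nprod, if_pos (by omega), if_neg (by omega)]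
      rw [show (-2 : ℤ) - ((-1 - n).toNat : ℤ) = n - 1 by omega]
      rw [show (((-1 - n).toNat : ℤ) + 1) = -n by omega]
      simp
    · intro i hi
      rw [vac_nprod, vac_nprod, if_neg (by omega), if_neg (by omega)]
      simp
  · rcases eq_or_ne n 0 with rfl | hn
    · rw [finsum_eq_zero_of_forall_eq_zero]
      · simp
      · intro i
        rw [vac_nprod, vac_nprod, if_neg (by omega), if_neg (by omega)]
        simp
    rw [finsum_eq_single _ (n - 1).toNat]
    · rw [neg_one_pow_mul_choose_two, vac_nprod, vac_nprod, if_neg (by omega), if_pos (by omega)]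
      rw [show ((n - 1).toNat : ℤ) = n - 1 by omega, show Int.negOnePow (-2) = 1 by decide]
      simp
    · intro i hi
      rw [vac_nprod, vac_nprod, if_neg (by omega), if_neg (by omega)]
      simp

theorem translation_nprod (a b : V) (n : ℤ) :
    translation (nprod n a b) = nprod n (translation a) b + nprod n a (translation b) := by
  rw [translation_nprod', nprod_translation]
  module

/-- `a(0)` is a derivation of all the products. -/
theorem nprod_zero_nprod (a b c : V) (n : ℤ) :
    nprod 0 a (nprod n b c) = nprod n (nprod 0 a b) c + nprod n b (nprod 0 a c) := by
  have h := nprod_comm a b c 0 n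
  rw [finsum_eq_single _ 0] at h
  · rw [sub_eq_iff_eq_add] at h
    simpa using h
  · intro i hi
    rw [Ring.choose_zero_pos _ (Nat.pos_of_ne_zero hi), zero_smul]

end Basic

/-! ### Heisenberg subspaces -/

section Heisenberg

variable {V : Type u} [AddCommGroup V] [Module ℂ V] [VertexAlgebra V]

open VertexAlgebra

/-- A (finite-dimensional) Heisenberg subspace `H` of a vertex algebra `V`.  A pair `(V, H)` with
`IsHeisenberg H` is a VH pair. -/
structure IsHeisenberg (H : Submodule ℂ V) : Prop where
  finite : Module.Finite ℂ H
  zero : ∀ h ∈ H, ∀ h' ∈ H, nprod 0 h h' = 0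
  one : ∀ h ∈ H, ∀ h' ∈ H, ∃ c : ℂ, nprod 1 h h' = c • (vac : V)
  two : ∀ h ∈ H, ∀ h' ∈ H, ∀ n : ℤ, 2 ≤ n → nprod n h h' = 0
  nondeg : ∀ h ∈ H, (∀ h' ∈ H, nprod 1 h h' = 0) → h = 0

theorem exists_vac_dual (V : Type u) [AddCommGroup V] [Module ℂ V] [VertexAlgebra V] :
    ∃ φ : V →ₗ[ℂ] ℂ, φ vac = 1 := by
  obtain ⟨φ, hφ⟩ := LinearMap.exists_leftInverse_of_injective
    (LinearMap.toSpanSingleton ℂ V vac)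
    (LinearMap.ker_toSpanSingleton ℂ (vac_ne_zero (V := V)))
  exact ⟨φ, by simpa using LinearMap.congr_fun hφ 1⟩

variable {H : Submodule ℂ V}

/-- The bilinear form on a Heisenberg subspace, `h(1)h' = (h, h') 𝟏` (see `heisForm_spec`). -/
def heisForm (_hH : IsHeisenberg H) : LinearMap.BilinForm ℂ H :=
  ((nprod 1).compr₂ (exists_vac_dual V).choose).compl₁₂ H.subtype H.subtype

theorem heisForm_spec (hH : IsHeisenberg H) (h h' : H) :
    nprod 1 (h : V) (h' : V) = heisForm hH h h' • (vac : V) := by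
  obtain ⟨c, hc⟩ := hH.one h h.2 h' h'.2
  simp [heisForm, hc, (exists_vac_dual V).choose_spec]

theorem heisForm_symm (hH : IsHeisenberg H) : (heisForm hH).IsSymm := by
  constructor
  intro h h'
  have h1 := skew (h : V) (h' : V) 1
  rw [finsum_eq_single _ 0] at h1
  · rw [heisForm_spec hH] at h1
    simp only [Nat.cast_zero, sub_zero, add_zero, nprod_neg_one_vac, pow_zero, one_smul] at h1
    rw [heisForm_spec hH, show Int.negOnePow (1 + 1) = 1 by decide] at h1
    simp only [Units.val_one, one_smul] at h1
    exact (smul_left_injective ℂ (vac_ne_zero (V := V)) h1).symm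
  · intro i hi
    rw [hH.two h h.2 h' h'.2 _ (by omega)]
    simp

theorem heisForm_nondeg (hH : IsHeisenberg H) : (heisForm hH).Nondegenerate := by
  have key : ∀ h : H, (∀ h', heisForm hH h h' = 0) → h = 0 := by
    intro h hh
    have := hH.nondeg h h.2 fun h' hh' => by
      rw [heisForm_spec hH h ⟨h', hh'⟩, hh, zero_smul]
    exact Subtype.ext this
  refine ⟨key, fun h hh => key h fun h' => ?_⟩
  rw [← hh h', (heisForm_symm hH).eq]

/-- The Sugawara vector `ω_H = ½ ∑ h_i(-1)h^i`. -/
def omegaVec (hH : IsHeisenberg H) : V :=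
  haveI := hH.finite
  (1 / 2 : ℂ) • ∑ i, nprod (-1) (Module.finBasis ℂ H i : V)
    ((heisForm hH).dualBasis (heisForm_nondeg hH) (Module.finBasis ℂ H) i : V)

/-- The space `Ω_{V,H}^α`. -/
def vacSpace (hH : IsHeisenberg H) (α : H) : Submodule ℂ V where
  carrier := {v | translation v = nprod 0 (omegaVec hH) v ∧
    (∀ h ∈ H, ∀ n : ℤ, 1 ≤ n → nprod n h v = 0) ∧
    ∀ h : H, nprod 0 (h : V) v = heisForm hH h α • v}
  zero_mem' := by simp
  add_mem' := by
    rintro v w ⟨hv1, hv2, hv3⟩ ⟨hw1, hw2, hw3⟩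
    refine ⟨by simp [hv1, hw1], fun h hh n hn => by simp [hv2 h hh n hn, hw2 h hh n hn],
      fun h => by simp [hv3, hw3]⟩
  smul_mem' := by
    rintro c v ⟨hv1, hv2, hv3⟩
    refine ⟨by simp [hv1], fun h hh n hn => by simp [hv2 h hh n hn],
      fun h => by simp [hv3, smul_comm c]⟩

variable {hH : IsHeisenberg H}

/-- `(h(-1)h')(0)v = (h', α) h(-1)v + (h, α) h'(-1)v` for an `H`-vacuum vector `v`. -/
theorem nprod_zero_quadratic {α : H} {v : V} (hv : v ∈ vacSpace hH α) (h h' : H) :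
    nprod 0 (nprod (-1) (h : V) (h' : V)) v =
      heisForm hH h' α • nprod (-1) (h : V) v + heisForm hH h α • nprod (-1) (h' : V) v := by
  rw [nprod_iterate, finsum_eq_single _ 0]
  · simp only [Nat.cast_zero, sub_zero, add_zero, hv.2.2, pow_zero, Ring.choose_zero_right]
    simp
  · intro i hi
    rw [hv.2.1 _ h.2 _ (by omega), hv.2.1 _ h'.2 _ (by omega)]
    simp

theorem sum_dualBasis (hH : IsHeisenberg H) {ι : Type*} [Fintype ι] [DecidableEq ι]
    (b : Module.Basis ι ℂ H) (α : H) :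
    ∑ i, heisForm hH (b i) α • (heisForm hH).dualBasis (heisForm_nondeg hH) b i = α := by
  conv_rhs => rw [← ((heisForm hH).dualBasis (heisForm_nondeg hH) b).sum_repr α]
  refine Finset.sum_congr rfl fun i _ => ?_
  rw [LinearMap.BilinForm.dualBasis_repr_apply, (heisForm_symm hH).eq]

theorem translation_of_mem {α : H} {v : V} (hv : v ∈ vacSpace hH α) :
    translation v = nprod (-1) (α : V) v := by
  have := hH.finite
  rw [hv.1, omegaVec]
  simp only [map_smul, map_sum, LinearMap.smul_apply, LinearMap.sum_apply,
    nprod_zero_quadratic hv, Finset.sum_add_distrib]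
  set b := Module.finBasis ℂ H
  set b' := (heisForm hH).dualBasis (heisForm_nondeg hH) b
  have e2 : ∑ i, heisForm hH (b i) α • b' i = α := sum_dualBasis hH b α
  have e1 : ∑ i, heisForm hH (b' i) α • b i = α := by
    have := sum_dualBasis hH b' α
    rwa [LinearMap.BilinForm.dualBasis_dualBasis _ (heisForm_symm hH)] at this
  have e1' := congrArg (fun x : H => nprod (-1) (x : V) v) e1
  have e2' := congrArg (fun x : H => nprod (-1) (x : V) v) e2
  simp only [AddSubmonoidClass.coe_finsetSum, Submodule.coe_smul, map_sum, map_smul,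
    LinearMap.sum_apply, LinearMap.smul_apply] at e1' e2'
  rw [e1', e2', ← two_smul ℂ, smul_smul]
  norm_num

theorem nprod_vac_comm {α : H} {v : V} (hv : v ∈ vacSpace hH α) (h : H) (w : V) (p q : ℤ) :
    nprod p (h : V) (nprod q v w) =
      nprod q v (nprod p (h : V) w) + heisForm hH h α • nprod (p + q) v w := by
  have hc := nprod_comm (h : V) v w p q
  rw [finsum_eq_single _ 0] at hc
  · rw [sub_eq_iff_eq_add'] at hc
    rw [hc]
    simp [hv.2.2]
  · intro i hi
    rw [hv.2.1 _ h.2 _ (by omega)]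
    simp

theorem nprod_top {α β : H} {v w : V} (hv : v ∈ vacSpace hH α) (hw : w ∈ vacSpace hH β)
    {m : ℤ} (hm : nprod m v w ≠ 0) :
    ∃ n : ℤ, heisForm hH α β = n ∧ ∀ k : ℤ, -n ≤ k → nprod k v w = 0 := by
  obtain ⟨N, hN⟩ := trunc v w
  obtain ⟨k, hk, hk'⟩ := Int.exists_greatest_of_bdd (P := fun k => nprod k v w ≠ 0)
    ⟨N, fun z hz => by
      by_contra hlt
      exact hz (hN z (by omega))⟩ ⟨m, hm⟩
  have hk0 : ∀ l, k < l → nprod l v w = 0 := by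
    intro l hl
    by_contra hne
    have := hk' l hne
    omega
  have h1 : nprod (k + 1) (translation v) w = (-(k + 1) : ℂ) • nprod k v w := by
    rw [nprod_translation, ← Int.cast_smul_eq_zsmul ℂ]
    simp
  have h2 : nprod (k + 1) (translation v) w = heisForm hH α β • nprod k v w := by
    rw [translation_of_mem hv, nprod_iterate, finsum_eq_single _ 0]
    · rw [hk0 _ (by simp)]
      simp [hw.2.2]
    · intro i hi
      rw [hw.2.1 _ α.2 _ (by omega), hk0 _ (by omega)]
      simp
  have h3 : heisForm hH α β = ((-(k + 1) : ℤ) : ℂ) := by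
    rw [h1] at h2
    push_cast
    exact (smul_left_injective ℂ hk h2).symm
  exact ⟨-(k + 1), h3, fun l hl => hk0 l (by omega)⟩

theorem nprod_mem {α β : H} {v w : V} (hv : v ∈ vacSpace hH α) (hw : w ∈ vacSpace hH β)
    {n : ℤ} (hn : heisForm hH α β = n) : nprod (-n - 1) v w ∈ vacSpace hH (α + β) := by
  by_cases h0 : nprod (-n - 1) v w = 0
  · rw [h0]
    exact Submodule.zero_mem _
  obtain ⟨n', hn', htop⟩ := nprod_top hv hw h0
  obtain rfl : n = n' := by
    rw [hn] at hn'
    exact_mod_cast hn'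
  refine ⟨?_, fun h hh k hk => ?_, fun h => ?_⟩
  · rw [nprod_zero_nprod, translation_nprod, hv.1, hw.1]
  · rw [nprod_vac_comm hv ⟨h, hh⟩, hw.2.1 h hh k hk, htop _ (by omega)]
    simp
  · rw [nprod_vac_comm hv h, hw.2.2]
    simp [add_smul, add_comm]


theorem vac_mem : (vac : V) ∈ vacSpace hH 0 := by
  refine ⟨?_, fun h _ n hn => nprod_vac_of_nonneg h n (by omega), fun h => ?_⟩
  · rw [translation_apply, vac_nprod, nprod_vac_of_nonneg _ _ le_rfl, if_neg (by decide)]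
  · rw [nprod_vac_of_nonneg _ _ le_rfl]
    simp

theorem nprod_eq_zero_of_not_int {α β : H} {v w : V} (hv : v ∈ vacSpace hH α)
    (hw : w ∈ vacSpace hH β) (hn : ¬ ∃ n : ℤ, heisForm hH α β = n) (m : ℤ) :
    nprod m v w = 0 := by
  by_contra h
  obtain ⟨n, h, -⟩ := nprod_top hv hw h
  exact hn ⟨n, h⟩

theorem nprod_eq_zero_of_le {α β : H} {v w : V} (hv : v ∈ vacSpace hH α)
    (hw : w ∈ vacSpace hH β) {n : ℤ} (hn : heisForm hH α β = n) (m : ℤ) (hm : -n ≤ m) :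
    nprod m v w = 0 := by
  by_contra h
  obtain ⟨n', h', h2⟩ := nprod_top hv hw h
  obtain rfl : n = n' := by
    rw [hn] at h'
    exact_mod_cast h'
  exact h (h2 m hm)

/-- The product `vw = v(-(α, β) - 1)w` of `v ∈ Ω^α` and `w ∈ Ω^β`; it is zero if
`(α, β)` is not an integer (in that case all the products `v(m)w` vanish). -/
def vacMul (hH : IsHeisenberg H) (α β : H) : V →ₗ[ℂ] V →ₗ[ℂ] V :=
  if ∃ n : ℤ, heisForm hH α β = n then nprod (-⌊(heisForm hH α β).re⌋ - 1) else 0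

theorem vacMul_of_int {α β : H} {n : ℤ} (hn : heisForm hH α β = n) :
    vacMul hH α β = nprod (-n - 1) := by
  rw [vacMul, if_pos ⟨n, hn⟩, hn]
  simp

theorem vacMul_of_not_int {α β : H} (hn : ¬ ∃ n : ℤ, heisForm hH α β = n) :
    vacMul hH α β = 0 := if_neg hn

theorem vacMul_mem {α β : H} {v w : V} (hv : v ∈ vacSpace hH α) (hw : w ∈ vacSpace hH β) :
    vacMul hH α β v w ∈ vacSpace hH (α + β) := by
  by_cases hn : ∃ n : ℤ, heisForm hH α β = n
  · obtain ⟨n, hn⟩ := hn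
    rw [vacMul_of_int hn]
    exact nprod_mem hv hw hn
  · rw [vacMul_of_not_int hn]
    exact Submodule.zero_mem _

theorem vacMul_comm {α β : H} {v w : V} (hv : v ∈ vacSpace hH α) (hw : w ∈ vacSpace hH β)
    {n : ℤ} (hn : heisForm hH α β = n) :
    vacMul hH α β v w = (Int.negOnePow n : ℤ) • vacMul hH β α w v := by
  have hn' : heisForm hH β α = n := by rw [← hn, (heisForm_symm hH).eq]
  rw [vacMul_of_int hn, vacMul_of_int hn', skew, finsum_eq_single _ 0]
  · simp only [Nat.cast_zero, sub_zero, add_zero, nprod_neg_one_vac, pow_zero, one_smul]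
    rw [show -n - 1 + 1 = -n by ring, Int.negOnePow_neg]
  · intro i hi
    rw [nprod_eq_zero_of_le hw hv hn' _ (by omega)]
    simp

theorem vacMul_assoc {α β γ : H} {a b c : V} (ha : a ∈ vacSpace hH α) (hb : b ∈ vacSpace hH β)
    (hc : c ∈ vacSpace hH γ) :
    vacMul hH (α + β) γ (vacMul hH α β a b) c = vacMul hH α (β + γ) a (vacMul hH β γ b c) := by
  by_cases h1 : ∃ n : ℤ, heisForm hH α β = n
  · obtain ⟨n1, h1⟩ := h1
    by_cases h2 : ∃ n : ℤ, heisForm hH β γ = n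
    · obtain ⟨n2, h2⟩ := h2
      by_cases h3 : ∃ n : ℤ, heisForm hH α γ = n
      · obtain ⟨n3, h3⟩ := h3
        have h4 : heisForm hH (α + β) γ = (n3 + n2 : ℤ) := by
          rw [map_add, LinearMap.add_apply, h2, h3]; push_cast; ring
        have h5 : heisForm hH α (β + γ) = (n1 + n3 : ℤ) := by
          rw [map_add, h1, h3]; push_cast; ring
        rw [vacMul_of_int h4, vacMul_of_int h5, vacMul_of_int h1, vacMul_of_int h2]
        have hB := borcherds a b c (-n3) (-n2 - 1) (-n1 - 1)
        rw [finsum_eq_single _ 0, finsum_eq_single _ 0] at hB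
        · simp only [Nat.cast_zero, sub_zero, add_zero, pow_zero, one_mul,
            Ring.choose_zero_right, one_smul] at hB
          rw [nprod_eq_zero_of_le ha hc h3 (-n3) le_rfl, map_zero, smul_zero, sub_zero] at hB
          rw [show -(n3 + n2) - 1 = -n3 + (-n2 - 1) by ring, hB]
          ring_nf
        · intro i hi
          rw [nprod_eq_zero_of_le ha hc h3 _ (by omega),
            nprod_eq_zero_of_le hb hc h2 _ (by omega)]
          simp
        · intro i hi
          rw [nprod_eq_zero_of_le ha hb h1 _ (by omega)]
          simp
      · rw [vacMul_of_not_int (α := α + β), vacMul_of_not_int (β := β + γ)]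
        · simp
        · rintro ⟨n, hn⟩
          refine h3 ⟨n - n1, ?_⟩
          rw [map_add, h1] at hn
          push_cast
          rw [← hn]
          ring
        · rintro ⟨n, hn⟩
          refine h3 ⟨n - n2, ?_⟩
          rw [map_add, LinearMap.add_apply, h2] at hn
          push_cast
          rw [← hn]
          ring
    · rw [vacMul_of_not_int h2, LinearMap.zero_apply, LinearMap.zero_apply, map_zero]
      by_cases h4 : ∃ n : ℤ, heisForm hH (α + β) γ = n
      · have h3 : ¬ ∃ n : ℤ, heisForm hH α γ = n := by
          rintro ⟨n, hn⟩
          obtain ⟨n4, h4⟩ := h4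
          refine h2 ⟨n4 - n, ?_⟩
          rw [map_add, LinearMap.add_apply, hn] at h4
          push_cast
          rw [← h4]
          ring
        obtain ⟨n4, h4⟩ := h4
        rw [vacMul_of_int h4, vacMul_of_int h1, nprod_iterate, finsum_eq_zero_of_forall_eq_zero]
        intro i
        rw [nprod_eq_zero_of_not_int ha hc h3, nprod_eq_zero_of_not_int hb hc h2]
        simp
      · rw [vacMul_of_not_int h4]
        simp
  · rw [vacMul_of_not_int h1, LinearMap.zero_apply, LinearMap.zero_apply, map_zero,
      LinearMap.zero_apply, eq_comm]
    by_cases h2 : ∃ n : ℤ, heisForm hH β γ = n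
    · by_cases h5 : ∃ n : ℤ, heisForm hH α (β + γ) = n
      · have h3 : ¬ ∃ n : ℤ, heisForm hH α γ = n := by
          rintro ⟨n, hn⟩
          obtain ⟨n5, h5⟩ := h5
          refine h1 ⟨n5 - n, ?_⟩
          rw [map_add, hn] at h5
          push_cast
          rw [← h5]
          ring
        obtain ⟨n2, h2⟩ := h2
        obtain ⟨n5, h5⟩ := h5
        rw [vacMul_of_int h2, vacMul_of_int h5]
        have hcm := nprod_comm a b c (-n5 - 1) (-n2 - 1)
        rw [nprod_eq_zero_of_not_int ha hc h3, map_zero, sub_zero,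
          finsum_eq_zero_of_forall_eq_zero] at hcm
        · exact hcm
        · intro i
          rw [nprod_eq_zero_of_not_int ha hb h1]
          simp
      · rw [vacMul_of_not_int h5]
        simp
    · rw [vacMul_of_not_int h2]
      simp

end Heisenberg

/-! ### AH pairs -/

section AH

variable {H : Type u} [AddCommGroup H] [Module ℂ H] (B : LinearMap.BilinForm ℂ H)

/-- An AH pair over the space `H` with bilinear form `B`: an `H`-graded associative unital
algebra `A = ⨁ α, A^α` over `ℂ`, given by its homogeneous components `comp α = A^α`. -/
structure AHPair where
  comp : H → Type v
  [addCommGroup : ∀ α, AddCommGroup (comp α)]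
  [module : ∀ α, Module ℂ (comp α)]
  [gring : DirectSum.GRing comp]
  [galgebra : DirectSum.GAlgebra ℂ comp]
  one_ne_zero : (1 : ⨁ α, comp α) ≠ 0
  integral : ∀ (α β : H) (v : comp α) (w : comp β),
    DirectSum.of comp α v * DirectSum.of comp β w ≠ 0 → ∃ n : ℤ, B α β = n
  comm : ∀ (α β : H) (v : comp α) (w : comp β) (n : ℤ), B α β = n →
    DirectSum.of comp α v * DirectSum.of comp β w =
      (Int.negOnePow n : ℤ) • (DirectSum.of comp β w * DirectSum.of comp α v)

attribute [instance] AHPair.addCommGroup AHPair.module AHPair.gring AHPair.galgebra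

variable {B}

namespace AHPair

/-- The algebra `A = ⨁ α, A^α` of an AH pair. -/
abbrev Alg (A : AHPair.{u, v} B) : Type max u v := ⨁ α, A.comp α

/-- An AH pair from bilinear multiplication maps between the homogeneous components. -/
def ofMul (comp : H → Type v) [∀ α, AddCommGroup (comp α)] [∀ α, Module ℂ (comp α)]
    (mul : ∀ α β, comp α →ₗ[ℂ] comp β →ₗ[ℂ] comp (α + β)) (one : comp 0)
    (one_mul : ∀ α (a : comp α), GradedMonoid.mk (0 + α) (mul 0 α one a) = .mk α a)
    (mul_one : ∀ α (a : comp α), GradedMonoid.mk (α + 0) (mul α 0 a one) = .mk α a)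
    (mul_assoc : ∀ α β γ (a : comp α) (b : comp β) (c : comp γ),
      GradedMonoid.mk (α + β + γ) (mul (α + β) γ (mul α β a b) c) =
        .mk (α + (β + γ)) (mul α (β + γ) a (mul β γ b c)))
    (one_ne_zero : one ≠ 0)
    (integral : ∀ α β (a : comp α) (b : comp β), mul α β a b ≠ 0 → ∃ n : ℤ, B α β = n)
    (comm : ∀ α β (a : comp α) (b : comp β) (n : ℤ), B α β = n →
      GradedMonoid.mk (α + β) (mul α β a b) =
        .mk (β + α) ((Int.negOnePow n : ℤ) • mul β α b a)) : AHPair.{u, v} B :=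
  letI gmul : GradedMonoid.GMul comp := ⟨fun {i j} a b => mul i j a b⟩
  letI gone : GradedMonoid.GOne comp := ⟨one⟩
  letI gmonoid : GradedMonoid.GMonoid comp :=
    { gmul, gone with
      one_mul := fun a => one_mul a.1 a.2
      mul_one := fun a => mul_one a.1 a.2
      mul_assoc := fun a b c => mul_assoc _ _ _ a.2 b.2 c.2 }
  letI gring : DirectSum.GRing comp :=
    { gmonoid with
      mul_zero := fun a => map_zero _
      zero_mul := fun {i j} b => (DFunLike.congr_fun (map_zero (mul i j)) b :)
      mul_add := fun a b c => map_add _ _ _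
      add_mul := fun a b c => (DFunLike.congr_fun (map_add (mul _ _) a b) c)
      natCast := fun n => n • one
      natCast_zero := zero_smul _ _
      natCast_succ := fun n => succ_nsmul _ _
      intCast := fun n => n • one
      intCast_ofNat := fun n => natCast_zsmul _ _
      intCast_negSucc_ofNat := fun n => negSucc_zsmul _ _ }
  letI galgebra : DirectSum.GAlgebra ℂ comp :=
    { toFun := (LinearMap.toSpanSingleton ℂ _ one).toAddMonoidHom
      map_one := one_smul _ _
      map_mul := fun r s => by
        have h := congrArg (fun x => (r * s) • x) (one_mul 0 one)
        refine h.symm.trans ?_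
        change GradedMonoid.mk _ ((r * s) • mul 0 0 one one) =
          GradedMonoid.mk _ (mul 0 0 (r • one) (s • one))
        rw [map_smul, map_smul, LinearMap.smul_apply, smul_smul, mul_comm]
      commutes := fun r x => by
        have h1 := congrArg (fun y => r • y) (one_mul x.1 x.2)
        have h2 := congrArg (fun y => r • y) (mul_one x.1 x.2)
        have h3 := h1.trans h2.symm
        change GradedMonoid.mk _ (r • mul 0 x.1 one x.2) =
          GradedMonoid.mk _ (r • mul x.1 0 x.2 one) at h3
        change GradedMonoid.mk _ (mul 0 x.1 (r • one) x.2) =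
          GradedMonoid.mk _ (mul x.1 0 x.2 (r • one))
        rw [map_smul, map_smul, LinearMap.smul_apply]
        exact h3
      smul_def := fun r x => by
        have h1 := congrArg (fun y => r • y) (one_mul x.1 x.2)
        change GradedMonoid.mk _ (r • mul 0 x.1 one x.2) = r • x at h1
        rw [← h1]
        change _ = GradedMonoid.mk _ (mul 0 x.1 (r • one) x.2)
        rw [map_smul, LinearMap.smul_apply] }
  { comp := comp
    gring := gring
    galgebra := galgebra
    one_ne_zero := fun h => one_ne_zero (DirectSum.of_injective (β := comp) 0 (by
      rw [map_zero]; exact h))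
    integral := fun α β v w h => integral α β v w fun h0 => h (by
      rw [DirectSum.of_mul_of]
      change DirectSum.of comp _ (mul α β v w) = 0
      rw [h0, map_zero])
    comm := fun α β v w n hn => by
      rw [DirectSum.of_mul_of, DirectSum.of_mul_of, ← map_zsmul]
      exact DirectSum.of_eq_of_gradedMonoid_eq (comm α β v w n hn) }

open GradedMonoid in
/-- A good AH pair: `A^0 = ℂ1`, and products of nonzero homogeneous elements are nonzero. -/
structure IsGood (A : AHPair.{u, v} B) : Prop where
  comp_zero : ∀ v : A.comp 0, ∃ c : ℂ, v = c • (GOne.one : A.comp 0)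
  mul_ne_zero : ∀ (α β : H) (v : A.comp α) (w : A.comp β), v ≠ 0 → w ≠ 0 →
    DirectSum.of A.comp α v * DirectSum.of A.comp β w ≠ 0

end AHPair

/-- A homomorphism of AH pairs `(f, f') : (A, H) → (A', H')`. -/
@[ext]
structure AHHom {H' : Type w} [AddCommGroup H'] [Module ℂ H'] {B' : LinearMap.BilinForm ℂ H'}
    (A : AHPair.{u, v} B) (A' : AHPair.{w, x} B') where
  toAlgHom : A.Alg →ₐ[ℂ] A'.Alg
  isom : H ≃ₗ[ℂ] H'
  isom_form : ∀ x y : H, B' (isom x) (isom y) = B x y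
  map_comp : ∀ (α : H) (v : A.comp α), ∃ w : A'.comp (isom α),
    toAlgHom (DirectSum.of A.comp α v) = DirectSum.of A'.comp (isom α) w

variable (B) in
/-- An even `H`-lattice: a subgroup `L` of `H` on which the form is integral and even. -/
structure EvenLattice where
  carrier : AddSubgroup H
  integral : ∀ α ∈ carrier, ∀ β ∈ carrier, ∃ n : ℤ, B α β = n
  even : ∀ α ∈ carrier, ∃ n : ℤ, B α α = 2 * n

namespace AHPair

theorem mem_ite_iff {M : Type*} [AddCommGroup M] [Module ℂ M] {p : Prop} {x : M} :
    x ∈ (if p then ⊤ else ⊥ : Submodule ℂ M) ↔ (¬ p → x = 0) := by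
  split_ifs with h <;> simp [h]

theorem mk_eq_of_of_eq {A : AHPair.{u, v} B} {α β : H} (h : α = β) {v : A.comp α}
    {w : A.comp β} (hvw : DirectSum.of A.comp α v = DirectSum.of A.comp β w) :
    GradedMonoid.mk α v = GradedMonoid.mk β w := by
  subst h
  rw [DirectSum.of_injective α hvw]

theorem gOne_ne_zero (A : AHPair.{u, v} B) : (GradedMonoid.GOne.one : A.comp 0) ≠ 0 := fun h =>
  A.one_ne_zero (by rw [DirectSum.one_def, h, map_zero])

theorem IsGood.exists_ne_zero {A : AHPair.{u, v} B} (hA : A.IsGood) {α β : H}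
    (h1 : ∃ v : A.comp α, v ≠ 0) (h2 : ∃ v : A.comp β, v ≠ 0) :
    ∃ v : A.comp (α + β), v ≠ 0 := by
  obtain ⟨v, hv⟩ := h1
  obtain ⟨w, hw⟩ := h2
  have h := hA.mul_ne_zero α β v w hv hw
  rw [DirectSum.of_mul_of] at h
  exact ⟨GradedMonoid.GMul.mul v w, fun h0 => h (by rw [h0, map_zero])⟩

/-- The AH pair `A_N = ⨁_{α ∈ N} A^α` for a submonoid `N` of `H`. -/
def restrict (A : AHPair.{u, v} B) (N : AddSubmonoid H) : AHPair.{u, v} B :=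
  ofMul (fun α => (if α ∈ N then ⊤ else ⊥ : Submodule ℂ (A.comp α)))
    (fun α β => LinearMap.mk₂ ℂ
      (fun a b => ⟨DirectSum.gMulLHom ℂ A.comp a.1 b.1, mem_ite_iff.2 fun hN => by
        by_cases h1 : α ∈ N
        · rw [mem_ite_iff.1 b.2 fun h2 => hN (N.add_mem h1 h2), map_zero]
        · rw [mem_ite_iff.1 a.2 h1, map_zero, LinearMap.zero_apply]⟩)
      (fun a a' b => Subtype.ext (by simp only [Submodule.coe_add, map_add, LinearMap.add_apply]))
      (fun c a b => Subtype.ext (by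
        simp only [Submodule.coe_smul, map_smul, LinearMap.smul_apply]))
      (fun a b b' => Subtype.ext (by simp only [Submodule.coe_add, map_add]))
      (fun c a b => Subtype.ext (by simp only [Submodule.coe_smul, map_smul])))
    ⟨GradedMonoid.GOne.one, mem_ite_iff.2 fun h => absurd N.zero_mem h⟩
    (fun α a => (Function.injective_id.sigma_map fun _ => Subtype.val_injective) (by
      exact GradedMonoid.GMonoid.one_mul (⟨α, a.1⟩ : GradedMonoid A.comp)))
    (fun α a => (Function.injective_id.sigma_map fun _ => Subtype.val_injective) (by
      exact GradedMonoid.GMonoid.mul_one (⟨α, a.1⟩ : GradedMonoid A.comp)))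
    (fun α β γ a b c => (Function.injective_id.sigma_map fun _ => Subtype.val_injective) (by
      exact GradedMonoid.GMonoid.mul_assoc (⟨α, a.1⟩ : GradedMonoid A.comp) ⟨β, b.1⟩ ⟨γ, c.1⟩))
    (fun h => A.one_ne_zero (by
      have h' : (GradedMonoid.GOne.one : A.comp 0) = 0 := Subtype.ext_iff.1 h
      rw [DirectSum.one_def, h', map_zero]))
    (fun α β a b h => A.integral α β a.1 b.1 fun h0 => h (Subtype.ext (by
      rw [DirectSum.of_mul_of] at h0
      exact DirectSum.of_injective (β := A.comp) _ (h0.trans (map_zero _).symm))))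
    (fun α β a b n hn => (Function.injective_id.sigma_map fun _ => Subtype.val_injective) (by
      have h := A.comm α β a.1 b.1 n hn
      rw [DirectSum.of_mul_of, DirectSum.of_mul_of, ← map_zsmul] at h
      exact mk_eq_of_of_eq (add_comm _ _) h))

/-- The maximal lattice `L_{A,H} = {α | A^α ≠ 0 and A^{-α} ≠ 0}` of a good AH pair. -/
def IsGood.lattice {A : AHPair.{u, v} B} (hA : A.IsGood) : EvenLattice B where
  carrier :=
    { carrier := {α | (∃ v : A.comp α, v ≠ 0) ∧ ∃ v : A.comp (-α), v ≠ 0}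
      zero_mem' := ⟨⟨_, A.gOne_ne_zero⟩, by rw [neg_zero]; exact ⟨_, A.gOne_ne_zero⟩⟩
      add_mem' := by
        rintro α β ⟨h1, h2⟩ ⟨h3, h4⟩
        exact ⟨hA.exists_ne_zero h1 h3, by rw [neg_add]; exact hA.exists_ne_zero h2 h4⟩
      neg_mem' := by
        rintro α ⟨h1, h2⟩
        exact ⟨h2, by rwa [neg_neg]⟩ }
  integral := by
    rintro α ⟨⟨v, hv⟩, -⟩ β ⟨⟨w, hw⟩, -⟩
    exact A.integral α β v w (hA.mul_ne_zero α β v w hv hw)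
  even := by
    rintro α ⟨⟨v, hv⟩, -⟩
    have h := hA.mul_ne_zero α α v v hv hv
    obtain ⟨n, hn⟩ := A.integral α α v v h
    rcases Int.even_or_odd' n with ⟨k, rfl | rfl⟩
    · exact ⟨k, by rw [hn]; push_cast; ring⟩
    · exfalso
      have h2 := A.comm α α v v _ hn
      rw [Int.negOnePow_odd _ ⟨k, rfl⟩] at h2
      simp only [Units.val_neg, Units.val_one, neg_smul, one_smul] at h2
      have h3 : (2 : ℂ) • (DirectSum.of A.comp α v * DirectSum.of A.comp α v) = 0 := by
        rw [two_smul]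
        exact eq_neg_iff_add_eq_zero.1 h2
      exact h ((smul_eq_zero.1 h3).resolve_left two_ne_zero)

/-- The lattice pair `A^lat = ⨁_{α ∈ L_{A,H}} A^α` of a good AH pair. -/
def IsGood.lat {A : AHPair.{u, v} B} (hA : A.IsGood) : AHPair.{u, v} B :=
  A.restrict hA.lattice.carrier.toAddSubmonoid

/-- The inclusion of `A^lat` in `A`, on homogeneous components. -/
def IsGood.latIncl {A : AHPair.{u, v} B} (hA : A.IsGood) (α : H) :
    hA.lat.comp α →ₗ[ℂ] A.comp α :=
  (if α ∈ hA.lattice.carrier.toAddSubmonoid then ⊤ else ⊥ : Submodule ℂ (A.comp α)).subtype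

theorem exists_bilin_of_alt {Q : Type*} [AddCommGroup Q] [Module (ZMod 2) Q]
    (C : Q →ₗ[ZMod 2] Q →ₗ[ZMod 2] ZMod 2) (hC : ∀ x, C x x = 0) :
    ∃ e : Q →ₗ[ZMod 2] Q →ₗ[ZMod 2] ZMod 2, ∀ x y, e x y = C x y + e y x := by
  let b := Module.Basis.ofVectorSpace (ZMod 2) Q
  let e : Q →ₗ[ZMod 2] Q →ₗ[ZMod 2] ZMod 2 := b.constr (ZMod 2) fun i =>
    b.constr (ZMod 2) fun j => if WellOrderingRel i j then C (b i) (b j) else 0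
  have he : ∀ i j, e (b i) (b j) = if WellOrderingRel i j then C (b i) (b j) else 0 := by
    intro i j
    simp only [e, Module.Basis.constr_basis]
  have key : e = C + e.flip := by
    refine b.ext fun i => b.ext fun j => ?_
    rw [LinearMap.add_apply, LinearMap.add_apply, LinearMap.flip_apply, he, he]
    rcases trichotomous_of WellOrderingRel i j with h | h | h
    · rw [if_pos h, if_neg (asymm h), add_zero]
    · subst h
      rw [if_neg (irrefl i), hC, zero_add]
    · rw [if_neg (asymm h), if_pos h]
      have h2 := hC (b i + b j)
      simp only [map_add, LinearMap.add_apply, hC] at h2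
      rw [← h2]
      ring
  exact ⟨e, fun x y => by
    conv_lhs => rw [key]
    rfl⟩

end AHPair

namespace EvenLattice

/-- A normalized 2-cocycle `ε` on `L` with values `±1` and commutator map
`ε(α, β) ε(β, α)⁻¹ = (-1)^(α, β)`. -/
structure IsCocycle (L : EvenLattice B) (ε : L.carrier → L.carrier → ℤˣ) : Prop where
  zero_left : ∀ α, ε 0 α = 1
  zero_right : ∀ α, ε α 0 = 1
  cocycle : ∀ α β γ, ε α β * ε (α + β) γ = ε α (β + γ) * ε β γ
  comm : ∀ (α β : L.carrier) (n : ℤ), B α β = n → ε α β = Int.negOnePow n * ε β α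

theorem exists_isCocycle (L : EvenLattice B) : ∃ ε, L.IsCocycle ε := by
  have hint : ∀ α β : L.carrier, ((⌊(B α β).re⌋ : ℤ) : ℂ) = B α β := by
    intro α β
    obtain ⟨n, hn⟩ := L.integral α α.2 β β.2
    rw [hn]
    simp
  let C0 : L.carrier →ₗ[ℤ] L.carrier →ₗ[ℤ] ℤ := LinearMap.mk₂ ℤ (fun α β => ⌊(B α β).re⌋)
    (fun α α' β => by
      have : ((⌊(B ↑(α + α') β).re⌋ : ℤ) : ℂ) = (⌊(B α β).re⌋ + ⌊(B α' β).re⌋ : ℤ) := by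
        rw [Int.cast_add, hint, hint, hint]
        simp
      exact_mod_cast this)
    (fun c α β => by
      have : ((⌊(B ↑(c • α) β).re⌋ : ℤ) : ℂ) = (c • ⌊(B α β).re⌋ : ℤ) := by
        rw [hint, smul_eq_mul]
        push_cast
        rw [hint]
        simp [map_zsmul]
      exact_mod_cast this)
    (fun α β β' => by
      have : ((⌊(B α ↑(β + β')).re⌋ : ℤ) : ℂ) = (⌊(B α β).re⌋ + ⌊(B α β').re⌋ : ℤ) := by
        rw [Int.cast_add, hint, hint, hint]
        simp
      exact_mod_cast this)
    (fun c α β => by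
      have : ((⌊(B α ↑(c • β)).re⌋ : ℤ) : ℂ) = (c • ⌊(B α β).re⌋ : ℤ) := by
        rw [hint, smul_eq_mul]
        push_cast
        rw [hint]
        simp [map_zsmul]
      exact_mod_cast this)
  let C := LinearMap.BilinForm.baseChange (ZMod 2) C0
  have hpure : ∀ x : ZMod 2 ⊗[ℤ] L.carrier, ∃ α : L.carrier, x = 1 ⊗ₜ α := by
    intro x
    induction x using TensorProduct.induction_on with
    | zero => exact ⟨0, by rw [TensorProduct.tmul_zero]⟩
    | tmul a α =>
      refine ⟨(a.val : ℤ) • α, ?_⟩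
      rw [← TensorProduct.smul_tmul]
      simp
    | add x y hx hy =>
      obtain ⟨α, rfl⟩ := hx
      obtain ⟨β, rfl⟩ := hy
      exact ⟨α + β, by rw [TensorProduct.tmul_add]⟩
  have hC : ∀ α β : L.carrier, C (1 ⊗ₜ α) (1 ⊗ₜ β) = ((C0 α β : ℤ) : ZMod 2) := by
    intro α β
    simp [C]
  obtain ⟨e, he⟩ := AHPair.exists_bilin_of_alt C fun x => by
    obtain ⟨α, rfl⟩ := hpure x
    obtain ⟨n, hn⟩ := L.even α α.2
    have h1 : C0 α α = 2 * n := by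
      change ⌊(B α α).re⌋ = _
      rw [hn, show (2 * (n : ℂ)) = ((2 * n : ℤ) : ℂ) by push_cast; rfl, Complex.intCast_re,
        Int.floor_intCast]
    rw [hC, h1, Int.cast_mul]
    exact zero_mul _
  refine ⟨fun α β => (-1) ^ e (1 ⊗ₜ α) (1 ⊗ₜ β), ?_, ?_, ?_, ?_⟩
  · intro α
    simp
  · intro α
    simp
  · intro α β γ
    rw [← uzpow_add, ← uzpow_add, TensorProduct.tmul_add, TensorProduct.tmul_add, map_add, map_add,
      LinearMap.add_apply]
    congr 1
    ring
  · intro α β n hn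
    have h1 : C0 α β = n := by
      change ⌊(B α β).re⌋ = _
      rw [hn, Complex.intCast_re, Int.floor_intCast]
    rw [he, uzpow_add, hC, h1, uzpow_intCast]
    rfl

/-- A chosen cocycle of an even `H`-lattice. -/
def ε (L : EvenLattice B) : L.carrier → L.carrier → ℤˣ := L.exists_isCocycle.choose

theorem ε_spec (L : EvenLattice B) : L.IsCocycle L.ε := L.exists_isCocycle.choose_spec

/-- The cocycle, extended by `1` to all of `H`. -/
def sgn (L : EvenLattice B) (α β : H) : ℤˣ :=
  if h : α ∈ L.carrier ∧ β ∈ L.carrier then L.ε ⟨α, h.1⟩ ⟨β, h.2⟩ else 1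

theorem sgn_of_mem (L : EvenLattice B) {α β : H} (hα : α ∈ L.carrier) (hβ : β ∈ L.carrier) :
    L.sgn α β = L.ε ⟨α, hα⟩ ⟨β, hβ⟩ := dif_pos ⟨hα, hβ⟩

open AHPair in
/-- The lattice pair `A_{L,H}`, i.e. the twisted group algebra `⨁_{α ∈ L} ℂ e_α`,
`e_α e_β = ε(α, β) e_{α+β}`. -/
def toAHPair (L : EvenLattice B) : AHPair.{u, 0} B :=
  AHPair.ofMul (fun α => (if α ∈ L.carrier then ⊤ else ⊥ : Submodule ℂ ℂ))
    (fun α β => LinearMap.mk₂ ℂ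
      (fun a b => ⟨((L.sgn α β : ℤ) : ℂ) * (a.1 * b.1), mem_ite_iff.2 fun hL => by
        by_cases h1 : α ∈ L.carrier
        · rw [mem_ite_iff.1 b.2 fun h2 => hL (L.carrier.add_mem h1 h2), mul_zero, mul_zero]
        · rw [mem_ite_iff.1 a.2 h1, zero_mul, mul_zero]⟩)
      (fun a a' b => Subtype.ext (by simp only [Submodule.coe_add]; ring))
      (fun c a b => Subtype.ext (by simp only [Submodule.coe_smul, smul_eq_mul]; ring))
      (fun a b b' => Subtype.ext (by simp only [Submodule.coe_add]; ring))
      (fun c a b => Subtype.ext (by simp only [Submodule.coe_smul, smul_eq_mul]; ring)))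
    ⟨1, mem_ite_iff.2 fun h => absurd L.carrier.zero_mem h⟩
    (fun α a => Sigma.subtype_ext (zero_add α) (by
      change ((L.sgn 0 α : ℤ) : ℂ) * (1 * a.1) = a.1
      by_cases h1 : α ∈ L.carrier
      · rw [L.sgn_of_mem L.carrier.zero_mem h1, show (⟨0, _⟩ : L.carrier) = 0 from rfl,
          L.ε_spec.zero_left]
        simp
      · rw [mem_ite_iff.1 a.2 h1, mul_zero, mul_zero]))
    (fun α a => Sigma.subtype_ext (add_zero α) (by
      change ((L.sgn α 0 : ℤ) : ℂ) * (a.1 * 1) = a.1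
      by_cases h1 : α ∈ L.carrier
      · rw [L.sgn_of_mem h1 L.carrier.zero_mem, show (⟨0, _⟩ : L.carrier) = 0 from rfl,
          L.ε_spec.zero_right]
        simp
      · rw [mem_ite_iff.1 a.2 h1, zero_mul, mul_zero]))
    (fun α β γ a b c => Sigma.subtype_ext (add_assoc α β γ) (by
      change ((L.sgn (α + β) γ : ℤ) : ℂ) * ((((L.sgn α β : ℤ) : ℂ) * (a.1 * b.1)) * c.1) =
        ((L.sgn α (β + γ) : ℤ) : ℂ) * (a.1 * (((L.sgn β γ : ℤ) : ℂ) * (b.1 * c.1)))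
      by_cases h1 : α ∈ L.carrier
      · by_cases h2 : β ∈ L.carrier
        · by_cases h3 : γ ∈ L.carrier
          · have h := L.ε_spec.cocycle ⟨α, h1⟩ ⟨β, h2⟩ ⟨γ, h3⟩
            rw [L.sgn_of_mem (L.carrier.add_mem h1 h2) h3, L.sgn_of_mem h1 h2,
              L.sgn_of_mem h1 (L.carrier.add_mem h2 h3), L.sgn_of_mem h2 h3]
            have h' := congrArg (fun x : ℤˣ => ((x : ℤ) : ℂ)) h
            simp only [Units.val_mul, Int.cast_mul, AddMemClass.mk_add_mk] at h'
            linear_combination (a.1 * b.1 * c.1) * h'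
          · rw [mem_ite_iff.1 c.2 h3]
            simp
        · rw [mem_ite_iff.1 b.2 h2]
          simp
      · rw [mem_ite_iff.1 a.2 h1]
        simp))
    (fun h => one_ne_zero (Subtype.ext_iff.1 h))
    (fun α β a b h => by
      by_cases h1 : α ∈ L.carrier
      · by_cases h2 : β ∈ L.carrier
        · exact L.integral α h1 β h2
        · refine absurd (Subtype.ext ?_) h
          change ((L.sgn α β : ℤ) : ℂ) * (a.1 * b.1) = 0
          rw [mem_ite_iff.1 b.2 h2]
          simp
      · refine absurd (Subtype.ext ?_) h
        change ((L.sgn α β : ℤ) : ℂ) * (a.1 * b.1) = 0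
        rw [mem_ite_iff.1 a.2 h1]
        simp)
    (fun α β a b n hn => Sigma.subtype_ext (add_comm α β) (by
      change ((L.sgn α β : ℤ) : ℂ) * (a.1 * b.1) =
        (Int.negOnePow n : ℤ) • (((L.sgn β α : ℤ) : ℂ) * (b.1 * a.1))
      by_cases h1 : α ∈ L.carrier
      · by_cases h2 : β ∈ L.carrier
        · rw [L.sgn_of_mem h1 h2, L.sgn_of_mem h2 h1, L.ε_spec.comm ⟨α, h1⟩ ⟨β, h2⟩ n hn]
          simp only [Units.val_mul, Int.cast_mul, zsmul_eq_mul]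
          ring
        · rw [mem_ite_iff.1 b.2 h2]
          simp
      · rw [mem_ite_iff.1 a.2 h1]
        simp))

end EvenLattice

end AH

/-! ### The functor `Ω` -/

section Omega

variable {V : Type u} [AddCommGroup V] [Module ℂ V] [VertexAlgebra V] {H : Submodule ℂ V}

/-- The AH pair `Ω(V, H)` of a VH pair `(V, H)`: the graded algebra `⨁ α, Ω_{V,H}^α` with the
product `vw = v(-(α, β) - 1)w` for `v ∈ Ω^α`, `w ∈ Ω^β`. -/
def Omega (hH : IsHeisenberg H) : AHPair.{u, u} (heisForm hH) :=
  AHPair.ofMul (fun α => vacSpace hH α)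
    (fun α β => LinearMap.mk₂ ℂ
      (fun v w => ⟨vacMul hH α β v w, vacMul_mem v.2 w.2⟩)
      (fun a a' b => Subtype.ext (by simp only [Submodule.coe_add, map_add, LinearMap.add_apply]))
      (fun c a b => Subtype.ext (by
        simp only [Submodule.coe_smul, map_smul, LinearMap.smul_apply]))
      (fun a b b' => Subtype.ext (by simp only [Submodule.coe_add, map_add]))
      (fun c a b => Subtype.ext (by simp only [Submodule.coe_smul, map_smul])))
    ⟨vac, vac_mem⟩
    (fun α a => Sigma.subtype_ext (zero_add α) (by
      change vacMul hH 0 α vac a.1 = a.1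
      rw [vacMul_of_int (n := 0) (by simp), vac_nprod]
      simp))
    (fun α a => Sigma.subtype_ext (add_zero α) (by
      change vacMul hH α 0 a.1 vac = a.1
      rw [vacMul_of_int (n := 0) (by simp)]
      simp [VertexAlgebra.nprod_neg_one_vac]))
    (fun α β γ a b c => Sigma.subtype_ext (add_assoc α β γ) (vacMul_assoc a.2 b.2 c.2))
    (fun h => VertexAlgebra.vac_ne_zero (Subtype.ext_iff.1 h))
    (fun α β a b h => by
      by_contra hn
      refine h (Subtype.ext ?_)
      change vacMul hH α β a.1 b.1 = 0
      rw [vacMul_of_not_int hn]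
      rfl)
    (fun α β a b n hn => Sigma.subtype_ext (add_comm α β) (vacMul_comm a.2 b.2 hn))

/-- The inclusion of `Ω_{V,H}^α` in `V`. -/
def Omega.val (hH : IsHeisenberg H) (α : H) : (Omega hH).comp α →ₗ[ℂ] V :=
  (vacSpace hH α).subtype

end Omega

/-! ### The functor `𝒱` -/

section Fock

variable (H : Type u) [AddCommGroup H] [Module ℂ H]

/-- The Fock space `M_H(0)`: the symmetric algebra on `H ⊗ t⁻¹ℂ[t⁻¹]`, with `h ⊗ t^(-n-1)`
represented by `Finsupp.single n h`. -/
abbrev Fock : Type u := SymmetricAlgebra ℂ (ℕ →₀ H)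

/-- Laurent polynomials in `z` with coefficients in the Fock space. -/
abbrev FockPoly : Type u := Fock H ⊗[ℂ] LaurentPolynomial ℂ

/-- Laurent series in `z` with coefficients in the Fock space. -/
abbrev FockSeries : Type u := LaurentSeries (Fock H)

variable {H}

instance : Algebra ℂ (FockSeries H) := HahnSeries.instAlgebra

instance : SMulCommClass ℂ (FockSeries H) (FockSeries H) :=
  ⟨fun c x y => (Algebra.mul_smul_comm c x y).symm⟩

instance : IsScalarTower ℂ (FockSeries H) (FockSeries H) :=
  ⟨fun c x y => Algebra.smul_mul_assoc c x y⟩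

/-- The element `h(-n-1)` of the Fock space. -/
def gen (n : ℕ) : H →ₗ[ℂ] Fock H := SymmetricAlgebra.ι ℂ (ℕ →₀ H) ∘ₗ Finsupp.lsingle n

/-- Homomorphisms from a symmetric algebra given by commuting elements. -/
theorem symm_lift_exists {M N : Type*} [AddCommGroup M] [Module ℂ M] [AddCommGroup N] [Module ℂ N]
    (f : M →ₗ[ℂ] Module.End ℂ N) (hf : ∀ x y, f x * f y = f y * f x) :
    ∃ F : SymmetricAlgebra ℂ M →ₐ[ℂ] Module.End ℂ N, ∀ x, F (SymmetricAlgebra.ι ℂ M x) = f x := by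
  have hc : IsMulCommutative (Algebra.adjoin ℂ (Set.range f)) :=
    Algebra.isMulCommutative_adjoin ℂ (by
      rintro _ ⟨x, rfl⟩ _ ⟨y, rfl⟩
      exact hf x y)
  let _ : CommSemiring (Algebra.adjoin ℂ (Set.range f)) :=
    { (Algebra.adjoin ℂ (Set.range f)).toSemiring with mul_comm := hc.is_comm.comm }
  let g : M →ₗ[ℂ] Algebra.adjoin ℂ (Set.range f) :=
    f.codRestrict (Subalgebra.toSubmodule (Algebra.adjoin ℂ (Set.range f)))
      (fun x => Algebra.subset_adjoin ⟨x, rfl⟩)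
  refine ⟨(Algebra.adjoin ℂ (Set.range f)).val.comp (SymmetricAlgebra.lift g), fun x => ?_⟩
  rw [AlgHom.comp_apply, SymmetricAlgebra.lift_ι_apply]
  rfl

/-- The algebra homomorphism out of a symmetric algebra determined by commuting operators. -/
def symmLift {M N : Type*} [AddCommGroup M] [Module ℂ M] [AddCommGroup N] [Module ℂ N]
    (f : M →ₗ[ℂ] Module.End ℂ N) (hf : ∀ x y, f x * f y = f y * f x) :
    SymmetricAlgebra ℂ M →ₐ[ℂ] Module.End ℂ N := (symm_lift_exists f hf).choose

theorem symmLift_ι {M N : Type*} [AddCommGroup M] [Module ℂ M] [AddCommGroup N] [Module ℂ N]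
    (f : M →ₗ[ℂ] Module.End ℂ N) (hf : ∀ x y, f x * f y = f y * f x) (x : M) :
    symmLift f hf (SymmetricAlgebra.ι ℂ M x) = f x := (symm_lift_exists f hf).choose_spec x

/-- The algebra homomorphism `m ↦ m + φ(m) ε` into the dual numbers over `M_H(0)[z^±]`. -/
def fockDual (φ : (ℕ →₀ H) →ₗ[ℂ] LaurentPolynomial ℂ) :
    FockPoly H →ₐ[ℂ] TrivSqZeroExt (FockPoly H) (FockPoly H) :=
  Algebra.TensorProduct.lift (C := TrivSqZeroExt (FockPoly H) (FockPoly H))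
    (SymmetricAlgebra.lift (R := ℂ) (A := TrivSqZeroExt (FockPoly H) (FockPoly H))
      ((TrivSqZeroExt.inlAlgHom ℂ (FockPoly H) (FockPoly H)).toLinearMap ∘ₗ
          (Algebra.TensorProduct.includeLeft (R := ℂ) (S := ℂ)).toLinearMap ∘ₗ
            SymmetricAlgebra.ι ℂ (ℕ →₀ H) +
        (TrivSqZeroExt.inrHom (FockPoly H) (FockPoly H)).restrictScalars ℂ ∘ₗ
          (Algebra.TensorProduct.includeRight (R := ℂ)).toLinearMap ∘ₗ φ))
    ((TrivSqZeroExt.inlAlgHom ℂ (FockPoly H) (FockPoly H)).comp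
      Algebra.TensorProduct.includeRight)
    (fun _ _ => mul_comm (G := TrivSqZeroExt (FockPoly H) (FockPoly H)) _ _)

/-- The `ℂ[z^±]`-linear derivation of `M_H(0)[z^±]` with `m ↦ φ(m)` on the generators of the
symmetric algebra. -/
def fockDer (φ : (ℕ →₀ H) →ₗ[ℂ] LaurentPolynomial ℂ) : FockPoly H →ₗ[ℂ] FockPoly H :=
  (TrivSqZeroExt.sndHom (FockPoly H) (FockPoly H)).restrictScalars ℂ ∘ₗ
    (fockDual φ).toLinearMap

theorem fockDer_ι (φ : (ℕ →₀ H) →ₗ[ℂ] LaurentPolynomial ℂ) (x : ℕ →₀ H) :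
    fockDer φ (SymmetricAlgebra.ι ℂ _ x ⊗ₜ 1) = 1 ⊗ₜ φ x := by
  simp [fockDer, fockDual]

theorem fockDer_right (φ : (ℕ →₀ H) →ₗ[ℂ] LaurentPolynomial ℂ) (r : LaurentPolynomial ℂ) :
    fockDer φ (1 ⊗ₜ r) = 0 := by
  simp [fockDer, fockDual]

theorem fockDer_mul (φ : (ℕ →₀ H) →ₗ[ℂ] LaurentPolynomial ℂ) (x y : FockPoly H) :
    fockDer φ (x * y) = x * fockDer φ y + fockDer φ x * y := by
  have key : (TrivSqZeroExt.fstHom ℂ (FockPoly H) (FockPoly H)).comp (fockDual φ) =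
      AlgHom.id ℂ _ := by
    refine Algebra.TensorProduct.ext (SymmetricAlgebra.algHom_ext (LinearMap.ext fun x => ?_))
      (AlgHom.ext fun r => ?_)
    · simp [fockDual]
    · simp [fockDual]
  have h := fun x => DFunLike.congr_fun key x
  simp only [AlgHom.comp_apply, AlgHom.id_apply, TrivSqZeroExt.fstHom_apply] at h
  simp only [fockDer, LinearMap.comp_apply, AlgHom.toLinearMap_apply, map_mul,
    LinearMap.restrictScalars_apply, TrivSqZeroExt.sndHom_apply, TrivSqZeroExt.snd_mul, h]
  simp [mul_comm]

/-- A `ℂ`-linear map satisfying the Leibniz rule and vanishing on generators is zero. -/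
theorem fock_leibniz_eq_zero (d : FockPoly H →ₗ[ℂ] FockPoly H)
    (hm : ∀ x y, d (x * y) = x * d y + d x * y)
    (hι : ∀ x, d (SymmetricAlgebra.ι ℂ _ x ⊗ₜ 1) = 0) (hr : ∀ r, d (1 ⊗ₜ r) = 0) : d = 0 := by
  have hs : ∀ s : Fock H, d (s ⊗ₜ 1) = 0 := by
    intro s
    induction s using SymmetricAlgebra.induction with
    | algebraMap c =>
      have := hr (algebraMap ℂ _ c)
      rwa [← Algebra.TensorProduct.algebraMap_apply', Algebra.TensorProduct.algebraMap_apply] at this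
    | ι x => exact hι x
    | mul a b ha hb =>
      have := hm (a ⊗ₜ 1) (b ⊗ₜ 1)
      rwa [ha, hb, mul_zero, zero_mul, add_zero, Algebra.TensorProduct.tmul_mul_tmul, mul_one]
        at this
    | add a b ha hb => rw [TensorProduct.add_tmul, map_add, ha, hb, add_zero]
  refine TensorProduct.ext' fun s r => ?_
  have := hm (s ⊗ₜ 1) (1 ⊗ₜ r)
  rw [hs, hr, mul_zero, zero_mul, add_zero, Algebra.TensorProduct.tmul_mul_tmul, mul_one,
    one_mul] at this
  simpa using this

theorem fockDer_add (φ ψ : (ℕ →₀ H) →ₗ[ℂ] LaurentPolynomial ℂ) :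
    fockDer (φ + ψ) = fockDer φ + fockDer ψ := by
  refine sub_eq_zero.1 (fock_leibniz_eq_zero _ (fun x y => ?_) (fun x => ?_) fun r => ?_)
  · simp only [LinearMap.sub_apply, LinearMap.add_apply, fockDer_mul]
    ring
  · simp [fockDer_ι, TensorProduct.tmul_add]
  · simp [fockDer_right]

theorem fockDer_smul (c : ℂ) (φ : (ℕ →₀ H) →ₗ[ℂ] LaurentPolynomial ℂ) :
    fockDer (c • φ) = c • fockDer φ := by
  refine sub_eq_zero.1 (fock_leibniz_eq_zero _ (fun x y => ?_) (fun x => ?_) fun r => ?_)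
  · simp only [LinearMap.sub_apply, LinearMap.smul_apply, fockDer_mul, smul_add,
      mul_sub, sub_mul, mul_smul_comm, smul_mul_assoc]
    abel
  · simp [fockDer_ι]
  · simp [fockDer_right]

theorem fockDer_comm (φ ψ : (ℕ →₀ H) →ₗ[ℂ] LaurentPolynomial ℂ) :
    fockDer φ ∘ₗ fockDer ψ = fockDer ψ ∘ₗ fockDer φ := by
  refine sub_eq_zero.1 (fock_leibniz_eq_zero _ (fun x y => ?_) (fun x => ?_) fun r => ?_)
  · simp only [LinearMap.sub_apply, LinearMap.comp_apply, fockDer_mul, map_add]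
    ring
  · simp [fockDer_ι, fockDer_right]
  · simp [fockDer_right]

variable (B : LinearMap.BilinForm ℂ H)

theorem ofPowerSeries_smul (c : ℂ) (f : PowerSeries (Fock H)) :
    HahnSeries.ofPowerSeries ℤ (Fock H) (c • f) = c • HahnSeries.ofPowerSeries ℤ (Fock H) f := by
  ext k
  rw [HahnSeries.coeff_smul]
  rcases lt_or_ge k 0 with h | h
  · rw [HahnSeries.ofPowerSeries_apply, HahnSeries.ofPowerSeries_apply,
      HahnSeries.embDomain_of_notMem_range, HahnSeries.embDomain_of_notMem_range, smul_zero] <;>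
    · rintro ⟨n, hn⟩
      simp at hn
      omega
  · lift k to ℕ using h
    simp

/-- The creation part `(1/n!) ∂_z^n ∑_{j ≥ 0} h(-j-1) z^j` of the field `(1/n!) ∂_z^n h(z)`. -/
def creation : (ℕ →₀ H) →ₗ[ℂ] FockSeries H :=
  Finsupp.lsum ℂ fun n =>
    { toFun := fun h => HahnSeries.ofPowerSeries ℤ (Fock H) <|
        PowerSeries.mk fun k => ((n + k).choose n : ℂ) • gen (n + k) h
      map_add' := fun h h' => by
        rw [← map_add]
        congr 1
        ext k
        simp [smul_add]
      map_smul' := fun c h => by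
        rw [RingHom.id_apply, ← ofPowerSeries_smul]
        congr 1
        ext k
        simp [smul_comm c] }

/-- The contraction of the field `(1/n!) ∂_z^n h(z)` with the vector `h'(-j-1)`:
the coefficient of `h(j+1)` in the field, times `[h(j+1), h'(-j-1)] = (j+1)(h, h')`. -/
def contraction : (ℕ →₀ H) →ₗ[ℂ] (ℕ →₀ H) →ₗ[ℂ] LaurentPolynomial ℂ :=
  Finsupp.lsum ℂ fun n => LinearMap.flip <| Finsupp.lsum ℂ fun j => LinearMap.flip <|
    B.compr₂ (LinearMap.toSpanSingleton ℂ _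
      (((Ring.choose (-(j : ℤ) - 2) n * (j + 1) : ℤ) : ℂ) •
        LaurentPolynomial.T (-(j : ℤ) - 2 - n)))

/-- The zero mode `(h, β) (1/n!) ∂_z^n z⁻¹` of `(1/n!) ∂_z^n h(z)` on the sector of charge `β`. -/
def zeroMode (β : H) : (ℕ →₀ H) →ₗ[ℂ] LaurentPolynomial ℂ :=
  Finsupp.lsum ℂ fun n => (LinearMap.toSpanSingleton ℂ _
      (((Ring.choose (-1 : ℤ) n : ℤ) : ℂ) • LaurentPolynomial.T (-1 - n))) ∘ₗ B.flip β

/-- The annihilation part (zero mode included) of `(1/n!) ∂_z^n h(z)` on the sector of charge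
`β`. -/
def annihilation (β : H) : (ℕ →₀ H) →ₗ[ℂ] Module.End ℂ (FockPoly H) where
  toFun x := fockDer (contraction B x) + LinearMap.mulLeft ℂ (1 ⊗ₜ zeroMode B β x)
  map_add' x y := by
    rw [map_add, fockDer_add, map_add, TensorProduct.tmul_add]
    refine LinearMap.ext fun p => ?_
    simp only [LinearMap.add_apply, LinearMap.mulLeft_apply, add_mul]
    abel
  map_smul' c x := by
    rw [map_smul, fockDer_smul, map_smul, TensorProduct.tmul_smul]
    refine LinearMap.ext fun p => ?_
    simp only [LinearMap.add_apply, LinearMap.smul_apply, LinearMap.mulLeft_apply,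
      smul_mul_assoc, smul_add, RingHom.id_apply]

theorem annihilation_comm (β : H) (x y : ℕ →₀ H) :
    annihilation B β x ∘ₗ annihilation B β y = annihilation B β y ∘ₗ annihilation B β x := by
  refine LinearMap.ext fun p => ?_
  have h := LinearMap.congr_fun (fockDer_comm (contraction B x) (contraction B y)) p
  simp only [LinearMap.comp_apply] at h
  simp only [annihilation, LinearMap.coe_mk, AddHom.coe_mk, LinearMap.comp_apply,
    LinearMap.add_apply, LinearMap.mulLeft_apply, map_add, fockDer_mul, fockDer_right, h]
  ring

/-- The normally ordered product with the field `(1/n!) ∂_z^n h(z)`: creation part on the left,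
annihilation part on the right. -/
def normalOrder (β : H) :
    (ℕ →₀ H) →ₗ[ℂ] Module.End ℂ (FockPoly H →ₗ[ℂ] FockSeries H) where
  toFun x :=
    { toFun := fun X => LinearMap.mulLeft ℂ (creation x) ∘ₗ X + X ∘ₗ annihilation B β x
      map_add' := fun X Y => by
        refine LinearMap.ext fun p => ?_
        simp only [LinearMap.add_apply, LinearMap.comp_apply, LinearMap.mulLeft_apply, mul_add]
        abel
      map_smul' := fun c X => by
        refine LinearMap.ext fun p => ?_
        simp only [LinearMap.add_apply, LinearMap.comp_apply, LinearMap.mulLeft_apply,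
          LinearMap.smul_apply, mul_smul_comm, smul_add, RingHom.id_apply] }
  map_add' x y := by
    refine LinearMap.ext fun X => LinearMap.ext fun p => ?_
    simp only [LinearMap.add_apply, LinearMap.comp_apply, LinearMap.mulLeft_apply,
      LinearMap.coe_mk, AddHom.coe_mk, map_add, add_mul]
    abel
  map_smul' c x := by
    refine LinearMap.ext fun X => LinearMap.ext fun p => ?_
    simp only [LinearMap.add_apply, LinearMap.comp_apply, LinearMap.mulLeft_apply,
      LinearMap.smul_apply, LinearMap.coe_mk, AddHom.coe_mk, map_smul, smul_mul_assoc, smul_add,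
      RingHom.id_apply]

theorem normalOrder_comm (β : H) (x y : ℕ →₀ H) :
    normalOrder B β x * normalOrder B β y = normalOrder B β y * normalOrder B β x := by
  refine LinearMap.ext fun X => LinearMap.ext fun p => ?_
  have h := LinearMap.congr_fun (annihilation_comm B β x y) p
  simp only [LinearMap.comp_apply] at h
  simp only [normalOrder, LinearMap.coe_mk, AddHom.coe_mk, Module.End.mul_apply,
    LinearMap.add_apply, LinearMap.comp_apply, LinearMap.mulLeft_apply, h, mul_add]
  ring

/-- The inclusion of Laurent polynomials into Laurent series. -/
def fockPolyToSeries : FockPoly H →ₗ[ℂ] FockSeries H :=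
  TensorProduct.lift <| LinearMap.flip <|
    Finsupp.lsum ℂ (fun k : ℤ => (LinearMap.toSpanSingleton ℂ _
      (HahnSeries.single.linearMap k : Fock H →ₗ[ℂ] FockSeries H))) ∘ₗ
        (AddMonoidAlgebra.coeffLinearEquiv ℂ).toLinearMap

/-- The power series `exp(∑_{n ≥ 1} α(-n) z^n / n)`. -/
def expPlus (α : H) : FockSeries H :=
  HahnSeries.ofPowerSeries ℤ (Fock H)
    ((PowerSeries.exp ℂ).subst (PowerSeries.mk fun n => (n : ℂ)⁻¹ • gen (n - 1) α))

/-- The operator `exp(-∑_{n ≥ 1} α(n) z^(-n) / n)`: as `∑ α(n) z^(-n) / n` is a derivation with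
`h(-n) ↦ (α, h) z^(-n)`, it is the algebra homomorphism with `h(-n) ↦ h(-n) - (α, h) z^(-n)`. -/
def expMinus (α : H) : FockPoly H →ₐ[ℂ] FockPoly H :=
  Algebra.TensorProduct.lift
    (SymmetricAlgebra.lift
      ((Algebra.TensorProduct.includeLeft (R := ℂ) (S := ℂ)).toLinearMap ∘ₗ
          SymmetricAlgebra.ι ℂ (ℕ →₀ H) -
        (Algebra.TensorProduct.includeRight (R := ℂ)).toLinearMap ∘ₗ
          (Finsupp.lsum ℂ (fun j : ℕ => (LinearMap.toSpanSingleton ℂ (LaurentPolynomial ℂ)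
            (LaurentPolynomial.T (-(j : ℤ) - 1))) ∘ₗ B α) :
              (ℕ →₀ H) →ₗ[ℂ] LaurentPolynomial ℂ)))
    Algebra.TensorProduct.includeRight (fun _ _ => mul_comm (G := FockPoly H) _ _)

/-- The first tensor factor `exp(∑_{n ≥ 1} α(-n) z^n / n) exp(-∑_{n ≥ 1} α(n) z^(-n) / n)` of
`Y(1 ⊗ a, z)`, for `a ∈ A^α`. -/
def vertexOp (α : H) : FockPoly H →ₗ[ℂ] FockSeries H :=
  LinearMap.mulLeft ℂ (expPlus α) ∘ₗ fockPolyToSeries ∘ₗ (expMinus B α).toLinearMap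

/-- The series `Y(u ⊗ a, z) (v ⊗ b) = fockField B α β u v z^(α, β) ⊗ ab`, for `a ∈ A^α` and
`b ∈ A^β`: for `u = h₁(-n₁-1) ⋯ h_k(-n_k-1)` it is the normally ordered product of the fields
`(1/n_i!) ∂_z^(n_i) h_i(z)` and `Y(1 ⊗ a, z)`. -/
def fockField (α β : H) : Fock H →ₗ[ℂ] Fock H →ₗ[ℂ] FockSeries H :=
  LinearMap.mk₂ ℂ
    (fun u v => symmLift (normalOrder B β) (normalOrder_comm B β) u (vertexOp B α) (v ⊗ₜ 1))
    (fun u u' v => by rw [map_add, LinearMap.add_apply, LinearMap.add_apply])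
    (fun c u v => by rw [map_smul, LinearMap.smul_apply, LinearMap.smul_apply])
    (fun u v v' => by rw [TensorProduct.add_tmul, map_add])
    (fun c u v => by rw [← TensorProduct.smul_tmul', map_smul])

/-- The coefficient of `z^k` in a Laurent series. -/
def fockCoeff (k : ℤ) : FockSeries H →ₗ[ℂ] Fock H where
  toFun f := f.coeff k
  map_add' _ _ := HahnSeries.coeff_add
  map_smul' _ _ := HahnSeries.coeff_smul

/-- The coefficient of `z^(-m-1)` in `fockField B α β u v z^(α, β)` if `(α, β)` is an integer.
(If it is not, then `ab = 0` for `a ∈ A^α` and `b ∈ A^β`, and the value is immaterial.) -/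
def fockMode (α β : H) (m : ℤ) : Fock H →ₗ[ℂ] Fock H →ₗ[ℂ] Fock H :=
  if ∃ n : ℤ, B α β = n then
    (fockField B α β).compr₂ (fockCoeff (-m - 1 - ⌊(B α β).re⌋)) else 0

end Fock

namespace AHPair

variable {H : Type u} [AddCommGroup H] [Module ℂ H] {B : LinearMap.BilinForm ℂ H}

/-- The space `V_{A,H} = ⨁ α, M_H(0) ⊗ A^α`. -/
def Vtx (A : AHPair.{u, v} B) : Type max u v := ⨁ α, Fock H ⊗[ℂ] A.comp α

instance (A : AHPair.{u, v} B) : AddCommGroup A.Vtx :=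
  inferInstanceAs (AddCommGroup (⨁ α, Fock H ⊗[ℂ] A.comp α))

instance (A : AHPair.{u, v} B) : Module ℂ A.Vtx :=
  inferInstanceAs (Module ℂ (⨁ α, Fock H ⊗[ℂ] A.comp α))

/-- The inclusion of the summand `M_H(0) ⊗ A^α` in `V_{A,H}`. -/
def Vtx.lof (A : AHPair.{u, v} B) (α : H) : Fock H ⊗[ℂ] A.comp α →ₗ[ℂ] A.Vtx :=
  DirectSum.lof ℂ H (fun α => Fock H ⊗[ℂ] A.comp α) α

/-- The vertex algebra structure of `V_{A,H}`. -/
instance (A : AHPair.{u, v} B) : PreVertexAlgebra A.Vtx where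
  vac := Vtx.lof A 0 (1 ⊗ₜ GradedMonoid.GOne.one)
  nprod m := DirectSum.toModule ℂ H _ fun α => LinearMap.flip <| DirectSum.toModule ℂ H _ fun β =>
    LinearMap.flip <|
      (TensorProduct.map₂ (fockMode B α β m) (DirectSum.gMulLHom ℂ A.comp)).compr₂
        (Vtx.lof A (α + β))

/-- The map `a ↦ 1 ⊗ a` from `A` to `V_{A,H}`. -/
def ofAlg (A : AHPair.{u, v} B) : A.Alg →ₗ[ℂ] A.Vtx :=
  DirectSum.toModule ℂ H _ fun α => Vtx.lof A α ∘ₗ TensorProduct.mk ℂ (Fock H) (A.comp α) 1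

/-- The map `h ↦ h(-1)1 ⊗ 1` from `H` to `V_{A,H}`. -/
def ofHeis (A : AHPair.{u, v} B) : H →ₗ[ℂ] A.Vtx :=
  Vtx.lof A 0 ∘ₗ (TensorProduct.mk ℂ (Fock H) (A.comp 0)).flip GradedMonoid.GOne.one ∘ₗ gen 0

/-- The Heisenberg subspace `H` of `V_{A,H}`; `(V_{A,H}, H)` is the VH pair `𝒱(A, H)`. -/
def heis (A : AHPair.{u, v} B) : Submodule ℂ A.Vtx := LinearMap.range A.ofHeis

end AHPair

/-- A VH pair homomorphism `(V, H_V) → (W, H_W)`: a vertex algebra homomorphism `f` with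
`f(H_V) = H_W`. -/
structure VHHom {V : Type u} [AddCommGroup V] [Module ℂ V] [PreVertexAlgebra V]
    {W : Type v} [AddCommGroup W] [Module ℂ W] [PreVertexAlgebra W]
    (HV : Submodule ℂ V) (HW : Submodule ℂ W) where
  toLinearMap : V →ₗ[ℂ] W
  map_vac : toLinearMap vac = vac
  map_nprod : ∀ (n : ℤ) (a b : V), toLinearMap (nprod n a b) =
    nprod n (toLinearMap a) (toLinearMap b)
  map_heis : HV.map toLinearMap = HW

/-- A vertex subalgebra. -/
structure VertexSubalgebra (V : Type u) [AddCommGroup V] [Module ℂ V] [PreVertexAlgebra V] where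
  toSubmodule : Submodule ℂ V
  vac_mem : vac ∈ toSubmodule
  nprod_mem : ∀ (n : ℤ) {a b : V}, a ∈ toSubmodule → b ∈ toSubmodule → nprod n a b ∈ toSubmodule

section Sub

variable {V : Type u} [AddCommGroup V] [Module ℂ V] [PreVertexAlgebra V]

instance (W : VertexSubalgebra V) : PreVertexAlgebra W.toSubmodule where
  vac := ⟨vac, W.vac_mem⟩
  nprod n := LinearMap.mk₂ ℂ (fun a b => ⟨nprod n a.1 b.1, W.nprod_mem n a.2 b.2⟩)
    (fun a a' b => Subtype.ext (by simp only [Submodule.coe_add, map_add, LinearMap.add_apply]))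
    (fun c a b => Subtype.ext (by
      simp only [Submodule.coe_smul, map_smul, LinearMap.smul_apply]))
    (fun a b b' => Subtype.ext (by simp only [Submodule.coe_add, map_add]))
    (fun c a b => Subtype.ext (by simp only [Submodule.coe_smul, map_smul]))

/-- The image of a VH pair homomorphism, as a vertex subalgebra. -/
def VHHom.range {U : Type w} [AddCommGroup U] [Module ℂ U] [PreVertexAlgebra U]
    {HU : Submodule ℂ U} {HV : Submodule ℂ V} (f : VHHom HU HV) : VertexSubalgebra V where
  toSubmodule := LinearMap.range f.toLinearMap
  vac_mem := ⟨vac, f.map_vac⟩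
  nprod_mem := by
    rintro n _ _ ⟨a, rfl⟩ ⟨b, rfl⟩
    exact ⟨nprod n a b, f.map_nprod n a b⟩

/-- The subspace `H` of `V`, as a subspace of a vertex subalgebra `W` (used for `H ≤ W`). -/
abbrev VertexSubalgebra.heis (W : VertexSubalgebra V) (H : Submodule ℂ V) :
    Submodule ℂ W.toSubmodule := H.comap W.toSubmodule.subtype

/-- The VH pair `(W, H)`, for a vertex subalgebra `W` of `V` containing `H`, is isomorphic to
`V_{L,H'}` for some even `H'`-lattice `L`; that is, `W` is a subVH pair of `(V, H)` and an
`H`-lattice vertex algebra. -/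
def VertexSubalgebra.IsHLattice (W : VertexSubalgebra V) (H : Submodule ℂ V) : Prop :=
  H ≤ W.toSubmodule ∧
    ∃ (H' : Type u) (_ : AddCommGroup H') (_ : Module ℂ H') (B : LinearMap.BilinForm ℂ H')
      (L : EvenLattice B), Module.Finite ℂ H' ∧ B.IsSymm ∧ B.Nondegenerate ∧
        ∃ g : VHHom L.toAHPair.heis (W.heis H), Function.Bijective g.toLinearMap

end Sub

end VHPairs

end

open VHPairs

/-!
A homomorphism out of the vertex algebra `V_{A,K} = M_K(0) ⊗ A` is the same thing as an isometry
`φ : K ≅ H` together with a homomorphism of graded algebras from `A` to the algebra `Ω(V, H)` of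
vacuum vectors.

* Given such data, `u ⊗ a` is sent to `u g(a)`, where the Fock space acts on `V` by the creation
  operators of `H` (`fockAct`).  Compatibility with the products (`fockAct_fockMode`) says that the
  explicit fields of `V_{A,K}` compute the fields of `V`.  For `u = 1` the field of a vacuum vector
  is determined by its commutators with `H` and by `Y(Ta, z) = ∂_z Y(a, z)`, where `Ta = α(-1)a`
  (`nprod_vacSpace`, `represents_vertexOp`).  Multiplying `u` by a creation operator corresponds to
  a normally ordered product on both sides (`Represents.normalOrder`).
* Conversely, a homomorphism preserves the relations that define `Ω(V, H)` inside `V`, so it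
  restricts to an isometry of the Heisenberg subspaces (`VHHom.exists_isometry`), sends `A^α` to
  `Ω^{φ(α)}` (`VHHom.apply_ofAlg_mem`), and is determined by its restrictions
  (`VHHom.apply_lof`).

If `Ω(V, H)` is good, applying the first construction to the inclusion of `Ω(V, H)^lat` gives
`ι = latHom`.  It is injective because the charges `α` are separated by the zero modes of `H`, the
homogeneous components of `Ω(V, H)^lat` are at most one-dimensional
(`AHPair.IsGood.lat_exists_eq_smul`), and `M_H(0)` is irreducible under the annihilation operators
(`VHHom.injective`).

In a lattice algebra `A_{L,K}` the element `e_α e_{-α}` is a nonzero multiple of `1`, so a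
homomorphism from `V_{L,K}` kills no `e_α`.  Hence both `φ(α)` and `-φ(α)` occur in `Ω(V, H)`,
that is, `φ(L)` lies in the maximal lattice, and the homomorphism factors through `ι`
(`exists_isAdjunct_of_vhHom`, `exists_equiv_isAdjunct`).

Finally `Ω(V, H)^lat` is itself a twisted group algebra: after choosing a basis vector in each
component, its structure constants differ from the chosen cocycle of the maximal lattice by a
symmetric cocycle with values in `ℂˣ`, and this is a coboundary since `ℂˣ` is divisible
(`exists_coboundary`, `AHPair.IsGood.exists_iso`).  So the image of `ι` is an `H`-lattice vertex
algebra.  It is the only one that contains the image of every homomorphism from a lattice vertex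
algebra, because each of two such subalgebras contains the other.
-/

noncomputable section

namespace VHPairs

open PreVertexAlgebra VertexAlgebra

/-! ### The Fock space and its action by creation operators -/

section FockInduction

variable {K : Type w} [AddCommGroup K] [Module ℂ K]

theorem gen_single (n : ℕ) (k : K) :
    SymmetricAlgebra.ι ℂ (ℕ →₀ K) (Finsupp.single n k) = gen n k := rfl

/-- Induction on elements of the Fock space: it is spanned by the vectors obtained from `1` by
left multiplication with creation operators. -/
theorem fock_induction {P : Fock K → Prop} (one : P 1) (add : ∀ u v, P u → P v → P (u + v))
    (smul : ∀ (c : ℂ) u, P u → P (c • u)) (gen_mul : ∀ n k u, P u → P (gen n k * u))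
    (u : Fock K) : P u := by
  have zero : P 0 := by simpa using smul 0 1 one
  suffices h : ∀ v, P v → P (u * v) by simpa using h 1 one
  induction u using SymmetricAlgebra.induction with
  | algebraMap c =>
    intro v hv
    rw [← Algebra.smul_def]
    exact smul c v hv
  | ι x =>
    intro v hv
    induction x using Finsupp.induction_linear with
    | zero => simpa using zero
    | add x y hx hy => rw [map_add, add_mul]; exact add _ _ hx hy
    | single n k => exact gen_mul n k v hv
  | mul a b ha hb =>
    intro v hv
    rw [mul_assoc]
    exact ha _ (hb _ hv)
  | add a b ha hb =>
    intro v hv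
    rw [add_mul]
    exact add _ _ (ha _ hv) (hb _ hv)

/-- The coefficient of `z^k` of a Laurent polynomial with coefficients in the Fock space. -/
def fockPolyCoeff (k : ℤ) : FockPoly K →ₗ[ℂ] Fock K :=
  TensorProduct.lift <| LinearMap.flip <|
    (Finsupp.lsum ℂ (fun l : ℤ => LinearMap.toSpanSingleton ℂ (Fock K →ₗ[ℂ] Fock K)
      (if l = k then LinearMap.id else 0))) ∘ₗ (AddMonoidAlgebra.coeffLinearEquiv ℂ).toLinearMap

theorem fockPolyCoeff_tmul_T (k l : ℤ) (u : Fock K) :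
    fockPolyCoeff k (u ⊗ₜ LaurentPolynomial.T l) = if l = k then u else 0 := by
  have hT : (LaurentPolynomial.T l : LaurentPolynomial ℂ).coeff = Finsupp.single l 1 := rfl
  split_ifs with h
  · subst h
    simp [fockPolyCoeff, hT]
  · simp [fockPolyCoeff, h, hT]

theorem laurent_induction {P : LaurentPolynomial ℂ → Prop}
    (add : ∀ p q, P p → P q → P (p + q))
    (smul_T : ∀ (c : ℂ) (n : ℤ), P (c • LaurentPolynomial.T n)) (p : LaurentPolynomial ℂ) :
    P p := by
  induction p using LaurentPolynomial.induction_on' with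
  | add p q hp hq => exact add p q hp hq
  | C_mul_T n c =>
    rw [← LaurentPolynomial.smul_eq_C_mul]
    exact smul_T c n

/-- The space of Fock space valued Laurent polynomials is spanned by the monomials `v z^j`. -/
theorem fockPoly_induction {P : FockPoly K → Prop}
    (add : ∀ p q, P p → P q → P (p + q))
    (tmul : ∀ (v : Fock K) (j : ℤ), P (v ⊗ₜ LaurentPolynomial.T j)) (p : FockPoly K) : P p := by
  induction p using TensorProduct.induction_on with
  | zero => simpa using tmul 0 0
  | add p q hp hq => exact add p q hp hq
  | tmul v r =>
    induction r using laurent_induction with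
    | add p q hp hq => rw [TensorProduct.tmul_add]; exact add _ _ hp hq
    | smul_T c n => rw [TensorProduct.tmul_smul, TensorProduct.smul_tmul']; exact tmul _ _

theorem fockPolyCoeff_mul (k : ℤ) (u : Fock K) (p : FockPoly K) :
    fockPolyCoeff k ((u ⊗ₜ 1) * p) = u * fockPolyCoeff k p := by
  induction p using fockPoly_induction with
  | add p q hp hq => simp only [mul_add, map_add, hp, hq]
  | tmul v j =>
    rw [Algebra.TensorProduct.tmul_mul_tmul, one_mul, fockPolyCoeff_tmul_T, fockPolyCoeff_tmul_T]
    split_ifs <;> simp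

/-- A Laurent polynomial is the finite sum of its terms. -/
theorem exists_finset_fockPolyCoeff (p : FockPoly K) :
    ∃ s : Finset ℤ, (∀ k ∉ s, fockPolyCoeff k p = 0) ∧
      p = ∑ k ∈ s, fockPolyCoeff k p ⊗ₜ LaurentPolynomial.T k := by
  suffices h : ∃ s : Finset ℤ, ∀ t, s ⊆ t → (∀ k ∉ t, fockPolyCoeff k p = 0) ∧
      p = ∑ k ∈ t, fockPolyCoeff k p ⊗ₜ LaurentPolynomial.T k by
    obtain ⟨s, hs⟩ := h
    exact ⟨s, hs s subset_rfl⟩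
  induction p using fockPoly_induction with
  | add p q hp hq =>
    obtain ⟨s, hs⟩ := hp
    obtain ⟨t, ht⟩ := hq
    refine ⟨s ∪ t, fun r hr => ?_⟩
    obtain ⟨h1, h2⟩ := hs r (Finset.union_subset_left hr)
    obtain ⟨h3, h4⟩ := ht r (Finset.union_subset_right hr)
    refine ⟨fun k hk => by rw [map_add, h1 k hk, h3 k hk, add_zero], ?_⟩
    simp only [map_add, TensorProduct.add_tmul, Finset.sum_add_distrib]
    rw [← h2, ← h4]
  | tmul v j =>
    refine ⟨{j}, fun t ht => ?_⟩
    simp only [fockPolyCoeff_tmul_T]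
    refine ⟨fun k hk => if_neg fun (h : j = k) => hk (h ▸ ht (by simp)), ?_⟩
    rw [Finset.sum_eq_single_of_mem j (ht (by simp))]
    · simp
    · intro b _ hb
      rw [if_neg hb.symm, TensorProduct.zero_tmul]

theorem linearMap_fockPoly_eq_finsum {M : Type*} [AddCommGroup M] [Module ℂ M]
    (L : FockPoly K →ₗ[ℂ] M) (p : FockPoly K) :
    L p = ∑ᶠ k : ℤ, L (fockPolyCoeff k p ⊗ₜ LaurentPolynomial.T k) := by
  obtain ⟨s, hs, hp⟩ := exists_finset_fockPolyCoeff p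
  rw [finsum_eq_sum_of_support_subset (s := s), ← map_sum, ← hp]
  intro k hk
  by_contra h
  exact hk (by simp only [hs k h, TensorProduct.zero_tmul, map_zero])

end FockInduction

section Action

variable {V : Type u} [AddCommGroup V] [Module ℂ V] [VertexAlgebra V] {H : Submodule ℂ V}
  {K : Type w} [AddCommGroup K] [Module ℂ K]

/-- The commutation relations of the Heisenberg algebra. -/
theorem heis_comm (hH : IsHeisenberg H) (h h' : H) (v : V) (p q : ℤ) :
    nprod p (h : V) (nprod q (h' : V) v) = nprod q (h' : V) (nprod p (h : V) v) +
      if p + q = 0 then ((p : ℂ) * heisForm hH h h') • v else 0 := by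
  have hc := nprod_comm (h : V) (h' : V) v p q
  rw [finsum_eq_single _ 1] at hc
  · rw [sub_eq_iff_eq_add'] at hc
    rw [hc, Nat.cast_one, heisForm_spec hH, Ring.choose_one_right, map_smul,
      LinearMap.smul_apply, vac_nprod]
    congr 1
    by_cases hpq : p + q = 0
    · rw [if_pos hpq, if_pos (by omega), ← Int.cast_smul_eq_zsmul ℂ, smul_smul]
    · rw [if_neg hpq, if_neg (by omega)]
      simp
  · intro i hi
    rcases Nat.lt_or_ge i 1 with h1 | h1
    · obtain rfl : i = 0 := by omega
      rw [Nat.cast_zero, hH.zero h h.2 h' h'.2]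
      simp
    · rw [hH.two h h.2 h' h'.2 _ (by omega)]
      simp

variable (φ : K →ₗ[ℂ] H)

/-- The creation operators: `k(-n-1) ↦ φ(k)(-n-1)`. -/
def creationOp : (ℕ →₀ K) →ₗ[ℂ] Module.End ℂ V :=
  Finsupp.lsum ℂ fun n => nprod (-(n : ℤ) - 1) ∘ₗ H.subtype ∘ₗ φ

theorem creationOp_single (n : ℕ) (k : K) :
    creationOp φ (Finsupp.single n k) = nprod (-(n : ℤ) - 1) (φ k : V) := by
  simp [creationOp]

theorem creationOp_comm (hH : IsHeisenberg H) (x y : ℕ →₀ K) :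
    creationOp φ x * creationOp φ y = creationOp φ y * creationOp φ x := by
  induction x using Finsupp.induction_linear with
  | zero => simp
  | add x x' hx hx' => rw [map_add, add_mul, mul_add, hx, hx']
  | single n k =>
    induction y using Finsupp.induction_linear with
    | zero => simp
    | add y y' hy hy' => rw [map_add, add_mul, mul_add, hy, hy']
    | single m k' =>
      refine LinearMap.ext fun v => ?_
      rw [creationOp_single, creationOp_single, Module.End.mul_apply, Module.End.mul_apply,
        heis_comm hH, if_neg (by omega), add_zero]

variable (hH : IsHeisenberg H)

/-- The action of the Fock space of `K` on `V` by creation operators, for a linear map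
`φ : K → H`: the vector `h₁(-n₁-1) ⋯ h_k(-n_k-1)` acts as `φ(h₁)(-n₁-1) ⋯ φ(h_k)(-n_k-1)`. -/
def fockAct : Fock K →ₐ[ℂ] Module.End ℂ V := symmLift (creationOp φ) (creationOp_comm φ hH)

theorem fockAct_gen (n : ℕ) (k : K) :
    fockAct φ hH (gen n k) = nprod (-(n : ℤ) - 1) (φ k : V) := by
  rw [fockAct, ← gen_single, symmLift_ι, creationOp_single]

theorem fockAct_gen_mul (n : ℕ) (k : K) (u : Fock K) (v : V) :
    fockAct φ hH (gen n k * u) v = nprod (-(n : ℤ) - 1) (φ k : V) (fockAct φ hH u v) := by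
  rw [map_mul, Module.End.mul_apply, fockAct_gen]

theorem fockAct_one (v : V) : fockAct φ hH (1 : Fock K) v = v := by
  rw [map_one, Module.End.one_apply]

/-- The zero modes of `H` commute with the creation operators. -/
theorem nprod_zero_fockAct (h : H) (u : Fock K) (v : V) :
    nprod 0 (h : V) (fockAct φ hH u v) = fockAct φ hH u (nprod 0 (h : V) v) := by
  induction u using fock_induction with
  | one => simp only [fockAct_one]
  | add u u' hu hu' => simp only [map_add, LinearMap.add_apply, hu, hu']
  | smul c u hu => simp only [map_smul, LinearMap.smul_apply, hu]
  | gen_mul n k u hu =>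
    rw [fockAct_gen_mul, fockAct_gen_mul, heis_comm hH, hu]
    simp

variable (B : LinearMap.BilinForm ℂ K)

theorem contraction_single (n j : ℕ) (h h' : K) :
    contraction B (Finsupp.single n h) (Finsupp.single j h') =
      (B h h' * ((Ring.choose (-(j : ℤ) - 2) n * (j + 1) : ℤ) : ℂ)) •
        LaurentPolynomial.T (-(j : ℤ) - 2 - n) := by
  simp [contraction, smul_smul]

theorem fockDer_gen_mul (ψ : (ℕ →₀ K) →ₗ[ℂ] LaurentPolynomial ℂ) (m : ℕ) (k : K) (v : Fock K) :
    fockDer ψ ((gen m k * v) ⊗ₜ 1) =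
      (gen m k ⊗ₜ 1) * fockDer ψ (v ⊗ₜ 1) + v ⊗ₜ ψ (Finsupp.single m k) := by
  have h := fockDer_mul ψ (gen m k ⊗ₜ 1) (v ⊗ₜ 1)
  rw [Algebra.TensorProduct.tmul_mul_tmul, one_mul] at h
  rw [h, ← gen_single, fockDer_ι, Algebra.TensorProduct.tmul_mul_tmul, mul_one, one_mul]

theorem fockDer_one (ψ : (ℕ →₀ K) →ₗ[ℂ] LaurentPolynomial ℂ) :
    fockDer ψ ((1 : Fock K) ⊗ₜ 1) = 0 := fockDer_right ψ 1

theorem fockDer_tmul (ψ : (ℕ →₀ K) →ₗ[ℂ] LaurentPolynomial ℂ) (v : Fock K)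
    (r : LaurentPolynomial ℂ) :
    fockDer ψ (v ⊗ₜ r) = fockDer ψ (v ⊗ₜ 1) * (1 ⊗ₜ r) := by
  have h := fockDer_mul ψ (v ⊗ₜ 1) (1 ⊗ₜ r)
  rw [Algebra.TensorProduct.tmul_mul_tmul, one_mul, mul_one, fockDer_right, mul_zero,
    zero_add] at h
  exact h

/-- The contraction of `(1/n!) ∂_z^n h(z)` only involves the powers `z^(-l-2-n)`, `l ≥ 0`. -/
theorem fockPolyCoeff_contraction_eq_zero (n : ℕ) (h : K) (v : Fock K) (k : ℤ)
    (hk : ∀ l : ℕ, k ≠ -(l : ℤ) - 2 - n) :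
    fockPolyCoeff k (fockDer (contraction B (Finsupp.single n h)) (v ⊗ₜ 1)) = 0 := by
  induction v using fock_induction with
  | one => rw [fockDer_one, map_zero]
  | add u u' hu hu' => rw [TensorProduct.add_tmul, map_add, map_add, hu, hu', add_zero]
  | smul c u hu => rw [← TensorProduct.smul_tmul', map_smul, map_smul, hu, smul_zero]
  | gen_mul m k' u hu =>
    rw [fockDer_gen_mul, map_add, fockPolyCoeff_mul, hu, mul_zero, zero_add, contraction_single,
      TensorProduct.tmul_smul, map_smul, fockPolyCoeff_tmul_T, if_neg (hk m).symm, smul_zero]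

variable {B}

/-- The coefficient of `z^(-l-2-n)` of the contraction with `(1/n!) ∂_z^n h(z)` corresponds to the
commutator with the annihilation operator `h(l+1)`. -/
theorem fockAct_contraction (hB : ∀ x y, heisForm hH (φ x) (φ y) = B x y) (n : ℕ) (h : K)
    (v : Fock K) (l : ℕ) (w : V) :
    fockAct φ hH (fockPolyCoeff (-(l : ℤ) - 2 - n)
      (fockDer (contraction B (Finsupp.single n h)) (v ⊗ₜ 1))) w =
      ((Ring.choose (-(l : ℤ) - 2) n : ℤ) : ℂ) • (nprod ((l : ℤ) + 1) (φ h : V) (fockAct φ hH v w) -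
        fockAct φ hH v (nprod ((l : ℤ) + 1) (φ h : V) w)) := by
  induction v using fock_induction with
  | one => simp [fockDer_one]
  | add u u' hu hu' =>
    simp only [TensorProduct.add_tmul, map_add, LinearMap.add_apply, hu, hu']
    module
  | smul c u hu =>
    simp only [← TensorProduct.smul_tmul', map_smul, LinearMap.smul_apply, hu]
    module
  | gen_mul m k' u hu =>
    rw [fockDer_gen_mul, map_add, fockPolyCoeff_mul, map_add, LinearMap.add_apply,
      fockAct_gen_mul, hu, contraction_single, TensorProduct.tmul_smul, map_smul _ (_ * _),
      fockPolyCoeff_tmul_T, fockAct_gen_mul, fockAct_gen_mul, heis_comm hH, hB]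
    by_cases hml : m = l
    · subst hml
      rw [if_pos rfl, if_pos (by ring)]
      simp only [map_smul, map_sub, LinearMap.smul_apply]
      push_cast
      module
    · rw [if_neg (by omega), if_neg (by omega)]
      simp only [map_smul, map_sub, smul_zero, map_zero, LinearMap.zero_apply, add_zero]

end Action

/-! ### Coefficients of Laurent series and of vertex operators -/

section Finsum

variable {M : Type*} [AddCommGroup M]

theorem finsum_nat_eq_sum_range {f : ℕ → M} {N : ℕ} (h : ∀ i, N ≤ i → f i = 0) :
    ∑ᶠ i, f i = ∑ i ∈ Finset.range N, f i :=
  finsum_eq_sum_of_support_subset _ fun i hi => by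
    by_contra hN
    exact hi (h i (by simpa using hN))

theorem finsum_eq_sum_range_comp {ι : Type*} {f : ι → M} {e : ℕ → ι}
    (he : Function.Injective e) {N : ℕ} (h : ∀ i, N ≤ i → f (e i) = 0)
    (h' : ∀ k, (∀ i, k ≠ e i) → f k = 0) :
    ∑ᶠ k, f k = ∑ i ∈ Finset.range N, f (e i) := by
  rw [← Finset.sum_image (s := Finset.range N) (g := e) (f := f) he.injOn]
  refine finsum_eq_sum_of_support_subset _ fun k hk => ?_
  by_cases hk' : ∃ i, k = e i
  · obtain ⟨i, rfl⟩ := hk'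
    by_contra hN
    refine hk (h i (not_lt.1 fun hlt => hN ?_))
    simpa using ⟨i, hlt, rfl⟩
  · exact absurd (h' k (not_exists.1 hk')) hk

end Finsum

section Series

variable {K : Type w} [AddCommGroup K] [Module ℂ K]

theorem coeff_ofPowerSeries_of_neg (f : PowerSeries (Fock K)) {i : ℤ} (hi : i < 0) :
    (HahnSeries.ofPowerSeries ℤ (Fock K) f).coeff i = 0 := by
  rw [HahnSeries.ofPowerSeries_apply, HahnSeries.embDomain_of_notMem_range]
  rintro ⟨n, hn⟩
  simp at hn
  omega

/-- The Cauchy product of a power series and a Laurent series, as a sum over `i < N` for some `N`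
such that the terms with `i ≥ N` vanish. -/
theorem coeff_ofPowerSeries_mul (f : PowerSeries (Fock K)) (s : FockSeries K) (k : ℤ) :
    ∃ N : ℕ, (∀ i : ℕ, N ≤ i → s.coeff (k - i) = 0) ∧
      (HahnSeries.ofPowerSeries ℤ (Fock K) f * s).coeff k =
        ∑ i ∈ Finset.range N, PowerSeries.coeff i f * s.coeff (k - i) := by
  refine ⟨(k - s.order + 1).toNat, fun i hi =>
    HahnSeries.coeff_eq_zero_of_lt_order (by omega), ?_⟩
  have key : ∀ i : ℤ, (HahnSeries.ofPowerSeries ℤ (Fock K) f).coeff i ≠ 0 → 0 ≤ i :=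
    fun i hi => not_lt.1 fun h => hi (coeff_ofPowerSeries_of_neg f h)
  rw [HahnSeries.coeff_mul]
  refine Finset.sum_bij_ne_zero (fun ij _ _ => ij.1.toNat) ?_ ?_ ?_ ?_
  · rintro ⟨i, j⟩ h1 -
    rw [Finset.mem_antidiagonal] at h1
    obtain ⟨h1, h2, h3⟩ := h1
    have h4 := key i h1
    have h5 := HahnSeries.order_le_of_coeff_ne_zero h2
    rw [Finset.mem_range]
    dsimp only at h3 h5 ⊢
    omega
  · rintro ⟨i, j⟩ h1 - ⟨i', j'⟩ h2 - h
    rw [Finset.mem_antidiagonal] at h1 h2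
    obtain ⟨h1, -, h3⟩ := h1
    obtain ⟨h2, -, h4⟩ := h2
    have h1 := key i h1
    have h2 := key i' h2
    dsimp only at h h3 h4
    obtain rfl : i = i' := by omega
    obtain rfl : j = j' := by omega
    rfl
  · intro i hi h
    refine ⟨((i : ℤ), k - i), ?_, ?_, ?_⟩
    · rw [Finset.mem_antidiagonal]
      refine ⟨?_, right_ne_zero_of_mul h, by ring⟩
      rw [HahnSeries.mem_support, HahnSeries.ofPowerSeries_apply_coeff]
      exact left_ne_zero_of_mul h
    · dsimp only
      rwa [HahnSeries.ofPowerSeries_apply_coeff]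
    · simp
  · rintro ⟨i, j⟩ h1 -
    rw [Finset.mem_antidiagonal] at h1
    obtain ⟨h1, -, h3⟩ := h1
    have h1 := key i h1
    dsimp only at h3 ⊢
    lift i to ℕ using h1
    rw [HahnSeries.ofPowerSeries_apply_coeff, Int.toNat_natCast, ← h3, add_sub_cancel_left]

theorem creation_single (n : ℕ) (h : K) :
    creation (Finsupp.single n h) = HahnSeries.ofPowerSeries ℤ (Fock K)
      (PowerSeries.mk fun k => ((n + k).choose n : ℂ) • gen (n + k) h) := by
  rw [creation, Finsupp.lsum_single]
  rfl

theorem zeroMode_single (B : LinearMap.BilinForm ℂ K) (β : K) (n : ℕ) (h : K) :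
    zeroMode B β (Finsupp.single n h) =
      (B h β * ((Ring.choose (-1 : ℤ) n : ℤ) : ℂ)) • LaurentPolynomial.T (-1 - n) := by
  simp [zeroMode, smul_smul]

theorem fockPolyToSeries_tmul_T (v : Fock K) (j : ℤ) :
    fockPolyToSeries (v ⊗ₜ LaurentPolynomial.T j) = HahnSeries.single j v := by
  have hT : (LaurentPolynomial.T j : LaurentPolynomial ℂ).coeff = Finsupp.single j 1 := rfl
  simp [fockPolyToSeries, hT]
  rfl

theorem fockPolyToSeries_mul (u : Fock K) (p : FockPoly K) :
    fockPolyToSeries ((u ⊗ₜ 1) * p) = HahnSeries.C u * fockPolyToSeries p := by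
  induction p using fockPoly_induction with
  | add p q hp hq => simp only [mul_add, map_add, hp, hq]
  | tmul v j =>
    rw [Algebra.TensorProduct.tmul_mul_tmul, one_mul, fockPolyToSeries_tmul_T,
      fockPolyToSeries_tmul_T, HahnSeries.C_apply, HahnSeries.single_mul_single, zero_add]

/-- The coefficients of `exp(∑_{n ≥ 1} α(-n) z^n / n)`. -/
def schur (α : K) (k : ℕ) : Fock K :=
  PowerSeries.coeff k
    ((PowerSeries.exp ℂ).subst (PowerSeries.mk fun n => (n : ℂ)⁻¹ • gen (n - 1) α))

theorem hasSubst_gen (α : K) :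
    PowerSeries.HasSubst
      (PowerSeries.mk fun n => (n : ℂ)⁻¹ • gen (n - 1) α : PowerSeries (Fock K)) :=
  PowerSeries.HasSubst.of_constantCoeff_zero' (by
    rw [← PowerSeries.coeff_zero_eq_constantCoeff_apply, PowerSeries.coeff_mk]
    simp)

/-- The chain rule for substitution needs the outer series to have coefficients in the same ring, so
the exponential series is moved from `ℂ` to the Fock space. -/
theorem exp_subst_eq (f : PowerSeries (Fock K)) (hf : PowerSeries.HasSubst f) :
    (PowerSeries.exp ℂ).subst f =
      ((PowerSeries.exp ℂ).map (algebraMap ℂ (Fock K))).subst f := by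
  ext n
  rw [PowerSeries.coeff_subst' hf, PowerSeries.coeff_subst' hf]
  refine finsum_congr fun d => ?_
  rw [PowerSeries.coeff_map, Algebra.smul_def, smul_eq_mul]

theorem derivative_map_exp :
    PowerSeries.derivative (Fock K) ((PowerSeries.exp ℂ).map (algebraMap ℂ (Fock K))) =
      (PowerSeries.exp ℂ).map (algebraMap ℂ (Fock K)) := by
  ext n
  have h := congrArg (fun f => algebraMap ℂ (Fock K) (PowerSeries.coeff n f))
    (PowerSeries.derivative_exp ℂ)
  rw [PowerSeries.coeff_map, ← h]
  simp only [PowerSeries.coeff_derivative, PowerSeries.coeff_map, map_mul, map_add, map_natCast,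
    map_one]

theorem schur_zero (α : K) : schur α 0 = 1 := by
  rw [schur, PowerSeries.coeff_subst' (hasSubst_gen α), finsum_eq_single _ 0]
  · simp
  · intro d hd
    rw [PowerSeries.coeff_zero_eq_constantCoeff_apply, map_pow,
      ← PowerSeries.coeff_zero_eq_constantCoeff_apply, PowerSeries.coeff_mk]
    simp [hd]

/-- The recursion `(k+1) s_{k+1} = ∑_{i+j=k} s_i α(-j-1)`, from the logarithmic derivative of the
exponential series. -/
theorem schur_succ (α : K) (k : ℕ) :
    ((k + 1 : ℕ) : ℂ) • schur α (k + 1) =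
      ∑ ij ∈ Finset.HasAntidiagonal.antidiagonal k, schur α ij.1 * gen ij.2 α := by
  have h := PowerSeries.derivative_subst
    (f := (PowerSeries.exp ℂ).map (algebraMap ℂ (Fock K))) (hasSubst_gen α)
  rw [derivative_map_exp] at h
  have h2 := congrArg (PowerSeries.coeff k) h
  rw [PowerSeries.coeff_derivative, PowerSeries.coeff_mul, ← exp_subst_eq _ (hasSubst_gen α)] at h2
  rw [Nat.cast_smul_eq_nsmul, nsmul_eq_mul, mul_comm]
  rw [schur, Nat.cast_succ, h2]
  refine Finset.sum_congr rfl fun ij _ => ?_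
  rw [PowerSeries.coeff_derivative, PowerSeries.coeff_mk, schur]
  congr 1
  have : (((ij.2 : ℕ) : Fock K) + 1) = algebraMap ℂ (Fock K) ((ij.2 + 1 : ℕ) : ℂ) := by simp
  rw [this, mul_comm, ← Algebra.smul_def, smul_smul, mul_inv_cancel₀, one_smul, Nat.add_sub_cancel]
  exact Nat.cast_ne_zero.2 (Nat.succ_ne_zero _)

theorem vertexOp_one_coeff (B : LinearMap.BilinForm ℂ K) (α : K) (j k : ℤ) :
    (vertexOp B α ((1 : Fock K) ⊗ₜ LaurentPolynomial.T j)).coeff k =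
      if j ≤ k then schur α (k - j).toNat else 0 := by
  have h1 : expMinus B α ((1 : Fock K) ⊗ₜ LaurentPolynomial.T j) = 1 ⊗ₜ LaurentPolynomial.T j := by
    simp [expMinus]
  rw [vertexOp, LinearMap.comp_apply, LinearMap.comp_apply, AlgHom.toLinearMap_apply, h1,
    fockPolyToSeries_tmul_T, LinearMap.mulLeft_apply, expPlus]
  have h2 := HahnSeries.coeff_mul_single_add (R := Fock K) (r := 1)
    (x := HahnSeries.ofPowerSeries ℤ (Fock K)
      ((PowerSeries.exp ℂ).subst (PowerSeries.mk fun n => (n : ℂ)⁻¹ • gen (n - 1) α)))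
    (a := k - j) (b := j)
  rw [sub_add_cancel, mul_one] at h2
  rw [h2]
  split_ifs with h
  · obtain ⟨d, hd⟩ := Int.eq_ofNat_of_zero_le (sub_nonneg.2 h)
    rw [hd, HahnSeries.ofPowerSeries_apply_coeff]
    rfl
  · rw [HahnSeries.ofPowerSeries_apply, HahnSeries.embDomain_of_notMem_range]
    rintro ⟨n, hn⟩
    simp at hn
    omega

theorem expMinus_gen (B : LinearMap.BilinForm ℂ K) (α : K) (n : ℕ) (h : K) :
    expMinus B α (gen n h ⊗ₜ 1) =
      gen n h ⊗ₜ 1 - B α h • (1 ⊗ₜ LaurentPolynomial.T (-(n : ℤ) - 1)) := by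
  rw [← gen_single]
  simp [expMinus]
  rw [← Algebra.TensorProduct.one_def, mul_one]

/-- The vertex operator of charge `α` commutes with `h(-n-1)` up to the shift `-(α, h) z^(-n-1)`. -/
theorem vertexOp_gen_mul (B : LinearMap.BilinForm ℂ K) (α : K) (n : ℕ) (h : K) (v : Fock K)
    (j k : ℤ) :
    (vertexOp B α ((gen n h * v) ⊗ₜ LaurentPolynomial.T j)).coeff k =
      gen n h * (vertexOp B α (v ⊗ₜ LaurentPolynomial.T j)).coeff k -
        B α h • (vertexOp B α (v ⊗ₜ LaurentPolynomial.T (j - n - 1))).coeff k := by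
  have h1 : ((gen n h * v) ⊗ₜ LaurentPolynomial.T j : FockPoly K) =
      (gen n h ⊗ₜ 1) * (v ⊗ₜ LaurentPolynomial.T j) := by
    rw [Algebra.TensorProduct.tmul_mul_tmul, one_mul]
  have h2 : expMinus B α ((1 : Fock K) ⊗ₜ LaurentPolynomial.T (-(n : ℤ) - 1)) =
      1 ⊗ₜ LaurentPolynomial.T (-(n : ℤ) - 1) := by
    simp [expMinus]
  have h3 : (v ⊗ₜ LaurentPolynomial.T (j - n - 1) : FockPoly K) =
      (1 ⊗ₜ LaurentPolynomial.T (-(n : ℤ) - 1)) * (v ⊗ₜ LaurentPolynomial.T j) := by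
    rw [Algebra.TensorProduct.tmul_mul_tmul, one_mul, ← LaurentPolynomial.T_add]
    congr 2
    ring
  rw [h1, h3]
  simp only [vertexOp, LinearMap.comp_apply, AlgHom.toLinearMap_apply, LinearMap.mulLeft_apply,
    map_mul, h2, expMinus_gen, sub_mul, smul_mul_assoc, map_sub, map_smul, fockPolyToSeries_mul,
    HahnSeries.coeff_sub, HahnSeries.coeff_smul]
  congr 1
  rw [mul_left_comm, HahnSeries.C_mul_eq_smul, HahnSeries.coeff_smul, smul_eq_mul]

end Series

/-! ### Normally ordered products and the fields of a vertex algebra -/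

section Represents

variable {V : Type u} [AddCommGroup V] [Module ℂ V] [VertexAlgebra V] {H : Submodule ℂ V}
  {K : Type w} [AddCommGroup K] [Module ℂ K] (φ : K →ₗ[ℂ] H) (hH : IsHeisenberg H)

/-- The operator `X` on Fock space valued Laurent polynomials computes the field `Y(x, z)` on the
vectors `u b`, `u` in the Fock space: under `u ↦ uc` it is carried to `z^(-n₀) Y(x, z)`. -/
def Represents (b c : V) (n₀ : ℤ) (X : FockPoly K →ₗ[ℂ] FockSeries K) (x : V) : Prop :=
  ∀ (v : Fock K) (j k : ℤ), fockAct φ hH ((X (v ⊗ₜ LaurentPolynomial.T j)).coeff k) c =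
    nprod (j - k - 1 - n₀) x (fockAct φ hH v b)

variable {φ hH} {B : LinearMap.BilinForm ℂ K} {b c : V} {n₀ : ℤ}

theorem Represents.add {X X' : FockPoly K →ₗ[ℂ] FockSeries K} {x x' : V}
    (h : Represents φ hH b c n₀ X x) (h' : Represents φ hH b c n₀ X' x') :
    Represents φ hH b c n₀ (X + X') (x + x') := fun v j k => by
  rw [LinearMap.add_apply, HahnSeries.coeff_add, map_add, LinearMap.add_apply, h, h', map_add,
    LinearMap.add_apply]

theorem Represents.smul {X : FockPoly K →ₗ[ℂ] FockSeries K} {x : V}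
    (h : Represents φ hH b c n₀ X x) (r : ℂ) : Represents φ hH b c n₀ (r • X) (r • x) :=
  fun v j k => by
    rw [LinearMap.smul_apply, HahnSeries.coeff_smul, map_smul, LinearMap.smul_apply, h, map_smul,
      LinearMap.smul_apply]

theorem choose_neg_one_eq (n : ℕ) : Ring.choose (-1 : ℤ) n = (-1) ^ n := by
  have := neg_one_pow_mul_choose_one n
  rcases neg_one_pow_eq_or ℤ n with h | h <;> rw [h] at this ⊢ <;> linarith

theorem neg_one_pow_mul_choose_neg_succ (n i : ℕ) :
    (-1) ^ i * Ring.choose (-(n : ℤ) - 1) i = ((n + i).choose n : ℤ) := by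
  rw [show -(n : ℤ) - 1 = -((n : ℤ) + 1) by ring, neg_one_pow_mul_choose,
    Ring.multichoose_eq, show (n : ℤ) + 1 + i - 1 = ((n + i : ℕ) : ℤ) by push_cast; ring,
    Ring.choose_natCast, Nat.choose_symm_add]

theorem choose_neg_sub_two (n l : ℕ) :
    Ring.choose (-(l : ℤ) - 2) n = (-1) ^ n * ((n + (l + 1)).choose n : ℤ) := by
  have h := neg_one_pow_mul_choose_neg_succ (l + 1) n
  rw [show -((l + 1 : ℕ) : ℤ) - 1 = -(l : ℤ) - 2 by push_cast; ring] at h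
  rw [Nat.choose_symm_of_eq_add (rfl : n + (l + 1) = n + (l + 1)), add_comm n, ← h, ← mul_assoc,
    ← mul_pow]
  simp

/-- The modes of `h(-n-1)x` in terms of those of `h` and `x`: the creation part, the zero mode and
the annihilation part of `h`.  All sums are taken over one range, which may be enlarged. -/
theorem nprod_neg_succ_nprod (h x y : V) (n : ℕ) (q : ℤ) :
    ∃ N : ℕ, ∀ M, N ≤ M → nprod q (nprod (-(n : ℤ) - 1) h x) y =
      ∑ i ∈ Finset.range M, ((n + i).choose n : ℂ) •
        nprod (-(n + i : ℕ) - 1) h (nprod (q + i) x y) +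
      ((-1) ^ n : ℂ) • nprod (q - n - 1) x (nprod 0 h y) +
      ∑ i ∈ Finset.range M, ((-1) ^ n * ((n + (i + 1)).choose n) : ℂ) •
        nprod (q - n - i - 2) x (nprod (i + 1 : ℤ) h y) := by
  obtain ⟨N₁, h1⟩ := trunc x y
  obtain ⟨N₂, h2⟩ := trunc h y
  refine ⟨max (N₁ - q).toNat N₂.toNat, fun M hM => ?_⟩
  have hM1 : N₁ ≤ q + M := by omega
  have hM2 : N₂ ≤ M := by omega
  rw [nprod_iterate, finsum_nat_eq_sum_range (N := M + 1)]
  · have hs : (Int.negOnePow (-(n : ℤ) - 1) : ℤ) = - (-1) ^ n := by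
      rw [show -(n : ℤ) - 1 = -((n : ℤ) + 1) by ring, Int.negOnePow_neg, Int.negOnePow_succ,
        Units.val_neg, Int.coe_negOnePow_natCast]
    simp only [neg_one_pow_mul_choose_neg_succ, hs, smul_sub, Finset.sum_sub_distrib]
    rw [Finset.sum_range_succ, h1 _ hM1, map_zero, smul_zero, add_zero, Finset.sum_range_succ',
      sub_eq_add_neg, neg_add, add_assoc, add_comm (- _), ← Finset.sum_neg_distrib]
    congr 1
    · refine Finset.sum_congr rfl fun i _ => ?_
      rw [← Int.cast_smul_eq_zsmul ℂ, Int.cast_natCast]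
      congr 3
      push_cast
      ring_nf
    congr 1
    · simp only [← Int.cast_smul_eq_zsmul ℂ]
      simp
      congr 3
      ring
    · refine Finset.sum_congr rfl fun i _ => ?_
      simp only [← Int.cast_smul_eq_zsmul ℂ, smul_smul]
      push_cast
      rw [← neg_smul]
      congr 1
      · ring
      · congr 2
        ring_nf
  · intro i hi
    rw [h1 _ (by omega), h2 _ (by omega)]
    simp

/-- Normally ordered products represent the fields of the vectors `h(-n-1)x`. -/
theorem Represents.normalOrder {β : K} (hB : ∀ x y, heisForm hH (φ x) (φ y) = B x y)
    (hb : b ∈ vacSpace hH (φ β)) {X : FockPoly K →ₗ[ℂ] FockSeries K} {x : V}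
    (hX : Represents φ hH b c n₀ X x) (n : ℕ) (h : K) :
    Represents φ hH b c n₀ (normalOrder B β (Finsupp.single n h) X)
      (nprod (-(n : ℤ) - 1) (φ h : V) x) := by
  intro v j k
  set q : ℤ := j - k - 1 - n₀ with hq
  have hpos : ∀ l : ℕ, fockAct φ hH v (nprod ((l : ℤ) + 1) (φ h : V) b) = 0 := fun l => by
    rw [hb.2.1 _ (φ h).2 _ (by omega), map_zero]
  -- the creation part
  obtain ⟨N₁, hN₁, e₁⟩ : ∃ N : ℕ, (∀ i, N ≤ i → nprod (q + i) x (fockAct φ hH v b) = 0) ∧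
      fockAct φ hH ((creation (Finsupp.single n h) *
        X (v ⊗ₜ LaurentPolynomial.T j)).coeff k) c =
      ∑ i ∈ Finset.range N, ((n + i).choose n : ℂ) •
        nprod (-(n + i : ℕ) - 1) (φ h : V) (nprod (q + i) x (fockAct φ hH v b)) := by
    have hX' : ∀ i : ℕ, fockAct φ hH ((X (v ⊗ₜ LaurentPolynomial.T j)).coeff (k - i)) c =
        nprod (q + i) x (fockAct φ hH v b) := fun i => by
      rw [hX, hq]
      congr 2
      ring_nf
    rw [creation_single]
    obtain ⟨N, hN, e⟩ := coeff_ofPowerSeries_mul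
      (PowerSeries.mk fun k => ((n + k).choose n : ℂ) • gen (n + k) h)
      (X (v ⊗ₜ LaurentPolynomial.T j)) k
    refine ⟨N, fun i hi => by rw [← hX', hN i hi, map_zero, LinearMap.zero_apply], ?_⟩
    rw [e, map_sum, LinearMap.sum_apply]
    refine Finset.sum_congr rfl fun i _ => ?_
    rw [PowerSeries.coeff_mk, smul_mul_assoc, map_smul, LinearMap.smul_apply, fockAct_gen_mul, hX']
  -- the annihilation part
  obtain ⟨N₂, h2⟩ := trunc (φ h : V) (fockAct φ hH v b)
  have e₂ : fockAct φ hH ((X (fockDer (contraction B (Finsupp.single n h))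
      (v ⊗ₜ LaurentPolynomial.T j))).coeff k) c =
      ∑ i ∈ Finset.range N₂.toNat, ((-1) ^ n * ((n + (i + 1)).choose n) : ℂ) •
        nprod (q - n - i - 2) x (nprod (i + 1 : ℤ) (φ h : V) (fockAct φ hH v b)) := by
    let L : FockPoly K →ₗ[ℂ] V := LinearMap.applyₗ c ∘ₗ (fockAct φ hH).toLinearMap ∘ₗ fockCoeff k ∘ₗ
      X ∘ₗ LinearMap.mulRight ℂ (1 ⊗ₜ LaurentPolynomial.T j)
    have hL : ∀ (u : Fock K) (i : ℤ), L (u ⊗ₜ LaurentPolynomial.T i) =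
        nprod (q + i) x (fockAct φ hH u b) := by
      intro u i
      change fockAct φ hH ((X ((u ⊗ₜ LaurentPolynomial.T i) *
        (1 ⊗ₜ LaurentPolynomial.T j))).coeff k) c = _
      rw [Algebra.TensorProduct.tmul_mul_tmul, mul_one, ← LaurentPolynomial.T_add, hX, hq]
      congr 2
      ring_nf
    have hterm : ∀ i : ℕ, L (fockPolyCoeff (-(i : ℤ) - 2 - n)
        (fockDer (contraction B (Finsupp.single n h)) (v ⊗ₜ 1)) ⊗ₜ
          LaurentPolynomial.T (-(i : ℤ) - 2 - n)) =
        ((-1) ^ n * ((n + (i + 1)).choose n) : ℂ) •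
        nprod (q - n - i - 2) x (nprod (i + 1 : ℤ) (φ h : V) (fockAct φ hH v b)) := by
      intro i
      rw [hL, fockAct_contraction φ hH hB, hpos, sub_zero, map_smul, choose_neg_sub_two]
      push_cast
      congr 3
      ring_nf
    rw [fockDer_tmul]
    change L (fockDer (contraction B (Finsupp.single n h)) (v ⊗ₜ 1)) = _
    rw [linearMap_fockPoly_eq_finsum, finsum_eq_sum_range_comp (e := fun i : ℕ => -(i : ℤ) - 2 - n)
      (N := N₂.toNat)]
    · exact Finset.sum_congr rfl fun i _ => hterm i
    · intro i i' hi
      dsimp only at hi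
      omega
    · intro i hi
      rw [hterm, h2 _ (by omega), map_zero, smul_zero]
    · intro k hk
      rw [fockPolyCoeff_contraction_eq_zero B n h v k hk, TensorProduct.zero_tmul, map_zero]
  -- the zero mode
  have e₃ : fockAct φ hH ((X ((1 ⊗ₜ zeroMode B β (Finsupp.single n h)) *
      (v ⊗ₜ LaurentPolynomial.T j))).coeff k) c =
      ((-1) ^ n : ℂ) • nprod (q - n - 1) x (nprod 0 (φ h : V) (fockAct φ hH v b)) := by
    rw [Algebra.TensorProduct.tmul_mul_tmul, one_mul, zeroMode_single, smul_mul_assoc,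
      ← LaurentPolynomial.T_add, TensorProduct.tmul_smul, map_smul, HahnSeries.coeff_smul, map_smul,
      LinearMap.smul_apply, hX, nprod_zero_fockAct, hb.2.2, hB, map_smul, map_smul, smul_smul,
      choose_neg_one_eq]
    congr 1
    · push_cast
      ring
    · rw [hq]
      congr 2
      ring_nf
  obtain ⟨N, hN⟩ := nprod_neg_succ_nprod (φ h : V) x (fockAct φ hH v b) n q
  rw [hN (max N (max N₁ N₂.toNat)) (le_max_left _ _)]
  change fockAct φ hH ((creation (Finsupp.single n h) * X (v ⊗ₜ LaurentPolynomial.T j) +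
    X (fockDer (contraction B (Finsupp.single n h)) (v ⊗ₜ LaurentPolynomial.T j) +
      (1 ⊗ₜ zeroMode B β (Finsupp.single n h)) * (v ⊗ₜ LaurentPolynomial.T j))).coeff k) c = _
  rw [map_add, HahnSeries.coeff_add, HahnSeries.coeff_add, map_add, map_add, LinearMap.add_apply,
    LinearMap.add_apply, e₁, e₂, e₃, add_comm (Finset.sum (Finset.range N₂.toNat) _), ← add_assoc]
  congr 1
  · congr 1
    refine Finset.sum_subset (Finset.range_mono (by omega)) fun i _ hi => ?_
    rw [hN₁ i (by simpa using hi), map_zero, smul_zero]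
  · refine Finset.sum_subset (Finset.range_mono (by omega)) fun i _ hi => ?_
    rw [Finset.mem_range] at hi
    rw [h2 _ (by omega), map_zero, smul_zero]

/-- The modes of a vacuum vector on another one: `Y(a, z)b = exp(∑ α(-n) z^n / n) ab z^(α, β)`.
This solves the differential equation `Y(Ta, z) = ∂_z Y(a, z)`, as `Ta = α(-1)a`. -/
theorem nprod_vacSpace (hB : ∀ x y, heisForm hH (φ x) (φ y) = B x y) {α β : K} {a : V}
    (ha : a ∈ vacSpace hH (φ α)) (hb : b ∈ vacSpace hH (φ β)) {n : ℤ} (hn : B α β = n) (k : ℕ) :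
    nprod (-n - 1 - k) a b = fockAct φ hH (schur α k) (nprod (-n - 1) a b) := by
  rw [← hB] at hn
  -- both sides satisfy the same recursion, by comparison of the coefficients in
  -- `Y(α(-1)a, z)b = ∂_z Y(a, z)b`
  induction k using Nat.strong_induction_on with
  | _ k ih =>
  rcases k with _ | k
  · rw [schur_zero, fockAct_one, Nat.cast_zero, sub_zero]
  have h1 := nprod_translation a b (-n - 1 - k)
  rw [translation_of_mem ha] at h1
  obtain ⟨N, hN⟩ := nprod_neg_succ_nprod (φ α : V) a b 0 (-n - 1 - k)
  have h2 := hN (max N (k + 1)) (le_max_left _ _)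
  rw [Nat.cast_zero, neg_zero, zero_sub] at h2
  rw [h2, hb.2.2, hn, Finset.sum_eq_zero (s := Finset.range (max N (k + 1)))
    (f := fun i => ((-1) ^ 0 * ((0 + (i + 1)).choose 0) : ℂ) • _)] at h1
  · have h3 : ∑ i ∈ Finset.range (max N (k + 1)), ((0 + i).choose 0 : ℂ) •
        nprod (-(0 + i : ℕ) - 1) (φ α : V) (nprod (-n - 1 - k + i) a b) =
        ∑ i ∈ Finset.range (k + 1), nprod (-(i : ℤ) - 1) (φ α : V)
          (nprod (-n - 1 - (k - i : ℕ)) a b) := by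
      rw [← Finset.sum_subset (Finset.range_mono (le_max_right N (k + 1)))]
      · refine Finset.sum_congr rfl fun i hi => ?_
        rw [Finset.mem_range] at hi
        rw [Nat.choose_zero_right, Nat.cast_one, one_smul, zero_add]
        congr 3
        rw [Nat.cast_sub (by omega)]
        ring_nf
      · intro i _ hi
        rw [Finset.mem_range] at hi
        rw [nprod_eq_zero_of_le ha hb hn _ (by omega), map_zero, smul_zero]
    have h4 := congrArg (fun u => fockAct φ hH u (nprod (-n - 1) a b)) (schur_succ α k)
    rw [map_smul, LinearMap.smul_apply, map_sum, LinearMap.sum_apply,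
      Finset.Nat.sum_antidiagonal_eq_sum_range_succ
        (fun i j => fockAct φ hH (schur α i * gen j α) (nprod (-n - 1) a b)),
      ← Finset.sum_range_reflect] at h4
    have h5 : ∑ i ∈ Finset.range (k + 1), nprod (-(i : ℤ) - 1) (φ α : V)
        (nprod (-n - 1 - (k - i : ℕ)) a b) = ((k + 1 : ℕ) : ℂ) •
          fockAct φ hH (schur α (k + 1)) (nprod (-n - 1) a b) := by
      rw [h4]
      refine Finset.sum_congr rfl fun i hi => ?_
      rw [Finset.mem_range] at hi
      rw [mul_comm, fockAct_gen_mul, ← ih _ (by omega)]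
      congr 3
      omega
    rw [h3, h5] at h1
    have hk : ((k + 1 : ℕ) : ℂ) ≠ 0 := Nat.cast_ne_zero.2 (Nat.succ_ne_zero _)
    refine smul_right_injective V hk (?_ : _ • _ = _ • _)
    have h6 : (-n - 1 - k : ℤ) - 1 = -n - 1 - (k + 1 : ℕ) := by push_cast; ring
    rw [← Int.cast_smul_eq_zsmul ℂ, h6] at h1
    simp only [sub_zero, map_smul, pow_zero, one_smul, add_zero, h6] at h1
    rw [← sub_eq_iff_eq_add.2 h1.symm, ← sub_smul]
    congr 1
    push_cast
    ring
  · intro i _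
    rw [hb.2.1 _ (φ α).2 _ (by omega), map_zero, smul_zero]

/-- The vertex operator of charge `α` represents the field of a vacuum vector of charge `φ(α)`.  The
general case follows from `nprod_vacSpace` by commuting creation operators through both sides. -/
theorem represents_vertexOp (hB : ∀ x y, heisForm hH (φ x) (φ y) = B x y) {α β : K} {a : V}
    (ha : a ∈ vacSpace hH (φ α)) (hb : b ∈ vacSpace hH (φ β)) {n : ℤ} (hn : B α β = n) :
    Represents φ hH b (nprod (-n - 1) a b) n (vertexOp B α) a := by
  intro v
  induction v using fock_induction with
  | one =>
    intro j k
    rw [vertexOp_one_coeff, fockAct_one]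
    split_ifs with h
    · rw [← nprod_vacSpace hB ha hb hn]
      rw [show -n - 1 - ((k - j).toNat : ℤ) = j - k - 1 - n by omega]
    · rw [map_zero, LinearMap.zero_apply, nprod_eq_zero_of_le ha hb ((hB _ _).trans hn)]
      omega
  | add u v hu hv =>
    intro j k
    simp only [TensorProduct.add_tmul, map_add, HahnSeries.coeff_add, LinearMap.add_apply, hu, hv]
  | smul r u hu =>
    intro j k
    simp only [← TensorProduct.smul_tmul', map_smul, HahnSeries.coeff_smul, LinearMap.smul_apply,
      hu]
  | gen_mul m h u hu =>
    intro j k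
    rw [vertexOp_gen_mul, map_sub, LinearMap.sub_apply, fockAct_gen_mul, fockAct_gen_mul, map_smul,
      LinearMap.smul_apply, hu, hu, nprod_vac_comm ha, hB]
    have hs : B h α = B α h := by rw [← hB, (heisForm_symm hH).eq, hB]
    rw [hs, sub_eq_iff_eq_add]
    congr 3
    congr 2
    ring

/-- Iterated normally ordered products represent the fields of the vectors `ux`, `u` in the Fock
space. -/
theorem represents_symmLift {β : K} (hB : ∀ x y, heisForm hH (φ x) (φ y) = B x y)
    (hb : b ∈ vacSpace hH (φ β)) {X : FockPoly K →ₗ[ℂ] FockSeries K} {x : V}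
    (hX : Represents φ hH b c n₀ X x) (u : Fock K) :
    Represents φ hH b c n₀ (symmLift (normalOrder B β) (normalOrder_comm B β) u X)
      (fockAct φ hH u x) := by
  induction u using fock_induction with
  | one => rwa [map_one, map_one, Module.End.one_apply, Module.End.one_apply]
  | add u u' hu hu' =>
    rw [map_add, map_add, LinearMap.add_apply, LinearMap.add_apply]
    exact hu.add hu'
  | smul r u hu =>
    rw [map_smul, map_smul, LinearMap.smul_apply, LinearMap.smul_apply]
    exact hu.smul r
  | gen_mul m h u hu =>
    rw [fockAct_gen_mul, map_mul, Module.End.mul_apply, ← gen_single, symmLift_ι]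
    exact hu.normalOrder hB hb m h

theorem nprod_fockAct_of_not_int (hB : ∀ x y, heisForm hH (φ x) (φ y) = B x y) {α β : K} {a : V}
    (ha : a ∈ vacSpace hH (φ α)) (hb : b ∈ vacSpace hH (φ β)) (hn : ¬ ∃ n : ℤ, B α β = n)
    (m : ℤ) (v : Fock K) : nprod m a (fockAct φ hH v b) = 0 := by
  induction v using fock_induction generalizing m with
  | one => rw [fockAct_one, nprod_eq_zero_of_not_int ha hb (by rwa [hB])]
  | add u u' hu hu' => simp only [map_add, LinearMap.add_apply, hu, hu', add_zero]
  | smul r u hu => simp only [map_smul, LinearMap.smul_apply, hu, smul_zero]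
  | gen_mul n h u hu =>
    have := nprod_vac_comm ha (φ h) (fockAct φ hH u b) (-(n : ℤ) - 1) m
    rwa [hu, hu, map_zero, smul_zero, add_zero, ← fockAct_gen_mul, eq_comm] at this

/-- The action of the Fock space intertwines `fockMode` with the products of `V`. -/
theorem fockAct_fockMode (hB : ∀ x y, heisForm hH (φ x) (φ y) = B x y) {α β : K} {a : V}
    (ha : a ∈ vacSpace hH (φ α)) (hb : b ∈ vacSpace hH (φ β)) (m : ℤ) (u v : Fock K) :
    fockAct φ hH (fockMode B α β m u v) (vacMul hH (φ α) (φ β) a b) =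
      nprod m (fockAct φ hH u a) (fockAct φ hH v b) := by
  by_cases hn : ∃ n : ℤ, B α β = n
  · obtain ⟨n, hn⟩ := hn
    rw [fockMode, if_pos ⟨n, hn⟩, vacMul_of_int ((hB α β).trans hn), hn]
    have h := represents_symmLift hB hb (represents_vertexOp hB ha hb hn) u v 0 (-m - 1 - n)
    rw [show (0 : ℤ) - (-m - 1 - n) - 1 - n = m by ring, LaurentPolynomial.T_zero] at h
    rw [← h, Complex.intCast_re, Int.floor_intCast]
    rfl
  · -- both sides vanish: all products of `a` with the sector of `b` are zero
    have h0 : Represents φ hH b 0 0 (0 : FockPoly K →ₗ[ℂ] FockSeries K) a := fun v j k => by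
      rw [map_zero, nprod_fockAct_of_not_int hB ha hb hn]
    have h := represents_symmLift hB hb h0 u v 0 (-m - 1)
    rw [show (0 : ℤ) - (-m - 1) - 1 - 0 = m by ring] at h
    rw [fockMode, if_neg hn, LinearMap.zero_apply, LinearMap.zero_apply, map_zero,
      LinearMap.zero_apply, ← h, map_zero]

end Represents

/-! ### Homomorphisms from `𝒱(A, K)` given by vacuum vectors -/

section Vtx

variable {K : Type w} [AddCommGroup K] [Module ℂ K] {B : LinearMap.BilinForm ℂ K}

theorem AHPair.Vtx.induction {A : AHPair.{w, v} B} {P : A.Vtx → Prop}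
    (add : ∀ x y, P x → P y → P (x + y))
    (tmul : ∀ α (u : Fock K) (a : A.comp α), P (Vtx.lof A α (u ⊗ₜ a))) (x : A.Vtx) : P x := by
  have zero : P 0 := by simpa using tmul 0 0 0
  induction x using DirectSum.induction_on with
  | zero => exact zero
  | add x y hx hy => exact add x y hx hy
  | of α t =>
    change P (Vtx.lof A α t)
    induction t using TensorProduct.induction_on with
    | zero => simpa using zero
    | tmul u a => exact tmul α u a
    | add s t hs ht => rw [map_add]; exact add _ _ hs ht

theorem AHPair.Vtx.nprod_lof (A : AHPair.{w, v} B) (m : ℤ) (α β : K) (u v : Fock K)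
    (a : A.comp α) (b : A.comp β) :
    nprod m (Vtx.lof A α (u ⊗ₜ a)) (Vtx.lof A β (v ⊗ₜ b)) =
      Vtx.lof A (α + β) (fockMode B α β m u v ⊗ₜ GradedMonoid.GMul.mul a b) := by
  refine (LinearMap.congr_fun (DirectSum.toModule_lof ℂ (M := fun α => Fock K ⊗[ℂ] A.comp α) α _)
    _).trans ?_
  exact LinearMap.congr_fun (DirectSum.toModule_lof ℂ (M := fun α => Fock K ⊗[ℂ] A.comp α) β _) _

theorem AHPair.ofHeis_apply (A : AHPair.{w, v} B) (k : K) :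
    A.ofHeis k = Vtx.lof A 0 (gen 0 k ⊗ₜ GradedMonoid.GOne.one) := rfl

theorem AHPair.ofAlg_of (A : AHPair.{w, v} B) (α : K) (a : A.comp α) :
    A.ofAlg (DirectSum.of A.comp α a) = Vtx.lof A α (1 ⊗ₜ a) := by
  rw [ofAlg, ← DirectSum.lof_eq_of ℂ, DirectSum.toModule_lof]
  rfl

end Vtx

section Construction

variable {V : Type u} [AddCommGroup V] [Module ℂ V] [VertexAlgebra V] {H : Submodule ℂ V}
  (hH : IsHeisenberg H) {K : Type w} [AddCommGroup K] [Module ℂ K] {B : LinearMap.BilinForm ℂ K}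
  (A : AHPair.{w, v} B) (φ : K ≃ₗ[ℂ] H) (g : ∀ α, A.comp α →ₗ[ℂ] V)

/-- The linear map `V_{A,K} → V`, `u ⊗ a ↦ u g(a)`, where the Fock space acts on `V` by creation
operators. -/
def inducedMap : A.Vtx →ₗ[ℂ] V :=
  DirectSum.toModule ℂ K V fun α =>
    TensorProduct.lift ((fockAct φ.toLinearMap hH).toLinearMap.compl₂ (g α))

theorem inducedMap_lof (α : K) (u : Fock K) (a : A.comp α) :
    inducedMap hH A φ g (AHPair.Vtx.lof A α (u ⊗ₜ a)) =
      fockAct φ.toLinearMap hH u (g α a) := by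
  exact DirectSum.toModule_lof ℂ (M := fun α => Fock K ⊗[ℂ] A.comp α) α _

theorem inducedMap_ofHeis (h1 : g 0 GradedMonoid.GOne.one = vac) (k : K) :
    inducedMap hH A φ g (A.ofHeis k) = φ k := by
  rw [AHPair.ofHeis_apply, inducedMap_lof, fockAct_gen, h1]
  exact nprod_neg_one_vac _

variable {A g}

/-- The homomorphism of VH pairs `𝒱(A, K) → (V, H)` extending an isometry `K ≅ H` and a
homomorphism of graded algebras from `A` to the algebra of vacuum vectors of `(V, H)`. -/
def inducedHom (hB : ∀ x y, heisForm hH (φ x) (φ y) = B x y)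
    (hg : ∀ α a, g α a ∈ vacSpace hH (φ α)) (h1 : g 0 GradedMonoid.GOne.one = vac)
    (hm : ∀ α β (a : A.comp α) (b : A.comp β), g (α + β) (GradedMonoid.GMul.mul a b) =
      vacMul hH (φ α) (φ β) (g α a) (g β b)) : VHHom A.heis H where
  toLinearMap := inducedMap hH A φ g
  map_vac := by
    change inducedMap hH A φ g (AHPair.Vtx.lof A 0 (1 ⊗ₜ GradedMonoid.GOne.one)) = vac
    rw [inducedMap_lof, fockAct_one, h1]
  map_nprod m x y := by
    induction x using AHPair.Vtx.induction with
    | add x x' hx hx' => simp only [map_add, LinearMap.add_apply, hx, hx']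
    | tmul α u a =>
      induction y using AHPair.Vtx.induction with
      | add y y' hy hy' => simp only [map_add, hy, hy']
      | tmul β v b =>
        rw [AHPair.Vtx.nprod_lof, inducedMap_lof, inducedMap_lof, inducedMap_lof, hm]
        exact fockAct_fockMode (φ := φ.toLinearMap) hB (hg α a) (hg β b) m u v
  map_heis := by
    rw [AHPair.heis, ← LinearMap.range_comp]
    have : inducedMap hH A φ g ∘ₗ A.ofHeis = H.subtype ∘ₗ φ.toLinearMap :=
      LinearMap.ext fun k => inducedMap_ofHeis hH A φ g h1 k
    rw [this, LinearMap.range_comp, LinearEquiv.range, Submodule.map_top, Submodule.range_subtype]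

end Construction

/-! ### Products in `𝒱(A, K)` and restriction of homomorphisms -/

section HeisenbergModes

variable {K : Type w} [AddCommGroup K] [Module ℂ K] {B : LinearMap.BilinForm ℂ K}

theorem schur_one (α : K) : schur α 1 = gen 0 α := by
  have h := schur_succ α 0
  rwa [Finset.Nat.antidiagonal_zero, Finset.sum_singleton, schur_zero, one_mul, zero_add,
    Nat.cast_one, one_smul] at h

theorem schur_zero_succ (k : ℕ) : schur (0 : K) (k + 1) = 0 := by
  have h := schur_succ (0 : K) k
  simp only [map_zero, mul_zero, Finset.sum_const_zero] at h
  exact (smul_eq_zero.1 h).resolve_left (Nat.cast_ne_zero.2 (Nat.succ_ne_zero _))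

/-- The vertex operator of charge `0` is the identity. -/
theorem vertexOp_zero_coeff (p : FockPoly K) (k : ℤ) :
    (vertexOp B 0 p).coeff k = fockPolyCoeff k p := by
  induction p using fockPoly_induction with
  | add p q hp hq => rw [map_add, map_add, HahnSeries.coeff_add, hp, hq]
  | tmul v j =>
    rw [fockPolyCoeff_tmul_T]
    induction v using fock_induction with
    | one =>
      rw [vertexOp_one_coeff]
      rcases lt_trichotomy j k with h | h | h
      · rw [if_pos h.le, if_neg h.ne]
        obtain ⟨i, hi⟩ : ∃ i : ℕ, (k - j).toNat = i + 1 := ⟨(k - j).toNat - 1, by omega⟩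
        rw [hi, schur_zero_succ]
      · rw [if_pos h.le, if_pos h, h, sub_self, Int.toNat_zero, schur_zero]
      · rw [if_neg (by omega), if_neg (by omega)]
    | add u v hu hv =>
      rw [TensorProduct.add_tmul, map_add, HahnSeries.coeff_add, hu, hv]
      split_ifs <;> simp
    | smul r u hu =>
      rw [← TensorProduct.smul_tmul', map_smul, HahnSeries.coeff_smul, hu]
      split_ifs <;> simp
    | gen_mul n h u hu =>
      rw [vertexOp_gen_mul, map_zero, LinearMap.zero_apply, zero_smul, sub_zero, hu]
      split_ifs <;> simp

/-- The modes of the Heisenberg fields on `V_{A,K}`. -/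
theorem fockMode_gen_zero (β : K) (m : ℤ) (h : K) (u : Fock K) :
    fockMode B 0 β m (gen 0 h) u =
      (if m < 0 then gen (-m - 1).toNat h * u else 0) +
      (fockPolyCoeff (-m - 1) (fockDer (contraction B (Finsupp.single 0 h)) (u ⊗ₜ 1)) +
      if m = 0 then B h β • u else 0) := by
  have hmode : fockMode B 0 β m (gen 0 h) u =
      (creation (Finsupp.single 0 h) * vertexOp B 0 (u ⊗ₜ 1)).coeff (-m - 1) +
      (vertexOp B 0 (fockDer (contraction B (Finsupp.single 0 h)) (u ⊗ₜ 1) +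
        (1 ⊗ₜ zeroMode B β (Finsupp.single 0 h)) * (u ⊗ₜ 1))).coeff (-m - 1) := by
    have h1 : fockMode B 0 β m =
        (fockField B 0 β).compr₂ (fockCoeff (-m - 1 - ⌊(B 0 β).re⌋)) := if_pos ⟨0, by simp⟩
    rw [h1, map_zero, LinearMap.zero_apply, Complex.zero_re, Int.floor_zero, sub_zero]
    change (symmLift (normalOrder B β) (normalOrder_comm B β) (gen 0 h) (vertexOp B 0)
      (u ⊗ₜ 1)).coeff (-m - 1) = _
    rw [← gen_single, symmLift_ι, ← HahnSeries.coeff_add]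
    rfl
  rw [hmode]
  congr 1
  · obtain ⟨N, hN, e⟩ := coeff_ofPowerSeries_mul
      (PowerSeries.mk fun k => ((0 + k).choose 0 : ℂ) • gen (0 + k) h)
      (vertexOp B 0 (u ⊗ₜ 1)) (-m - 1)
    rw [creation_single, e]
    have hterm : ∀ i : ℕ, (vertexOp B 0 (u ⊗ₜ 1)).coeff (-m - 1 - i) =
        if m = -(i : ℤ) - 1 then u else 0 := by
      intro i
      rw [vertexOp_zero_coeff, ← LaurentPolynomial.T_zero, fockPolyCoeff_tmul_T]
      congr 1
      rw [eq_iff_iff]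
      omega
    simp only [hterm] at hN ⊢
    split_ifs with hm
    · rcases Nat.lt_or_ge (-m - 1).toNat N with hlt | hge
      · rw [Finset.sum_eq_single_of_mem _ (Finset.mem_range.2 hlt)]
        · rw [if_pos (by omega), PowerSeries.coeff_mk]
          simp
        · intro i _ hi
          rw [if_neg (by omega), mul_zero]
      · have hu := hN _ hge
        rw [if_pos (by omega)] at hu
        simp [hu]
    · refine Finset.sum_eq_zero fun i _ => ?_
      rw [if_neg (by omega), mul_zero]
  · rw [vertexOp_zero_coeff, map_add]
    congr 1
    rw [zeroMode_single, Algebra.TensorProduct.tmul_mul_tmul, one_mul, mul_one,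
      TensorProduct.tmul_smul, map_smul, fockPolyCoeff_tmul_T]
    split_ifs with h1 h2 h2
    · simp
    · omega
    · omega
    · simp

theorem AHPair.Vtx.lof_one_mul (A : AHPair.{w, v} B) (β : K) (u : Fock K) (b : A.comp β) :
    Vtx.lof A (0 + β) (u ⊗ₜ GradedMonoid.GMul.mul GradedMonoid.GOne.one b) =
      Vtx.lof A β (u ⊗ₜ b) :=
  congrArg (fun x : GradedMonoid A.comp => Vtx.lof A x.1 (u ⊗ₜ x.2))
    (GradedMonoid.GMonoid.one_mul (⟨β, b⟩ : GradedMonoid A.comp))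

theorem AHPair.Vtx.lof_mul_one (A : AHPair.{w, v} B) (β : K) (u : Fock K) (b : A.comp β) :
    Vtx.lof A (β + 0) (u ⊗ₜ GradedMonoid.GMul.mul b GradedMonoid.GOne.one) =
      Vtx.lof A β (u ⊗ₜ b) :=
  congrArg (fun x : GradedMonoid A.comp => Vtx.lof A x.1 (u ⊗ₜ x.2))
    (GradedMonoid.GMonoid.mul_one (⟨β, b⟩ : GradedMonoid A.comp))

variable (A : AHPair.{w, v} B)

theorem AHPair.nprod_ofHeis (m : ℤ) (h β : K) (u : Fock K) (b : A.comp β) :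
    nprod m (A.ofHeis h) (Vtx.lof A β (u ⊗ₜ b)) =
      Vtx.lof A β (fockMode B 0 β m (gen 0 h) u ⊗ₜ b) := by
  rw [ofHeis_apply, Vtx.nprod_lof, Vtx.lof_one_mul]

theorem AHPair.nprod_ofHeis_neg (n : ℕ) (h β : K) (u : Fock K) (b : A.comp β) :
    nprod (-(n : ℤ) - 1) (A.ofHeis h) (Vtx.lof A β (u ⊗ₜ b)) =
      Vtx.lof A β ((gen n h * u) ⊗ₜ b) := by
  rw [nprod_ofHeis, fockMode_gen_zero, if_pos (by omega), if_neg (by omega),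
    fockPolyCoeff_contraction_eq_zero, add_zero, add_zero,
    show (-(-(n : ℤ) - 1) - 1).toNat = n by omega]
  · intro l
    push_cast
    omega

theorem AHPair.nprod_ofHeis_zero (h β : K) (b : A.comp β) :
    nprod 0 (A.ofHeis h) (Vtx.lof A β (1 ⊗ₜ b)) = B h β • Vtx.lof A β (1 ⊗ₜ b) := by
  rw [nprod_ofHeis, fockMode_gen_zero, if_neg (by omega), if_pos rfl, fockDer_one, map_zero,
    zero_add, zero_add, ← TensorProduct.smul_tmul', map_smul]

theorem AHPair.nprod_ofHeis_pos {m : ℤ} (hm : 1 ≤ m) (h β : K) (b : A.comp β) :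
    nprod m (A.ofHeis h) (Vtx.lof A β (1 ⊗ₜ b)) = 0 := by
  rw [nprod_ofHeis, fockMode_gen_zero, if_neg (by omega), if_neg (by omega), fockDer_one, map_zero,
    zero_add, zero_add, TensorProduct.zero_tmul, map_zero]

theorem AHPair.nprod_one_ofHeis (h h' : K) :
    nprod 1 (A.ofHeis h) (A.ofHeis h') = B h h' • (vac : A.Vtx) := by
  have h1 : fockDer (contraction B (Finsupp.single 0 h)) (gen 0 h' ⊗ₜ 1) =
      1 ⊗ₜ contraction B (Finsupp.single 0 h) (Finsupp.single 0 h') := by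
    rw [← gen_single, fockDer_ι]
  rw [ofHeis_apply A h', nprod_ofHeis, fockMode_gen_zero, if_neg (by omega), if_neg (by omega), h1,
    contraction_single, TensorProduct.tmul_smul, map_smul, fockPolyCoeff_tmul_T,
    if_pos (by norm_num), zero_add, add_zero, ← TensorProduct.smul_tmul', map_smul]
  simp
  rfl

theorem fockMode_one_one {α β : K} {n : ℤ} (hn : B α β = n) (k : ℕ) :
    fockMode B α β (-n - 1 - k) 1 1 = schur α k := by
  rw [fockMode, if_pos ⟨n, hn⟩, hn, Complex.intCast_re, Int.floor_intCast]
  change (symmLift (normalOrder B β) (normalOrder_comm B β) 1 (vertexOp B α)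
      (1 ⊗ₜ 1)).coeff (-(-n - 1 - k) - 1 - n) = _
  rw [map_one, Module.End.one_apply, ← LaurentPolynomial.T_zero, vertexOp_one_coeff,
    if_pos (by omega)]
  congr 1
  omega

theorem AHPair.vac_eq_lof :
    (vac : A.Vtx) = Vtx.lof A 0 (1 ⊗ₜ GradedMonoid.GOne.one) := rfl

theorem AHPair.nprod_ofAlg_vac (α : K) (a : A.comp α) :
    nprod (-2) (Vtx.lof A α (1 ⊗ₜ a)) vac = nprod (-1) (A.ofHeis α) (Vtx.lof A α (1 ⊗ₜ a)) := by
  have h1 := A.nprod_ofHeis_neg 0 α α 1 a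
  rw [Nat.cast_zero, neg_zero, zero_sub] at h1
  rw [h1, mul_one, ← schur_one]
  have h2 : fockMode B α 0 (-2) 1 1 = schur α 1 :=
    fockMode_one_one (n := 0) (by simp) 1
  rw [vac_eq_lof, Vtx.nprod_lof, h2, Vtx.lof_mul_one]

theorem AHPair.nprod_ofAlg_ofAlg {α β : K} {n : ℤ} (hn : B α β = n) (a : A.comp α)
    (b : A.comp β) :
    nprod (-n - 1) (Vtx.lof A α (1 ⊗ₜ a)) (Vtx.lof A β (1 ⊗ₜ b)) =
      Vtx.lof A (α + β) (1 ⊗ₜ GradedMonoid.GMul.mul a b) := by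
  have h := fockMode_one_one hn 0
  rw [Nat.cast_zero, sub_zero, schur_zero] at h
  rw [Vtx.nprod_lof, h]

end HeisenbergModes

section Restriction

variable {V : Type u} [AddCommGroup V] [Module ℂ V] [VertexAlgebra V] {H : Submodule ℂ V}
  {K : Type w} [AddCommGroup K] [Module ℂ K] {B : LinearMap.BilinForm ℂ K} {A : AHPair.{w, v} B}

/-- The operator `ω_H(0)` acts as `α(-1)` on every vector of charge `α` that is annihilated by the
positive modes of `H`. -/
theorem nprod_zero_omegaVec (hH : IsHeisenberg H) {α : H} {v : V}
    (hpos : ∀ h ∈ H, ∀ n : ℤ, 1 ≤ n → nprod n h v = 0)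
    (hzero : ∀ h : H, nprod 0 (h : V) v = heisForm hH h α • v) :
    nprod 0 (omegaVec hH) v = nprod (-1) (α : V) v := by
  have := hH.finite
  have hquad : ∀ h h' : H, nprod 0 (nprod (-1) (h : V) (h' : V)) v =
      heisForm hH h' α • nprod (-1) (h : V) v + heisForm hH h α • nprod (-1) (h' : V) v := by
    intro h h'
    rw [nprod_iterate, finsum_eq_single _ 0]
    · simp only [Nat.cast_zero, sub_zero, add_zero, hzero, pow_zero, Ring.choose_zero_right]
      simp
    · intro i hi
      rw [hpos _ h.2 _ (by omega), hpos _ h'.2 _ (by omega)]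
      simp
  rw [omegaVec]
  simp only [map_smul, map_sum, LinearMap.smul_apply, LinearMap.sum_apply, hquad,
    Finset.sum_add_distrib]
  set b := Module.finBasis ℂ H
  set b' := (heisForm hH).dualBasis (heisForm_nondeg hH) b
  have e2 : ∑ i, heisForm hH (b i) α • b' i = α := sum_dualBasis hH b α
  have e1 : ∑ i, heisForm hH (b' i) α • b i = α := by
    have := sum_dualBasis hH b' α
    rwa [LinearMap.BilinForm.dualBasis_dualBasis _ (heisForm_symm hH)] at this
  have e1' := congrArg (fun x : H => nprod (-1) (x : V) v) e1
  have e2' := congrArg (fun x : H => nprod (-1) (x : V) v) e2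
  simp only [AddSubmonoidClass.coe_finsetSum, Submodule.coe_smul, map_sum, map_smul,
    LinearMap.sum_apply, LinearMap.smul_apply] at e1' e2'
  rw [e1', e2', ← two_smul ℂ, smul_smul]
  norm_num

/-- A homomorphism from `𝒱(A, K)` to `(V, H)` restricts to an isometry `K ≅ H`. -/
theorem VHHom.exists_isometry (hH : IsHeisenberg H) (hB : B.Nondegenerate) (F : VHHom A.heis H) :
    ∃ φ : K ≃ₗ[ℂ] H, (∀ k, F.toLinearMap (A.ofHeis k) = φ k) ∧
      ∀ x y, heisForm hH (φ x) (φ y) = B x y := by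
  have hrange : LinearMap.range (F.toLinearMap ∘ₗ A.ofHeis) = H := by
    rw [LinearMap.range_comp]
    exact F.map_heis
  let φ₀ : K →ₗ[ℂ] H := (F.toLinearMap ∘ₗ A.ofHeis).codRestrict H fun k =>
    hrange.le ⟨k, rfl⟩
  have hφ₀ : ∀ x y, heisForm hH (φ₀ x) (φ₀ y) = B x y := by
    intro x y
    have h := congrArg F.toLinearMap (A.nprod_one_ofHeis x y)
    rw [F.map_nprod, map_smul, F.map_vac] at h
    refine smul_left_injective ℂ (vac_ne_zero (V := V)) ?_
    exact (heisForm_spec hH (φ₀ x) (φ₀ y)).symm.trans h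
  refine ⟨LinearEquiv.ofBijective φ₀ ⟨?_, ?_⟩, fun k => rfl, hφ₀⟩
  · rw [injective_iff_map_eq_zero]
    intro k hk
    refine hB.1 k fun y => ?_
    rw [← hφ₀, hk, map_zero, LinearMap.zero_apply]
  · rintro ⟨h, hh⟩
    obtain ⟨k, hk⟩ := hrange.ge hh
    exact ⟨k, Subtype.ext hk⟩

variable {hH : IsHeisenberg H} {φ : K ≃ₗ[ℂ] H} {F : VHHom A.heis H}

/-- A homomorphism from `𝒱(A, K)` is determined by its restrictions to `K` and to `A`. -/
theorem VHHom.apply_lof (hF : ∀ k, F.toLinearMap (A.ofHeis k) = φ k) (α : K) (u : Fock K)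
    (a : A.comp α) : F.toLinearMap (AHPair.Vtx.lof A α (u ⊗ₜ a)) =
      fockAct φ.toLinearMap hH u (F.toLinearMap (AHPair.Vtx.lof A α (1 ⊗ₜ a))) := by
  induction u using fock_induction with
  | one => rw [fockAct_one]
  | add u v hu hv => simp only [TensorProduct.add_tmul, map_add, hu, hv, LinearMap.add_apply]
  | smul r u hu => simp only [← TensorProduct.smul_tmul', map_smul, hu, LinearMap.smul_apply]
  | gen_mul n k u hu =>
    rw [← A.nprod_ofHeis_neg, F.map_nprod, hF, fockAct_gen_mul, hu]
    rfl

/-- A homomorphism from `𝒱(A, K)` to `(V, H)` maps `1 ⊗ a`, `a ∈ A^α`, to a vacuum vector. -/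
theorem VHHom.apply_ofAlg_mem (hF : ∀ k, F.toLinearMap (A.ofHeis k) = φ k)
    (hφ : ∀ x y, heisForm hH (φ x) (φ y) = B x y) (α : K) (a : A.comp α) :
    F.toLinearMap (AHPair.Vtx.lof A α (1 ⊗ₜ a)) ∈ vacSpace hH (φ α) := by
  set v := F.toLinearMap (AHPair.Vtx.lof A α (1 ⊗ₜ a)) with hv
  have h2 : ∀ h ∈ H, ∀ n : ℤ, 1 ≤ n → nprod n h v = 0 := by
    intro h hh n hn
    obtain ⟨k, hk⟩ := φ.surjective ⟨h, hh⟩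
    have : h = φ k := by rw [hk]
    rw [this, ← hF, hv, ← F.map_nprod, A.nprod_ofHeis_pos hn, map_zero]
  have h3 : ∀ h : H, nprod 0 (h : V) v = heisForm hH h (φ α) • v := by
    intro h
    obtain ⟨k, rfl⟩ := φ.surjective h
    rw [← hF, hv, ← F.map_nprod, A.nprod_ofHeis_zero, map_smul, hφ]
  refine ⟨?_, h2, h3⟩
  have h1 : translation v = nprod (-1) (φ α : V) v := by
    rw [translation_apply, ← hF, hv, ← F.map_vac, ← F.map_nprod, ← F.map_nprod, A.nprod_ofAlg_vac]
  rw [h1, nprod_zero_omegaVec hH h2 h3]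

end Restriction

/-! ### Irreducibility of the Fock space and injectivity -/

section Derivatives

/-- A nonzero space of polynomials that is stable under partial derivatives contains `1`. -/
theorem mvPolynomial_eq_zero_of_pderiv_mem {σ : Type*} (Q : Submodule ℂ (MvPolynomial σ ℂ))
    (h1 : 1 ∉ Q) (hQ : ∀ i, ∀ p ∈ Q, MvPolynomial.pderiv i p ∈ Q) (p : MvPolynomial σ ℂ)
    (hp : p ∈ Q) : p = 0 := by
  have hC : ∀ c : ℂ, MvPolynomial.C c ∈ Q → c = 0 := by
    intro c hc
    by_contra hne
    refine h1 ?_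
    have := Q.smul_mem c⁻¹ hc
    rwa [← MvPolynomial.C_mul', ← map_mul, inv_mul_cancel₀ hne, map_one] at this
  -- induction on the total degree: the partial derivatives of `p` vanish, so `p` is constant
  suffices h : ∀ (N : ℕ) (p : MvPolynomial σ ℂ), p ∈ Q → (∀ m ∈ p.support, m.degree < N) →
      p = 0 from h (p.support.sup Finsupp.degree + 1) p hp fun m hm =>
        Nat.lt_succ_of_le (Finset.le_sup hm)
  intro N
  induction N with
  | zero =>
    intro p _ hd
    ext m
    by_contra hm
    exact absurd (hd m (MvPolynomial.mem_support_iff.2 hm)) (Nat.not_lt_zero _)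
  | succ N ih =>
    intro p hp hd
    have hder : ∀ i, MvPolynomial.pderiv i p = 0 := by
      intro i
      refine ih _ (hQ i p hp) fun m hm => ?_
      rw [MvPolynomial.mem_support_iff, MvPolynomial.coeff_pderiv] at hm
      have := hd _ (MvPolynomial.mem_support_iff.2 (left_ne_zero_of_mul hm))
      rw [map_add, Finsupp.degree_single] at this
      omega
    have hconst : p = MvPolynomial.C (MvPolynomial.coeff 0 p) := by
      ext m
      rw [MvPolynomial.coeff_C]
      split_ifs with hm
      · rw [hm]
      · obtain ⟨i, hi⟩ : ∃ i, m i ≠ 0 := by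
          by_contra! h
          exact hm (Finsupp.ext h).symm
        have h2 := congrArg (MvPolynomial.coeff (m - Finsupp.single i 1)) (hder i)
        rw [MvPolynomial.coeff_pderiv, MvPolynomial.coeff_zero, tsub_add_cancel_of_le] at h2
        · refine (mul_eq_zero.1 h2).resolve_right ?_
          exact Nat.cast_add_one_ne_zero _
        · intro j
          rw [Finsupp.single_apply]
          split_ifs with hj
          · subst hj
            omega
          · exact Nat.zero_le _
    have h0 : MvPolynomial.coeff 0 p = 0 := hC _ (by rwa [← hconst])
    rw [hconst, h0, map_zero]

variable {K : Type w} [AddCommGroup K] [Module ℂ K] (B : LinearMap.BilinForm ℂ K)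

/-- The derivation of the Fock space with `h'(-l-1) ↦ (l+1) (h, h')`, i.e. the annihilation
operator `h(l+1)`. -/
def fockAnnih (l : ℕ) (h : K) : Fock K →ₗ[ℂ] Fock K :=
  fockPolyCoeff (-(l : ℤ) - 2) ∘ₗ fockDer (contraction B (Finsupp.single 0 h)) ∘ₗ
    (TensorProduct.mk ℂ (Fock K) (LaurentPolynomial ℂ)).flip 1

theorem fockAnnih_one (l : ℕ) (h : K) : fockAnnih B l h 1 = 0 := by
  change fockPolyCoeff _ (fockDer _ (1 ⊗ₜ 1)) = 0
  rw [fockDer_one, map_zero]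

theorem fockAnnih_gen_mul (l : ℕ) (h : K) (m : ℕ) (k : K) (u : Fock K) :
    fockAnnih B l h (gen m k * u) = gen m k * fockAnnih B l h u +
      if m = l then (((l : ℂ) + 1) * B h k) • u else 0 := by
  change fockPolyCoeff _ (fockDer _ ((gen m k * u) ⊗ₜ 1)) =
    gen m k * fockPolyCoeff _ (fockDer _ (u ⊗ₜ 1)) + _
  rw [fockDer_gen_mul, map_add, fockPolyCoeff_mul, contraction_single, TensorProduct.tmul_smul,
    map_smul, fockPolyCoeff_tmul_T]
  congr 1
  by_cases hml : m = l
  · subst hml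
    rw [if_pos rfl, if_pos (by simp), Ring.choose_zero_right]
    congr 1
    push_cast
    ring
  · rw [if_neg hml, if_neg (by omega), smul_zero]

/-- The Fock space is irreducible: a subspace that is stable under the annihilation operators and
does not contain the vacuum vector is zero. -/
theorem fock_eq_zero_of_annih_mem [Module.Finite ℂ K] (hB : B.Nondegenerate)
    (P : Submodule ℂ (Fock K)) (h1 : 1 ∉ P)
    (hP : ∀ (l : ℕ) (h : K), ∀ u ∈ P, fockAnnih B l h u ∈ P) (u : Fock K) (hu : u ∈ P) : u = 0 := by
  -- in the coordinates given by dual bases, annihilation operators are partial derivatives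
  let b := Module.finBasis ℂ K
  let b' := B.dualBasis hB b
  let bb := Finsupp.basis (R := ℂ) (fun _ : ℕ => b)
  let e := SymmetricAlgebra.equivMvPolynomial bb
  have hX : ∀ n i, e.symm (MvPolynomial.X ⟨n, i⟩) = gen n (b i) := by
    intro n i
    rw [SymmetricAlgebra.equivMvPolynomial_symm_X, ← gen_single]
    congr 1
    simp [bb, Finsupp.coe_basis]
  have hder : ∀ (l i) (p), e.symm (MvPolynomial.pderiv ⟨l, i⟩ p) =
      ((l : ℂ) + 1)⁻¹ • fockAnnih B l (b' i) (e.symm p) := by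
    intro l i p
    have hl : (l : ℂ) + 1 ≠ 0 := by exact_mod_cast Nat.succ_ne_zero l
    induction p using MvPolynomial.induction_on with
    | C a =>
      rw [MvPolynomial.pderiv_C, map_zero, ← MvPolynomial.algebraMap_eq, AlgEquiv.commutes,
        Algebra.algebraMap_eq_smul_one, map_smul, fockAnnih_one, smul_zero, smul_zero]
    | add p q hp hq => simp only [map_add, hp, hq, smul_add]
    | mul_X p j hp =>
      obtain ⟨m, j⟩ := j
      rw [mul_comm, Derivation.leibniz, map_add, smul_eq_mul, smul_eq_mul, map_mul, map_mul,
        map_mul, hX, hp, fockAnnih_gen_mul, smul_add, mul_smul_comm]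
      congr 1
      rw [MvPolynomial.pderiv_X, Pi.single_apply]
      by_cases hml : m = l
      · subst hml
        rw [if_pos rfl, smul_smul, ← mul_assoc, inv_mul_cancel₀ hl, one_mul,
          LinearMap.BilinForm.apply_dualBasis_left]
        by_cases hij : j = i
        · subst hij
          simp
        · rw [if_neg hij, if_neg, map_zero, mul_zero, zero_smul]
          simpa using hij
      · rw [if_neg hml, if_neg, map_zero, mul_zero, smul_zero]
        simp only [Sigma.mk.injEq, not_and]
        intro h
        exact absurd h hml
  have key := mvPolynomial_eq_zero_of_pderiv_mem (P.comap e.symm.toLinearMap) (by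
    simpa using h1) (fun i p hp => by
      obtain ⟨l, i⟩ := i
      change e.symm _ ∈ P
      rw [hder]
      exact P.smul_mem _ (hP l _ _ hp)) (e u) (by simpa using hu)
  simpa using key

end Derivatives

section Injectivity

variable {V : Type u} [AddCommGroup V] [Module ℂ V] [VertexAlgebra V] {H : Submodule ℂ V}
  {hH : IsHeisenberg H} {K : Type w} [AddCommGroup K] [Module ℂ K] {B : LinearMap.BilinForm ℂ K}
  {φ : K ≃ₗ[ℂ] H}

/-- The Fock space acts freely on a nonzero vacuum vector. -/
theorem fockAct_injective (hφ : ∀ x y, heisForm hH (φ x) (φ y) = B x y) {α : H} {w : V}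
    (hw : w ∈ vacSpace hH α) (hw0 : w ≠ 0) {u : Fock K}
    (hu : fockAct φ.toLinearMap hH u w = 0) : u = 0 := by
  have := hH.finite
  have : Module.Finite ℂ K := Module.Finite.equiv φ.symm
  have hs : B.IsSymm := ⟨fun x y => by
    rw [← hφ, ← hφ, (heisForm_symm hH).eq]⟩
  have hnd : ∀ x, (∀ y, B x y = 0) → x = 0 := by
    intro x hx
    rw [← φ.map_eq_zero_iff]
    refine (heisForm_nondeg hH).1 _ fun y => ?_
    obtain ⟨y, rfl⟩ := φ.surjective y
    rw [hφ, hx]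
  have hB : B.Nondegenerate := ⟨hnd, fun x hx => hnd x fun y => by rw [← hs.eq]; exact hx y⟩
  -- the annihilator of `w` is stable under annihilation operators, as these kill `w`
  refine fock_eq_zero_of_annih_mem B hB
    (LinearMap.ker ((fockAct φ.toLinearMap hH).toLinearMap.flip w)) ?_ ?_ u hu
  · intro h
    refine hw0 ?_
    rw [← fockAct_one φ.toLinearMap hH w]
    exact h
  · intro l h u hu
    change fockAct φ.toLinearMap hH _ w = 0
    have hu' : fockAct φ.toLinearMap hH u w = 0 := hu
    have h2 := fockAct_contraction φ.toLinearMap hH (B := B) hφ 0 h u l w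
    rw [hu', map_zero, hw.2.1 _ (φ.toLinearMap h).2 ((l : ℤ) + 1) (by omega), map_zero, sub_zero,
      smul_zero] at h2
    rwa [Nat.cast_zero, sub_zero] at h2

/-- The eigenspaces of the zero modes of `H` are independent. -/
theorem iSupIndep_weightSpace (hH : IsHeisenberg H) :
    iSupIndep fun α : H => ⨅ h : H, Module.End.maxGenEigenspace (nprod 0 (h : V))
      (heisForm hH h α) := by
  refine (Module.End.independent_iInf_maxGenEigenspace_of_forall_mapsTo
    (fun h : H => (nprod 0 (h : V) : Module.End ℂ V)) fun i j c =>
      Module.End.mapsTo_maxGenEigenspace_of_comm ?_ c).comp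
        (f := fun (α h : H) => heisForm hH h α) ?_
  · refine LinearMap.ext fun v => ?_
    have := heis_comm hH j i v 0 0
    simpa using this
  · intro α β hαβ
    rw [← sub_eq_zero]
    refine (heisForm_nondeg hH).2 _ fun h => ?_
    rw [map_sub, sub_eq_zero]
    exact congrFun hαβ h

/-- A homomorphism from `𝒱(A, K)` is injective if the homogeneous components of `A` are at most
one-dimensional and are embedded in `V`. -/
theorem VHHom.injective {A : AHPair.{w, v} B} {F : VHHom A.heis H}
    (hF : ∀ k, F.toLinearMap (A.ofHeis k) = φ k)
    (hφ : ∀ x y, heisForm hH (φ x) (φ y) = B x y)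
    (hdim : ∀ α (a b : A.comp α), a ≠ 0 → ∃ c : ℂ, b = c • a)
    (hinj : ∀ α (a : A.comp α), F.toLinearMap (AHPair.Vtx.lof A α (1 ⊗ₜ a)) = 0 → a = 0) :
    Function.Injective F.toLinearMap := by
  have hcomp : ∀ α (t : Fock K ⊗[ℂ] A.comp α), F.toLinearMap (AHPair.Vtx.lof A α t) = 0 →
      t = 0 := by
    intro α t ht
    by_cases h0 : ∃ a : A.comp α, a ≠ 0
    · obtain ⟨a, ha⟩ := h0
      obtain ⟨u, rfl⟩ : ∃ u, t = u ⊗ₜ a := by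
        clear ht
        induction t using TensorProduct.induction_on with
        | zero => exact ⟨0, by rw [TensorProduct.zero_tmul]⟩
        | tmul u b =>
          obtain ⟨c, rfl⟩ := hdim α a b ha
          exact ⟨c • u, by rw [TensorProduct.tmul_smul, TensorProduct.smul_tmul']⟩
        | add s t hs ht =>
          obtain ⟨u, rfl⟩ := hs
          obtain ⟨v, rfl⟩ := ht
          exact ⟨u + v, by rw [TensorProduct.add_tmul]⟩
      rw [F.apply_lof (hH := hH) hF] at ht
      rw [fockAct_injective hφ (F.apply_ofAlg_mem hF hφ α a) (fun h => ha (hinj α a h)) ht,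
        TensorProduct.zero_tmul]
    · have : Subsingleton (A.comp α) := ⟨fun a b => by
        by_contra hab
        exact h0 ⟨a - b, sub_ne_zero.2 hab⟩⟩
      exact Subsingleton.elim _ _
  -- the images of the sectors lie in different eigenspaces, so the kernel is graded
  have hmem : ∀ α (t : Fock K ⊗[ℂ] A.comp α), F.toLinearMap (AHPair.Vtx.lof A α t) ∈
      ⨅ h : H, Module.End.maxGenEigenspace (nprod 0 (h : V)) (heisForm hH h (φ α)) := by
    intro α t
    induction t using TensorProduct.induction_on with
    | zero => rw [map_zero, map_zero]; exact Submodule.zero_mem _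
    | add s t hs ht => rw [map_add, map_add]; exact Submodule.add_mem _ hs ht
    | tmul u a =>
      rw [Submodule.mem_iInf]
      intro h
      refine Module.End.mem_maxGenEigenspace _ _ _ |>.2 ⟨1, ?_⟩
      rw [pow_one, LinearMap.sub_apply, F.apply_lof (hH := hH) hF, nprod_zero_fockAct,
        (F.apply_ofAlg_mem hF hφ α a).2.2, map_smul]
      simp
  rw [injective_iff_map_eq_zero]
  intro (x : ⨁ α, Fock K ⊗[ℂ] A.comp α) hx
  have hsum : ∑ α ∈ DFinsupp.support x, F.toLinearMap (AHPair.Vtx.lof A α (x α)) = 0 := by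
    rw [← map_sum, ← hx]
    congr 1
    exact DirectSum.sum_support_of x
  have hind := ((iSupIndep_weightSpace hH).comp φ.injective)
  rw [iSupIndep_iff_finsetSum_eq_zero_imp_eq_zero] at hind
  have hz := hind (DFinsupp.support x) (fun α => F.toLinearMap (AHPair.Vtx.lof A α (x α)))
    (fun α _ => hmem α (x α)) hsum
  refine DFinsupp.ext fun α => ?_
  by_cases hα : α ∈ DFinsupp.support x
  · exact hcomp α _ (hz α hα)
  · exact DFinsupp.notMem_support_iff.1 hα

end Injectivity

/-! ### Symmetric cocycles, graded homomorphisms and lattice pairs -/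

section Cocycle

variable {L : Type*} [AddCommGroup L]

/-- The central extension `ℂˣ ×_d L` of an abelian group `L` by `ℂˣ` given by a function
`d : L → L → ℂˣ`: the set `ℂˣ × L` with `(x, a) + (y, b) = (x y d(a, b), a + b)`.  It is a group if
`d` is a 2-cocycle, which is not assumed to be normalized: the zero element is
`(d(0, 0)⁻¹, 0)`. -/
@[ext]
structure CentralExt (d : L → L → ℂˣ) where
  unit : ℂˣ
  base : L

/-- `ℂˣ` is divisible, as `ℂ` is algebraically closed. -/
theorem exists_divisibleBy_units : Nonempty (DivisibleBy (Additive ℂˣ) ℤ) := by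
  refine ⟨divisibleByOfSMulRightSurj _ _ ?_⟩
  intro n hn x
  obtain ⟨z, hz⟩ := IsAlgClosed.exists_pow_nat_eq ((x.toMul : ℂˣ) : ℂ) (Int.natAbs_pos.2 hn)
  have hz0 : z ≠ 0 := by
    rintro rfl
    rw [zero_pow (Int.natAbs_pos.2 hn).ne'] at hz
    exact x.toMul.ne_zero hz.symm
  have hz' : (Units.mk0 z hz0) ^ n.natAbs = x.toMul := Units.ext (by simpa using hz)
  rcases Int.natAbs_eq n with h | h
  · refine ⟨Additive.ofMul (Units.mk0 z hz0), ?_⟩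
    dsimp only
    rw [h, ← ofMul_zpow, zpow_natCast, hz']
    rfl
  · refine ⟨Additive.ofMul (Units.mk0 z hz0)⁻¹, ?_⟩
    dsimp only
    rw [h, ← ofMul_zpow, zpow_neg, inv_zpow, inv_inv, zpow_natCast, hz']
    rfl

/-- A symmetric 2-cocycle with values in `ℂˣ` is a coboundary, because the corresponding extension
is abelian and `ℂˣ` is divisible, hence injective. -/
theorem exists_coboundary (d : L → L → ℂˣ) (hs : ∀ a b, d a b = d b a)
    (hc : ∀ a b c, d a b * d (a + b) c = d a (b + c) * d b c) :
    ∃ t : L → ℂˣ, ∀ a b, d a b * t (a + b) = t a * t b := by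
  have h0 : ∀ c, d 0 c = d 0 0 := by
    intro c
    have := hc 0 0 c
    rw [add_zero, zero_add] at this
    exact (mul_right_cancel this).symm
  let i1 : Add (CentralExt d) := ⟨fun x y => ⟨x.unit * y.unit * d x.base y.base, x.base + y.base⟩⟩
  let i2 : Zero (CentralExt d) := ⟨⟨(d 0 0)⁻¹, 0⟩⟩
  let i3 : Neg (CentralExt d) :=
    ⟨fun x => ⟨x.unit⁻¹ * (d (-x.base) x.base)⁻¹ * (d 0 0)⁻¹, -x.base⟩⟩
  let i4 : AddGroup (CentralExt d) := AddGroup.ofLeftAxioms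
    (fun x y z => by
      refine CentralExt.ext ?_ (add_assoc _ _ _)
      change x.unit * y.unit * d x.base y.base * z.unit * d (x.base + y.base) z.base =
        x.unit * (y.unit * z.unit * d y.base z.base) * d x.base (y.base + z.base)
      have := hc x.base y.base z.base
      calc _ = x.unit * y.unit * z.unit * (d x.base y.base * d (x.base + y.base) z.base) := by
            ac_rfl
        _ = _ := by
            rw [this]
            ac_rfl)
    (fun x => by
      refine CentralExt.ext ?_ (zero_add _)
      change (d 0 0)⁻¹ * x.unit * d 0 x.base = x.unit
      rw [h0 x.base, mul_right_comm, inv_mul_cancel, one_mul])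
    (fun x => by
      refine CentralExt.ext ?_ (neg_add_cancel _)
      change x.unit⁻¹ * (d (-x.base) x.base)⁻¹ * (d 0 0)⁻¹ * x.unit * d (-x.base) x.base =
        (d 0 0)⁻¹
      calc _ = (x.unit⁻¹ * x.unit) * ((d (-x.base) x.base)⁻¹ * d (-x.base) x.base) *
            (d 0 0)⁻¹ := by ac_rfl
        _ = _ := by rw [inv_mul_cancel, inv_mul_cancel, one_mul, one_mul])
  let i5 : AddCommGroup (CentralExt d) :=
    { i4 with
      add_comm := fun x y => by
        refine CentralExt.ext ?_ (add_comm _ _)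
        change x.unit * y.unit * d x.base y.base = y.unit * x.unit * d y.base x.base
        rw [hs, mul_comm x.unit] }
  -- the inclusion of `ℂˣ` in the extension has a retraction `r`; `t` is its restriction to `L`
  let f : Additive ℂˣ →+ CentralExt d := AddMonoidHom.mk'
    (fun x => ⟨x.toMul * (d 0 0)⁻¹, 0⟩) fun x y => by
      refine CentralExt.ext ?_ (add_zero _).symm
      change x.toMul * y.toMul * (d 0 0)⁻¹ =
        x.toMul * (d 0 0)⁻¹ * (y.toMul * (d 0 0)⁻¹) * d 0 0
      rw [← mul_assoc, inv_mul_cancel_right, mul_right_comm]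
  have hf : Function.Injective f := by
    intro x y hxy
    have := congrArg CentralExt.unit hxy
    exact mul_right_cancel (b := (d 0 0)⁻¹) this
  obtain ⟨i6⟩ := exists_divisibleBy_units
  obtain ⟨r, hr⟩ := (Module.Baer.of_divisible (Additive ℂˣ)).extension_property_addMonoidHom f hf
    (AddMonoidHom.id _)
  have hr' : ∀ x : ℂˣ, r ⟨x * (d 0 0)⁻¹, 0⟩ = Additive.ofMul x := fun x =>
    DFunLike.congr_fun hr (Additive.ofMul x)
  refine ⟨fun a => (r ⟨1, a⟩).toMul, fun a b => ?_⟩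
  have h1 : (⟨1, a⟩ + ⟨1, b⟩ : CentralExt d) = ⟨d a b * (d 0 0)⁻¹, 0⟩ + ⟨1, a + b⟩ := by
    refine CentralExt.ext ?_ (zero_add _).symm
    change 1 * 1 * d a b = d a b * (d 0 0)⁻¹ * 1 * d 0 (a + b)
    rw [h0 (a + b), mul_one, mul_one, one_mul, inv_mul_cancel_right]
  have h2 := congrArg r h1
  rw [map_add, map_add, hr'] at h2
  exact (congrArg Additive.toMul h2).symm

end Cocycle

section GradedHom

variable {H : Type u} [AddCommGroup H] [Module ℂ H] {B : LinearMap.BilinForm ℂ H}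
  {H' : Type w} [AddCommGroup H'] [Module ℂ H'] {B' : LinearMap.BilinForm ℂ H'}

/-- A homomorphism of AH pairs, from its homogeneous components. -/
def AHHom.ofComp {A : AHPair.{u, v} B} {A' : AHPair.{w, x} B'} (φ : H ≃ₗ[ℂ] H')
    (hφ : ∀ x y, B' (φ x) (φ y) = B x y) (f : ∀ α, A.comp α →ₗ[ℂ] A'.comp (φ α))
    (h1 : DirectSum.of A'.comp _ (f 0 GradedMonoid.GOne.one) = 1)
    (hm : ∀ α β (a : A.comp α) (b : A.comp β),
      DirectSum.of A'.comp _ (f (α + β) (GradedMonoid.GMul.mul a b)) =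
        DirectSum.of A'.comp _ (f α a) * DirectSum.of A'.comp _ (f β b)) : AHHom A A' where
  toAlgHom := DirectSum.toAlgebra ℂ A.comp (fun α => DirectSum.lof ℂ H' A'.comp (φ α) ∘ₗ f α)
    h1 (fun a b => hm _ _ a b)
  isom := φ
  isom_form := hφ
  map_comp α v := ⟨f α v, DirectSum.toAddMonoid_of
    (fun α => (DirectSum.lof ℂ H' A'.comp (φ α) ∘ₗ f α).toAddMonoidHom) α v⟩

theorem AHHom.ofComp_of {A : AHPair.{u, v} B} {A' : AHPair.{w, x} B'} {φ : H ≃ₗ[ℂ] H'}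
    {hφ : ∀ x y, B' (φ x) (φ y) = B x y} {f : ∀ α, A.comp α →ₗ[ℂ] A'.comp (φ α)}
    {h1 : DirectSum.of A'.comp _ (f 0 GradedMonoid.GOne.one) = 1}
    {hm : ∀ α β (a : A.comp α) (b : A.comp β),
      DirectSum.of A'.comp _ (f (α + β) (GradedMonoid.GMul.mul a b)) =
        DirectSum.of A'.comp _ (f α a) * DirectSum.of A'.comp _ (f β b)} (α : H) (a : A.comp α) :
    (AHHom.ofComp φ hφ f h1 hm).toAlgHom (DirectSum.of A.comp α a) =
      DirectSum.of A'.comp (φ α) (f α a) :=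
  DirectSum.toAddMonoid_of (fun α => (DirectSum.lof ℂ H' A'.comp (φ α) ∘ₗ f α).toAddMonoidHom) α a

end GradedHom

namespace AHPair

variable {H : Type u} [AddCommGroup H] [Module ℂ H] {B : LinearMap.BilinForm ℂ H}
  {A : AHPair.{u, v} B}

theorem IsGood.exists_of_eq_smul_one (hA : A.IsGood) {γ : H} (hγ : γ = 0) (v : A.comp γ) :
    ∃ c : ℂ, DirectSum.of A.comp γ v = c • 1 := by
  subst hγ
  obtain ⟨c, rfl⟩ := hA.comp_zero v
  refine ⟨c, ?_⟩
  rw [DirectSum.one_def, ← DirectSum.lof_eq_of ℂ, ← DirectSum.lof_eq_of ℂ, map_smul]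

/-- The homogeneous components of a good AH pair are one-dimensional on the maximal lattice. -/
theorem IsGood.exists_eq_smul (hA : A.IsGood) {α : H} (hα : α ∈ hA.lattice.carrier)
    (a b : A.comp α) (ha : a ≠ 0) : ∃ c : ℂ, b = c • a := by
  obtain ⟨-, y, hy⟩ := hα
  -- right multiplication by `y` embeds `A^α` in `A^0 = ℂ1`
  have hab : ∀ a : A.comp α, ∃ c : ℂ,
      DirectSum.of A.comp α a * DirectSum.of A.comp (-α) y = c • 1 := by
    intro a
    rw [DirectSum.of_mul_of]
    exact hA.exists_of_eq_smul_one (add_neg_cancel α) _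
  obtain ⟨c, hc⟩ := hab a
  obtain ⟨c', hc'⟩ := hab b
  have hc0 : c ≠ 0 := by
    rintro rfl
    exact hA.mul_ne_zero _ _ a y ha hy (by rw [hc, zero_smul])
  have h : c • b - c' • a = 0 := by
    by_contra hne
    refine hA.mul_ne_zero _ _ _ y hne hy ?_
    rw [map_sub, ← DirectSum.lof_eq_of ℂ, ← DirectSum.lof_eq_of ℂ, map_smul, map_smul,
      DirectSum.lof_eq_of, DirectSum.lof_eq_of, sub_mul, smul_mul_assoc, smul_mul_assoc, hc, hc',
      smul_comm, sub_self]
  refine ⟨c⁻¹ * c', ?_⟩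
  rw [mul_smul, ← sub_eq_zero.1 h, smul_smul, inv_mul_cancel₀ hc0, one_smul]

theorem IsGood.latIncl_injective (hA : A.IsGood) (α : H) :
    Function.Injective (hA.latIncl α) := Subtype.val_injective

theorem IsGood.latIncl_mul (hA : A.IsGood) {α β : H} (a : hA.lat.comp α) (b : hA.lat.comp β) :
    hA.latIncl (α + β) (GradedMonoid.GMul.mul a b) =
      GradedMonoid.GMul.mul (hA.latIncl α a) (hA.latIncl β b) := rfl

theorem IsGood.exists_latIncl_eq (hA : A.IsGood) {α : H} (hα : α ∈ hA.lattice.carrier)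
    (a : A.comp α) : ∃ b, hA.latIncl α b = a := ⟨⟨a, mem_ite_iff.2 fun h => absurd hα h⟩, rfl⟩

theorem IsGood.lat_eq_zero (hA : A.IsGood) {α : H} (hα : α ∉ hA.lattice.carrier)
    (a : hA.lat.comp α) : a = 0 := Subtype.ext (mem_ite_iff.1 a.2 hα)

theorem IsGood.lat_exists_eq_smul (hA : A.IsGood) {α : H} (a b : hA.lat.comp α) (ha : a ≠ 0) :
    ∃ c : ℂ, b = c • a := by
  by_cases hα : α ∈ hA.lattice.carrier
  · obtain ⟨c, hc⟩ := hA.exists_eq_smul hα (hA.latIncl α a) (hA.latIncl α b)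
      fun h => ha (hA.latIncl_injective α (h.trans (map_zero _).symm))
    exact ⟨c, hA.latIncl_injective α (by rw [map_smul, hc])⟩
  · exact absurd (hA.lat_eq_zero hα a) ha

theorem IsGood.lat_mul_ne_zero (hA : A.IsGood) {α β : H} {a : hA.lat.comp α} {b : hA.lat.comp β}
    (ha : a ≠ 0) (hb : b ≠ 0) :
    (GradedMonoid.GMul.mul a b : hA.lat.comp (α + β)) ≠ 0 := by
  intro h
  refine hA.mul_ne_zero α β (hA.latIncl α a) (hA.latIncl β b)
    (fun h => ha (hA.latIncl_injective α (h.trans (map_zero _).symm)))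
    (fun h => hb (hA.latIncl_injective β (h.trans (map_zero _).symm))) ?_
  rw [DirectSum.of_mul_of, ← hA.latIncl_mul, h, map_zero, map_zero]

end AHPair

section TwistedGroupAlgebra

open AHPair

variable {H : Type u} [AddCommGroup H] [Module ℂ H] {B : LinearMap.BilinForm ℂ H}

theorem EvenLattice.eq_zero_of_notMem (L : EvenLattice B) {α : H} (hα : α ∉ L.carrier)
    (a : L.toAHPair.comp α) : a = 0 := Subtype.ext (mem_ite_iff.1 a.2 hα)

/-- The underlying complex number of an element of `ℂ e_α`. -/
def EvenLattice.coord (L : EvenLattice B) (α : H) : L.toAHPair.comp α →ₗ[ℂ] ℂ :=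
  (if α ∈ L.carrier then ⊤ else ⊥ : Submodule ℂ ℂ).subtype

theorem EvenLattice.coord_injective (L : EvenLattice B) (α : H) :
    Function.Injective (L.coord α) := Subtype.val_injective

theorem EvenLattice.coord_surjective (L : EvenLattice B) {α : H} (hα : α ∈ L.carrier) (c : ℂ) :
    ∃ a, L.coord α a = c := ⟨⟨c, mem_ite_iff.2 fun h => absurd hα h⟩, rfl⟩

theorem EvenLattice.coord_one (L : EvenLattice B) : L.coord 0 GradedMonoid.GOne.one = 1 := rfl

theorem EvenLattice.coord_mul (L : EvenLattice B) {α β : H} (a : L.toAHPair.comp α)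
    (b : L.toAHPair.comp β) : L.coord (α + β) (GradedMonoid.GMul.mul a b) =
      ((L.sgn α β : ℤ) : ℂ) * (L.coord α a * L.coord β b) := rfl

end TwistedGroupAlgebra

/-! ### The lattice pair as a twisted group algebra -/

open AHPair

section MaximalLattice

variable {H : Type u} [AddCommGroup H] [Module ℂ H] {B : LinearMap.BilinForm ℂ H}
  {A : AHPair.{u, v} B}

/-- The lattice pair `A^lat` is a twisted group algebra of the maximal lattice: on homogeneous
components the isomorphism is given by a rescaling of the vectors `e_α`. -/
theorem AHPair.IsGood.exists_comp_equiv (hA : A.IsGood) :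
    ∃ ψ : ∀ α, hA.lattice.toAHPair.comp α ≃ₗ[ℂ] hA.lat.comp α,
      ψ 0 GradedMonoid.GOne.one = GradedMonoid.GOne.one ∧
      ∀ (α β) (a : hA.lattice.toAHPair.comp α) (b : hA.lattice.toAHPair.comp β),
        ψ (α + β) (GradedMonoid.GMul.mul a b) = GradedMonoid.GMul.mul (ψ α a) (ψ β b) := by
  set L := hA.lattice
  have hne : ∀ α ∈ L.carrier, ∃ e : hA.lat.comp α, e ≠ 0 := by
    rintro α hα
    obtain ⟨v, hv⟩ := hα.1
    obtain ⟨b, rfl⟩ := hA.exists_latIncl_eq hα v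
    exact ⟨b, fun h => hv (by rw [h, map_zero])⟩
  let e : ∀ α, hA.lat.comp α := fun α => if h : α ∈ L.carrier then (hne α h).choose else 0
  have he : ∀ α ∈ L.carrier, e α ≠ 0 := fun α hα => by
    simp only [e, dif_pos hα]
    exact (hne α hα).choose_spec
  have hd : ∀ α β : L.carrier, ∃ d : ℂˣ, (GradedMonoid.GMul.mul (e α) (e β) : hA.lat.comp _) =
      (d : ℂ) • e (α + β : H) := by
    intro α β
    obtain ⟨c, hc⟩ := hA.lat_exists_eq_smul (e (α + β : H)) (GradedMonoid.GMul.mul (e α) (e β))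
      (he _ (L.carrier.add_mem α.2 β.2))
    have hc0 : c ≠ 0 := by
      rintro rfl
      exact hA.lat_mul_ne_zero (he _ α.2) (he _ β.2) (by rw [hc, zero_smul])
    exact ⟨Units.mk0 c hc0, hc⟩
  -- the structure constants `d` of `A^lat` with respect to the basis vectors `e_α`
  choose d hd using hd
  let E : L.carrier → hA.lat.Alg := fun α => DirectSum.of hA.lat.comp α (e α)
  have hE0 : ∀ α, E α ≠ 0 := fun α h => he α α.2
    (DirectSum.of_injective (β := hA.lat.comp) (α : H) (h.trans (map_zero _).symm))
  have hE : ∀ α β, E α * E β = (d α β : ℂ) • E (α + β) := fun α β => by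
    simp only [E]
    rw [DirectSum.of_mul_of, hd, ← DirectSum.lof_eq_of ℂ, map_smul]
    rfl
  have hint : ∀ α β : L.carrier, ∃ n : ℤ, B α β = n := fun α β => L.integral α α.2 β β.2
  let ε' : L.carrier → L.carrier → ℂˣ := fun α β =>
    Units.map (Int.castRingHom ℂ).toMonoidHom (L.ε α β)
  have hε' : ∀ α β, ((ε' α β : ℂˣ) : ℂ) = ((L.ε α β : ℤ) : ℂ) := fun α β => rfl
  -- `d` and `ε` have the same commutator map, so their product (as `ε = ε⁻¹`) is symmetric
  obtain ⟨t, ht⟩ := exists_coboundary (fun α β => d α β * ε' α β) (by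
      intro α β
      obtain ⟨n, hn⟩ := hint α β
      have h1 := hA.lat.comm α β (e α) (e β) n hn
      have h2 : (d α β : ℂ) • E (α + β) =
          ((Int.negOnePow n : ℤ) : ℂ) • ((d β α : ℂ) • E (β + α)) := by
        rw [← hE, ← hE, Int.cast_smul_eq_zsmul]
        exact h1
      rw [add_comm β α, smul_smul] at h2
      have h3 := smul_left_injective ℂ (hE0 _) h2
      have h4 := L.ε_spec.comm α β n hn
      refine Units.ext ?_
      rw [Units.val_mul, Units.val_mul, hε', hε', h3, h4]
      rcases Int.units_eq_one_or (Int.negOnePow n) with h | h <;> rw [h] <;> simp)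
    (by
      intro α β γ
      have h1 := mul_assoc (E α) (E β) (E γ)
      rw [hE, hE, smul_mul_assoc, mul_smul_comm, hE, hE, smul_smul, smul_smul, add_assoc] at h1
      have h2 : (d α β : ℂ) * d (α + β) γ = d β γ * d α (β + γ) := smul_left_injective ℂ (hE0 _) h1
      have h3 := congrArg (Units.map (Int.castRingHom ℂ).toMonoidHom) (L.ε_spec.cocycle α β γ)
      rw [map_mul, map_mul] at h3
      have h2' : d α β * d (α + β) γ = d β γ * d α (β + γ) := Units.ext h2
      calc _ = (d α β * d (α + β) γ) * (ε' α β * ε' (α + β) γ) := by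
            ac_rfl
        _ = (d β γ * d α (β + γ)) * (ε' α (β + γ) * ε' β γ) := congrArg₂ _ h2' h3
        _ = _ := by
            ac_rfl)
  have hct : ∀ a b, ε' a b * (t (a + b))⁻¹ = d a b * ((t a)⁻¹ * (t b)⁻¹) := fun a b => by
    have hεε : ε' a b * ε' a b = 1 := by
      rw [← map_mul, Int.units_mul_self, map_one]
    rw [← mul_inv, ← ht, mul_inv, mul_inv, ← mul_assoc, ← mul_assoc, mul_inv_cancel, one_mul,
      inv_eq_of_mul_eq_one_right hεε]
  let c : H → ℂ := fun α => if h : α ∈ L.carrier then ((t ⟨α, h⟩)⁻¹ : ℂˣ) else 0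
  have hc : ∀ α (h : α ∈ L.carrier), c α = ((t ⟨α, h⟩)⁻¹ : ℂˣ) := fun α h => dif_pos h
  have hc0 : ∀ α ∈ L.carrier, c α ≠ 0 := fun α h => by rw [hc α h]; exact Units.ne_zero _
  let f : ∀ α, L.toAHPair.comp α →ₗ[ℂ] hA.lat.comp α := fun α =>
    LinearMap.toSpanSingleton ℂ _ (c α • e α) ∘ₗ L.coord α
  have hf : ∀ α a, f α a = (L.coord α a * c α) • e α := fun α a => by
    rw [mul_smul]
    rfl
  have hsmul : ∀ (α β : H) (x y : ℂ) (a : hA.lat.comp α) (b : hA.lat.comp β),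
      (GradedMonoid.GMul.mul (x • a) (y • b) : hA.lat.comp (α + β)) =
        (x * y) • GradedMonoid.GMul.mul a b := by
    intro α β x y a b
    have h := DirectSum.gMulLHom_apply_apply (R := ℂ) (A := hA.lat.comp) (x • a) (y • b)
    rw [← h, map_smul, map_smul, LinearMap.smul_apply, smul_smul, mul_comm,
      DirectSum.gMulLHom_apply_apply]
  have hmul : ∀ (α β) (a : L.toAHPair.comp α) (b : L.toAHPair.comp β),
      f (α + β) (GradedMonoid.GMul.mul a b) = GradedMonoid.GMul.mul (f α a) (f β b) := by
    intro α β a b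
    rw [hf, hf, hf, hsmul, L.coord_mul]
    by_cases hα : α ∈ L.carrier
    · by_cases hβ : β ∈ L.carrier
      · have h1 := hd ⟨α, hα⟩ ⟨β, hβ⟩
        have h2 := congrArg Units.val (hct ⟨α, hα⟩ ⟨β, hβ⟩)
        simp only [Units.val_mul, hε'] at h2
        dsimp only at h1
        rw [h1, smul_smul, hc α hα, hc β hβ, hc _ (L.carrier.add_mem hα hβ), L.sgn_of_mem hα hβ]
        congr 1
        rw [AddMemClass.mk_add_mk] at h2
        linear_combination (L.coord α a * L.coord β b) * h2
      · simp [L.eq_zero_of_notMem hβ b]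
    · simp [L.eq_zero_of_notMem hα a]
  have hbij : ∀ α, Function.Bijective (f α) := by
    intro α
    by_cases hα : α ∈ L.carrier
    · constructor
      · rw [injective_iff_map_eq_zero]
        intro a ha
        rw [hf] at ha
        have := (mul_eq_zero.1 ((smul_eq_zero.1 ha).resolve_right (he α hα))).resolve_right
          (hc0 α hα)
        exact L.coord_injective α (this.trans (map_zero _).symm)
      · intro b
        obtain ⟨r, hr⟩ := hA.lat_exists_eq_smul (e α) b (he α hα)
        obtain ⟨a, ha⟩ := L.coord_surjective hα (r * (c α)⁻¹)
        exact ⟨a, by rw [hf, ha, inv_mul_cancel_right₀ (hc0 α hα), hr]⟩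
    · exact ⟨fun a b _ => by rw [L.eq_zero_of_notMem hα a, L.eq_zero_of_notMem hα b],
        fun b => ⟨0, by rw [map_zero, hA.lat_eq_zero hα b]⟩⟩
  refine ⟨fun α => LinearEquiv.ofBijective (f α) (hbij α), ?_, hmul⟩
  change f 0 GradedMonoid.GOne.one = GradedMonoid.GOne.one
  -- the image of `1` is a nonzero idempotent, hence equal to `1`
  obtain ⟨r, hr⟩ := hA.lat_exists_eq_smul GradedMonoid.GOne.one (f 0 GradedMonoid.GOne.one)
    hA.lat.gOne_ne_zero
  have hr0 : r ≠ 0 := by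
    rintro rfl
    rw [zero_smul] at hr
    exact L.toAHPair.gOne_ne_zero ((hbij 0).1 (hr.trans (map_zero _).symm))
  have h1 : DirectSum.of hA.lat.comp 0 (f 0 GradedMonoid.GOne.one) = r • 1 := by
    rw [hr, DirectSum.one_def, ← DirectSum.lof_eq_of ℂ, map_smul]
    rfl
  have h2 : DirectSum.of hA.lat.comp (0 + 0)
      (f (0 + 0) (GradedMonoid.GMul.mul GradedMonoid.GOne.one GradedMonoid.GOne.one)) =
      DirectSum.of hA.lat.comp 0 (f 0 GradedMonoid.GOne.one) :=
    congrArg (fun x : GradedMonoid L.toAHPair.comp => DirectSum.of hA.lat.comp x.1 (f x.1 x.2))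
      (GradedMonoid.GMonoid.one_mul (⟨0, GradedMonoid.GOne.one⟩ : GradedMonoid L.toAHPair.comp))
  rw [hmul, ← DirectSum.of_mul_of, h1, smul_mul_smul_comm, mul_one] at h2
  have h3 : r * r = r := smul_left_injective ℂ hA.lat.one_ne_zero h2
  rw [hr, mul_right_cancel₀ hr0 (h3.trans (one_mul r).symm), one_smul]

/-- The isomorphism of `A^lat` with the twisted group algebra of the maximal lattice, and its
inverse. -/
theorem AHPair.IsGood.exists_iso (hA : A.IsGood) :
    ∃ (Φ : AHHom hA.lat hA.lattice.toAHPair) (Ψ : AHHom hA.lattice.toAHPair hA.lat),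
      Φ.isom = LinearEquiv.refl ℂ H ∧ Ψ.isom = LinearEquiv.refl ℂ H ∧
      (∀ x, Φ.toAlgHom (Ψ.toAlgHom x) = x) ∧ ∀ y, Ψ.toAlgHom (Φ.toAlgHom y) = y := by
  obtain ⟨ψ, h1, hm⟩ := hA.exists_comp_equiv
  have hm' : ∀ (α β) (a : hA.lat.comp α) (b : hA.lat.comp β),
      (ψ (α + β)).symm (GradedMonoid.GMul.mul a b) =
        GradedMonoid.GMul.mul ((ψ α).symm a) ((ψ β).symm b) := fun α β a b => by
    rw [LinearEquiv.symm_apply_eq, hm, LinearEquiv.apply_symm_apply, LinearEquiv.apply_symm_apply]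
  let Φ : AHHom hA.lat hA.lattice.toAHPair := AHHom.ofComp (LinearEquiv.refl ℂ H) (fun _ _ => rfl)
    (fun α => (ψ α).symm.toLinearMap)
    (congrArg (DirectSum.of hA.lattice.toAHPair.comp 0) ((LinearEquiv.symm_apply_eq _).2 h1.symm))
    (fun α β a b => (congrArg (DirectSum.of hA.lattice.toAHPair.comp (α + β)) (hm' α β a b)).trans
      (DirectSum.of_mul_of _ _).symm)
  let Ψ : AHHom hA.lattice.toAHPair hA.lat := AHHom.ofComp (LinearEquiv.refl ℂ H) (fun _ _ => rfl)
    (fun α => (ψ α).toLinearMap)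
    (congrArg (DirectSum.of hA.lat.comp 0) h1)
    (fun α β a b => (congrArg (DirectSum.of hA.lat.comp (α + β)) (hm α β a b)).trans
      (DirectSum.of_mul_of _ _).symm)
  have hΦ : ∀ α a, Φ.toAlgHom (DirectSum.of hA.lat.comp α a) =
      DirectSum.of hA.lattice.toAHPair.comp α ((ψ α).symm a) := fun α a => AHHom.ofComp_of α a
  have hΨ : ∀ α a, Ψ.toAlgHom (DirectSum.of hA.lattice.toAHPair.comp α a) =
      DirectSum.of hA.lat.comp α (ψ α a) := fun α a => AHHom.ofComp_of α a
  refine ⟨Φ, Ψ, rfl, rfl, fun x => ?_, fun y => ?_⟩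
  · induction x using DirectSum.induction_on with
    | zero => rw [map_zero, map_zero]
    | add x y hx hy => rw [map_add, map_add, hx, hy]
    | of α a => rw [hΨ, hΦ, LinearEquiv.symm_apply_apply]
  · induction y using DirectSum.induction_on with
    | zero => rw [map_zero, map_zero]
    | add x y hx hy => rw [map_add, map_add, hx, hy]
    | of α a => rw [hΦ, hΨ, LinearEquiv.apply_symm_apply]

end MaximalLattice

/-! ### The embedding of `𝒱(Ω(V, H)^lat)` and the adjunction -/

section Composition

variable {H₁ : Type*} [AddCommGroup H₁] [Module ℂ H₁] {B₁ : LinearMap.BilinForm ℂ H₁}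
  {H₂ : Type*} [AddCommGroup H₂] [Module ℂ H₂] {B₂ : LinearMap.BilinForm ℂ H₂}
  {H₃ : Type*} [AddCommGroup H₃] [Module ℂ H₃] {B₃ : LinearMap.BilinForm ℂ H₃}
  {A₁ : AHPair B₁} {A₂ : AHPair B₂} {A₃ : AHPair B₃}

/-- The composition of homomorphisms of AH pairs. -/
def AHHom.comp (g : AHHom A₂ A₃) (f : AHHom A₁ A₂) : AHHom A₁ A₃ where
  toAlgHom := g.toAlgHom.comp f.toAlgHom
  isom := f.isom.trans g.isom
  isom_form x y := (g.isom_form _ _).trans (f.isom_form x y)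
  map_comp α v := by
    obtain ⟨w, hw⟩ := f.map_comp α v
    obtain ⟨z, hz⟩ := g.map_comp _ w
    exact ⟨z, (congrArg g.toAlgHom hw).trans hz⟩

/-- Composition with an isomorphism of AH pairs. -/
def AHHom.compEquiv (Φ : AHHom A₂ A₃) (Ψ : AHHom A₃ A₂) (hisom : Ψ.isom = Φ.isom.symm)
    (hΦΨ : ∀ x, Φ.toAlgHom (Ψ.toAlgHom x) = x) (hΨΦ : ∀ y, Ψ.toAlgHom (Φ.toAlgHom y) = y) :
    AHHom A₁ A₂ ≃ AHHom A₁ A₃ where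
  toFun G := Φ.comp G
  invFun G := Ψ.comp G
  left_inv G := AHHom.ext (AlgHom.ext fun _ => hΨΦ _) (LinearEquiv.ext fun k => by
    change Ψ.isom (Φ.isom (G.isom k)) = G.isom k
    rw [hisom, LinearEquiv.symm_apply_apply])
  right_inv G := AHHom.ext (AlgHom.ext fun _ => hΦΨ _) (LinearEquiv.ext fun k => by
    change Φ.isom (Ψ.isom (G.isom k)) = G.isom k
    rw [hisom, LinearEquiv.apply_symm_apply])

end Composition

/-- The augmentation of the Fock space gives a left inverse of `a ↦ 1 ⊗ a`. -/
theorem AHPair.ofAlg_injective {K : Type w} [AddCommGroup K] [Module ℂ K]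
    {B : LinearMap.BilinForm ℂ K} (A : AHPair.{w, v} B) : Function.Injective A.ofAlg := by
  let r : A.Vtx →ₗ[ℂ] A.Alg := DirectSum.toModule ℂ K A.Alg fun α =>
    DirectSum.lof ℂ K A.comp α ∘ₗ (TensorProduct.lid ℂ (A.comp α)).toLinearMap ∘ₗ
      (SymmetricAlgebra.algebraMapInv (R := ℂ) (M := ℕ →₀ K)).toLinearMap.rTensor (A.comp α)
  have hr : ∀ x, r (A.ofAlg x) = x := by
    intro x
    induction x using DirectSum.induction_on with
    | zero => rw [map_zero, map_zero]
    | add x y hx hy => rw [map_add, map_add, hx, hy]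
    | of α a =>
      rw [ofAlg_of]
      refine (DirectSum.toModule_lof ℂ (M := fun α => Fock K ⊗[ℂ] A.comp α) α _).trans ?_
      simp [DirectSum.lof_eq_of]
  exact Function.LeftInverse.injective hr

section Sub

variable {V : Type u} [AddCommGroup V] [Module ℂ V] [PreVertexAlgebra V] {H : Submodule ℂ V}
  {U : Type w} [AddCommGroup U] [Module ℂ U] [PreVertexAlgebra U] {HU : Submodule ℂ U}

theorem VertexSubalgebra.ext {W W' : VertexSubalgebra V} (h : W.toSubmodule = W'.toSubmodule) :
    W = W' := by
  cases W
  cases W'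
  cases h
  rfl

/-- A homomorphism of VH pairs with values in a vertex subalgebra. -/
def VHHom.codRestrict (F : VHHom HU H) (W : VertexSubalgebra V)
    (hW : ∀ x, F.toLinearMap x ∈ W.toSubmodule) : VHHom HU (W.heis H) where
  toLinearMap := F.toLinearMap.codRestrict W.toSubmodule hW
  map_vac := Subtype.ext F.map_vac
  map_nprod n a b := Subtype.ext (F.map_nprod n a b)
  map_heis := by
    ext ⟨y, hy⟩
    constructor
    · rintro ⟨x, hx, hxy⟩
      have h : F.toLinearMap x = y := congrArg Subtype.val hxy
      exact (F.map_heis.le ⟨x, hx, h⟩ : y ∈ H)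
    · intro (h : y ∈ H)
      obtain ⟨x, hx, hxy⟩ := F.map_heis.ge h
      exact ⟨x, hx, Subtype.ext hxy⟩

/-- A homomorphism to the VH pair `(W, H)`, for a vertex subalgebra `W` of `V` containing `H`, as a
homomorphism to `(V, H)`. -/
def VHHom.toAmbient {W : VertexSubalgebra V} (hW : H ≤ W.toSubmodule) (g : VHHom HU (W.heis H)) :
    VHHom HU H where
  toLinearMap := W.toSubmodule.subtype ∘ₗ g.toLinearMap
  map_vac := congrArg Subtype.val g.map_vac
  map_nprod n a b := congrArg Subtype.val (g.map_nprod n a b)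
  map_heis := by
    rw [Submodule.map_comp, g.map_heis, Submodule.map_comap_subtype, inf_eq_right.2 hW]

theorem VHHom.range_toAmbient {W : VertexSubalgebra V} (hW : H ≤ W.toSubmodule)
    (g : VHHom HU (W.heis H)) (hg : Function.Surjective g.toLinearMap) :
    (g.toAmbient hW).range.toSubmodule = W.toSubmodule := by
  change LinearMap.range (W.toSubmodule.subtype ∘ₗ g.toLinearMap) = _
  rw [LinearMap.range_comp, LinearMap.range_eq_top.2 hg, Submodule.map_top,
    Submodule.range_subtype]

end Sub

section Embedding

variable {V : Type u} [AddCommGroup V] [Module ℂ V] [VertexAlgebra V] {H : Submodule ℂ V}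
  (hH : IsHeisenberg H) (hgood : (Omega hH).IsGood)

/-- Direct sums indexed by a subspace use the same (classical) decidability of equality as direct
sums indexed by an arbitrary vector space. -/
local instance (priority := high) decidableEqSubmodule {M : Type*} [AddCommGroup M] [Module ℂ M]
    (N : Submodule ℂ M) : DecidableEq N := fun a b => Classical.propDecidable (a = b)

/-- The inclusion of the component of degree `α` of `Ω(V, H)^lat` in `V`. -/
def latVal (α : H) : hgood.lat.comp α →ₗ[ℂ] V := Omega.val hH α ∘ₗ hgood.latIncl α

theorem latVal_injective (α : H) : Function.Injective (latVal hH hgood α) :=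
  Subtype.val_injective.comp (hgood.latIncl_injective α)

theorem latVal_mul {α β : H} (a : hgood.lat.comp α) (b : hgood.lat.comp β) :
    latVal hH hgood (α + β) (GradedMonoid.GMul.mul a b) =
      vacMul hH α β (latVal hH hgood α a) (latVal hH hgood β b) := rfl

/-- The homomorphism `𝒱(Ω(V, H)^lat) → (V, H)` that is the identity on `H` and on the homogeneous
components of `Ω(V, H)^lat`. -/
def latHom : VHHom hgood.lat.heis H :=
  inducedHom hH (LinearEquiv.refl ℂ H) (g := latVal hH hgood) (fun _ _ => rfl)
    (fun α a => (hgood.latIncl α a).2) rfl fun _ _ a b => latVal_mul hH hgood a b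

theorem latHom_ofHeis (h : H) : (latHom hH hgood).toLinearMap (hgood.lat.ofHeis h) = h :=
  inducedMap_ofHeis hH hgood.lat (LinearEquiv.refl ℂ H) (latVal hH hgood) rfl h

theorem latHom_lof (α : H) (a : hgood.lat.comp α) :
    (latHom hH hgood).toLinearMap (Vtx.lof hgood.lat α (1 ⊗ₜ a)) = latVal hH hgood α a :=
  (inducedMap_lof hH hgood.lat (LinearEquiv.refl ℂ H) (latVal hH hgood) α 1 a).trans
    (fockAct_one _ _ _)

theorem latHom_ofAlg (α : H) (a : hgood.lat.comp α) :
    (latHom hH hgood).toLinearMap (hgood.lat.ofAlg (DirectSum.of hgood.lat.comp α a)) =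
      latVal hH hgood α a := by
  rw [ofAlg_of, latHom_lof]

theorem latHom_injective : Function.Injective (latHom hH hgood).toLinearMap := by
  refine VHHom.injective (hH := hH) (φ := LinearEquiv.refl ℂ H) (latHom_ofHeis hH hgood)
    (fun _ _ => rfl) (fun α a b ha => hgood.lat_exists_eq_smul a b ha) fun α a ha => ?_
  rw [latHom_lof] at ha
  exact latVal_injective hH hgood α (ha.trans (map_zero _).symm)

theorem latHom_ofAlg_injective :
    Function.Injective fun x => (latHom hH hgood).toLinearMap (hgood.lat.ofAlg x) :=
  (latHom_injective hH hgood).comp hgood.lat.ofAlg_injective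

variable {K : Type w} [AddCommGroup K] [Module ℂ K] {B : LinearMap.BilinForm ℂ K}

/-- The relation between a homomorphism `F` from `𝒱(A, K)` to `(V, H)` and a homomorphism `G` from
`(A, K)` to the lattice pair of `Ω(V, H)`: the restrictions of `F` to `K` and `A` are given by
`G`. -/
def IsAdjunct {A : AHPair.{w, v} B} (F : VHHom A.heis H) (G : AHHom A hgood.lat) : Prop :=
  (∀ k, F.toLinearMap (A.ofHeis k) = G.isom k) ∧
    ∀ x, F.toLinearMap (A.ofAlg x) =
      (latHom hH hgood).toLinearMap (hgood.lat.ofAlg (G.toAlgHom x))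

variable {hH hgood}

/-- The image of a homomorphism from `𝒱(A, K)` to `(V, H)` is generated by `H` and the image of
`A`. -/
theorem VHHom.range_le {A : AHPair.{w, v} B} (F : VHHom A.heis H) (φ : K ≃ₗ[ℂ] H)
    (hF : ∀ k, F.toLinearMap (A.ofHeis k) = φ k) (W : VertexSubalgebra V)
    (hW : H ≤ W.toSubmodule)
    (hA : ∀ α (a : A.comp α), F.toLinearMap (Vtx.lof A α (1 ⊗ₜ a)) ∈ W.toSubmodule) :
    F.range.toSubmodule ≤ W.toSubmodule := by
  rintro _ ⟨x, rfl⟩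
  induction x using Vtx.induction with
  | add x y hx hy => rw [map_add]; exact Submodule.add_mem _ hx hy
  | tmul α u a =>
    induction u using fock_induction with
    | one => exact hA α a
    | add u v hu hv =>
      rw [TensorProduct.add_tmul, map_add, map_add]
      exact Submodule.add_mem _ hu hv
    | smul r u hu =>
      rw [← TensorProduct.smul_tmul', map_smul, map_smul]
      exact Submodule.smul_mem _ r hu
    | gen_mul n k u hu =>
      rw [← A.nprod_ofHeis_neg, F.map_nprod, hF]
      exact W.nprod_mem _ (hW (φ k).2) hu

theorem VHHom.le_range {U : Type w} [AddCommGroup U] [Module ℂ U] [PreVertexAlgebra U]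
    {HU : Submodule ℂ U} (F : VHHom HU H) : H ≤ F.range.toSubmodule := by
  intro h hh
  rw [← F.map_heis] at hh
  obtain ⟨u, -, rfl⟩ := hh
  exact ⟨u, rfl⟩

theorem IsAdjunct.range_le {A : AHPair.{w, v} B} {F : VHHom A.heis H} {G : AHHom A hgood.lat}
    (h : IsAdjunct hH hgood F G) :
    F.range.toSubmodule ≤ (latHom hH hgood).range.toSubmodule := by
  refine F.range_le G.isom h.1 _ (VHHom.le_range _) fun α a => ?_
  rw [← ofAlg_of, h.2]
  exact ⟨_, rfl⟩

/-- `F` is determined by `G`, because a homomorphism from `𝒱(A, K)` is determined on `K` and `A`. -/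
theorem IsAdjunct.left_unique {A : AHPair.{w, v} B} {F F' : VHHom A.heis H}
    {G : AHHom A hgood.lat} (h : IsAdjunct hH hgood F G) (h' : IsAdjunct hH hgood F' G) :
    F = F' := by
  have key : F.toLinearMap = F'.toLinearMap := by
    refine LinearMap.ext fun x => ?_
    induction x using Vtx.induction with
    | add x y hx hy => rw [map_add, map_add, hx, hy]
    | tmul α u a =>
      rw [F.apply_lof (hH := hH) h.1, F'.apply_lof (hH := hH) h'.1, ← ofAlg_of, h.2, h'.2]
  cases F
  cases F'
  cases key
  rfl

/-- `G` is determined by `F`, because `ι` is injective. -/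
theorem IsAdjunct.right_unique {A : AHPair.{w, v} B} {F : VHHom A.heis H}
    {G G' : AHHom A hgood.lat} (h : IsAdjunct hH hgood F G) (h' : IsAdjunct hH hgood F G') :
    G = G' := by
  refine AHHom.ext (AlgHom.ext fun x => ?_) (LinearEquiv.ext fun k => Subtype.ext ?_)
  · exact latHom_ofAlg_injective hH hgood ((h.2 x).symm.trans (h'.2 x))
  · exact (h.1 k).symm.trans (h'.1 k)

variable (hH hgood)

/-- A homomorphism of AH pairs to `Ω(V, H)^lat` extends to a homomorphism of VH pairs. -/
theorem exists_isAdjunct_of_ahHom {A : AHPair.{w, v} B} (G : AHHom A hgood.lat) :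
    ∃ F : VHHom A.heis H, IsAdjunct hH hgood F G := by
  let g : ∀ α, A.comp α →ₗ[ℂ] V := fun α =>
    (latHom hH hgood).toLinearMap ∘ₗ hgood.lat.ofAlg ∘ₗ G.toAlgHom.toLinearMap ∘ₗ
      DirectSum.lof ℂ K A.comp α
  have hg : ∀ α a, g α a = (latHom hH hgood).toLinearMap
      (hgood.lat.ofAlg (G.toAlgHom (DirectSum.of A.comp α a))) := fun α a => rfl
  have h1 : g 0 GradedMonoid.GOne.one = vac := by
    rw [hg, ← DirectSum.one_def, map_one, DirectSum.one_def, latHom_ofAlg]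
    rfl
  let F := inducedHom hH G.isom (A := A) (g := g) G.isom_form
    (fun α a => by
      obtain ⟨w, hw⟩ := G.map_comp α a
      rw [hg, hw, latHom_ofAlg]
      exact (hgood.latIncl _ w).2)
    h1
    (fun α β a b => by
      obtain ⟨w, hw⟩ := G.map_comp α a
      obtain ⟨z, hz⟩ := G.map_comp β b
      rw [hg, hg, hg, ← DirectSum.of_mul_of, map_mul, hw, hz, DirectSum.of_mul_of, latHom_ofAlg,
        latHom_ofAlg, latHom_ofAlg, latVal_mul])
  refine ⟨F, fun k => inducedMap_ofHeis hH A G.isom g h1 k, fun x => ?_⟩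
  induction x using DirectSum.induction_on with
  | zero => simp only [map_zero]
  | add x y hx hy => simp only [map_add, hx, hy]
  | of α a =>
    rw [ofAlg_of]
    exact (inducedMap_lof hH A G.isom g α 1 a).trans (fockAct_one _ _ _)

/-- `1 ⊗ a` is a multiple of the vacuum vector if `a` has degree `0`. -/
theorem EvenLattice.lof_eq_smul_vac (L : EvenLattice B) {γ : K} (hγ : γ = 0)
    (m : L.toAHPair.comp γ) :
    Vtx.lof L.toAHPair γ (1 ⊗ₜ m) = L.coord γ m • (vac : L.toAHPair.Vtx) := by
  subst hγ
  have h : m = L.coord 0 m • GradedMonoid.GOne.one := L.coord_injective 0 (by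
    rw [map_smul, L.coord_one, smul_eq_mul, mul_one])
  conv_lhs => rw [h]
  rw [TensorProduct.tmul_smul, map_smul]
  rfl

/-- As `e_α e_(-α)` is a nonzero multiple of `1`, a homomorphism from a lattice vertex algebra does
not vanish on `e_α`. -/
theorem VHHom.exists_apply_ne_zero {L : EvenLattice B} (F : VHHom L.toAHPair.heis H) {α : K}
    (hα : α ∈ L.carrier) :
    ∃ a : L.toAHPair.comp α, F.toLinearMap (Vtx.lof L.toAHPair α (1 ⊗ₜ a)) ≠ 0 := by
  obtain ⟨a, ha⟩ := L.coord_surjective hα 1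
  obtain ⟨b, hb⟩ := L.coord_surjective (L.carrier.neg_mem hα) 1
  refine ⟨a, fun h => ?_⟩
  obtain ⟨n, hn⟩ := L.integral α hα (-α) (L.carrier.neg_mem hα)
  have h1 := congrArg F.toLinearMap (L.toAHPair.nprod_ofAlg_ofAlg hn a b)
  rw [F.map_nprod, h, map_zero, LinearMap.zero_apply, L.lof_eq_smul_vac (add_neg_cancel α),
    map_smul, F.map_vac, L.coord_mul, ha, hb, mul_one, mul_one] at h1
  rcases smul_eq_zero.1 h1.symm with h2 | h2
  · rcases Int.units_eq_one_or (L.sgn α (-α)) with h3 | h3 <;> simp [h3] at h2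
  · exact vac_ne_zero h2

/-- A homomorphism from a lattice vertex algebra to `(V, H)` restricts to a homomorphism of AH pairs
to `Ω(V, H)^lat`. -/
theorem exists_isAdjunct_of_vhHom (hB : B.Nondegenerate) {L : EvenLattice B}
    (F : VHHom L.toAHPair.heis H) :
    ∃ G : AHHom L.toAHPair hgood.lat, IsAdjunct hH hgood F G := by
  obtain ⟨φ, hF, hφ⟩ := F.exists_isometry hH hB
  let F' : ∀ α, L.toAHPair.comp α →ₗ[ℂ] V := fun α =>
    F.toLinearMap ∘ₗ Vtx.lof L.toAHPair α ∘ₗ TensorProduct.mk ℂ (Fock K) (L.toAHPair.comp α) 1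
  have hF' : ∀ α a, F' α a = F.toLinearMap (Vtx.lof L.toAHPair α (1 ⊗ₜ a)) := fun _ _ => rfl
  have hmem : ∀ α a, F' α a ∈ vacSpace hH (φ α) := fun α a => F.apply_ofAlg_mem hF hφ α a
  have hlat : ∀ α ∈ L.carrier, φ α ∈ hgood.lattice.carrier := by
    have hne : ∀ α ∈ L.carrier, ∃ v : (Omega hH).comp (φ α), v ≠ 0 := by
      intro α hα
      obtain ⟨a, ha⟩ := F.exists_apply_ne_zero hα
      exact ⟨⟨F' α a, hmem α a⟩, fun h => ha (congrArg Subtype.val h)⟩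
    intro α hα
    refine ⟨hne α hα, ?_⟩
    have := hne (-α) (L.carrier.neg_mem hα)
    rwa [map_neg] at this
  -- for `α ∉ L` there is nothing to show, as `A^α = 0`
  have hex : ∀ α a, ∃ b, latVal hH hgood (φ α) b = F' α a := by
    intro α a
    by_cases hα : α ∈ L.carrier
    · obtain ⟨b, hb⟩ := hgood.exists_latIncl_eq (hlat α hα) ⟨F' α a, hmem α a⟩
      exact ⟨b, congrArg Subtype.val hb⟩
    · exact ⟨0, by rw [L.eq_zero_of_notMem hα a, map_zero, map_zero]⟩
  have hf : ∀ α, ∃ f : L.toAHPair.comp α →ₗ[ℂ] hgood.lat.comp (φ α),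
      ∀ a, latVal hH hgood (φ α) (f a) = F' α a := by
    intro α
    obtain ⟨l, hl⟩ := (latVal hH hgood (φ α)).exists_leftInverse_of_injective
      (LinearMap.ker_eq_bot.2 (latVal_injective hH hgood _))
    refine ⟨l ∘ₗ F' α, fun a => ?_⟩
    obtain ⟨b, hb⟩ := hex α a
    rw [LinearMap.comp_apply, ← hb]
    exact congrArg _ (LinearMap.congr_fun hl b)
  choose f hf using hf
  have hof : ∀ α a, (latHom hH hgood).toLinearMap (hgood.lat.ofAlg
      (DirectSum.of hgood.lat.comp (φ α) (f α a))) = F' α a := fun α a => by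
    rw [latHom_ofAlg, hf]
  -- multiplicativity is checked after applying the injective map `x ↦ ι(1 ⊗ x)`
  let G : AHHom L.toAHPair hgood.lat := AHHom.ofComp φ hφ f
    (latHom_ofAlg_injective hH hgood (by
      dsimp only
      rw [hof, DirectSum.one_def, latHom_ofAlg]
      exact F.map_vac))
    (fun α β a b => latHom_ofAlg_injective hH hgood (by
      dsimp only
      rw [hof, DirectSum.of_mul_of, latHom_ofAlg, latVal_mul, hf, hf]
      by_cases hn : ∃ n : ℤ, B α β = n
      · obtain ⟨n, hn⟩ := hn
        rw [vacMul_of_int ((hφ α β).trans hn), hF', hF', hF', ← F.map_nprod,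
          nprod_ofAlg_ofAlg _ hn]
      · rw [vacMul_of_not_int (by rwa [hφ]), LinearMap.zero_apply, LinearMap.zero_apply]
        have h0 : GradedMonoid.GMul.mul a b = (0 : L.toAHPair.comp (α + β)) := by
          by_contra h0
          refine hn (L.toAHPair.integral α β a b fun h => h0 ?_)
          rw [DirectSum.of_mul_of] at h
          exact DirectSum.of_injective (β := L.toAHPair.comp) _ (h.trans (map_zero _).symm)
        rw [h0, map_zero]))
  refine ⟨G, hF, fun x => ?_⟩
  induction x using DirectSum.induction_on with
  | zero => simp only [map_zero]
  | add x y hx hy => simp only [map_add, hx, hy]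
  | of α a => rw [AHHom.ofComp_of, hof, ofAlg_of, hF']

/-- The adjunction: homomorphisms from a lattice vertex algebra to `(V, H)` correspond to
homomorphisms of AH pairs to `Ω(V, H)^lat`. -/
theorem exists_equiv_isAdjunct (hB : B.Nondegenerate) (L : EvenLattice B) :
    ∃ E : VHHom L.toAHPair.heis H ≃ AHHom L.toAHPair hgood.lat,
      ∀ F, IsAdjunct hH hgood F (E F) := by
  choose G hG using fun F => exists_isAdjunct_of_vhHom hH hgood hB (L := L) F
  choose F hF using fun G => exists_isAdjunct_of_ahHom hH hgood (A := L.toAHPair) G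
  exact ⟨⟨G, F, fun F' => (hF _).left_unique (hG F'), fun G' => (hG _).right_unique (hF G')⟩, hG⟩

/-- The image of every homomorphism from a lattice vertex algebra to `(V, H)` lies in
`𝒱(Ω(V, H)^lat)`. -/
theorem range_le_range_latHom (hB : B.Nondegenerate) {L : EvenLattice B}
    (F : VHHom L.toAHPair.heis H) :
    F.range.toSubmodule ≤ (latHom hH hgood).range.toSubmodule := by
  obtain ⟨G, hG⟩ := exists_isAdjunct_of_vhHom hH hgood hB F
  exact hG.range_le

/-- The vertex subalgebra `𝒱(Ω(V, H)^lat)` of `V` is the image of an embedding over `H` of the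
lattice vertex algebra of the maximal lattice. -/
theorem exists_lattice_embedding :
    ∃ F : VHHom hgood.lattice.toAHPair.heis H, Function.Injective F.toLinearMap ∧
      (∀ h : H, F.toLinearMap (hgood.lattice.toAHPair.ofHeis h) = h) ∧
      F.range.toSubmodule = (latHom hH hgood).range.toSubmodule := by
  obtain ⟨Φ, Ψ, -, hΨ, hΦΨ, hΨΦ⟩ := hgood.exists_iso
  obtain ⟨F, hF⟩ := exists_isAdjunct_of_ahHom hH hgood Ψ
  refine ⟨F, ?_, fun h => by rw [hF.1, hΨ]; rfl, le_antisymm hF.range_le ?_⟩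
  · refine VHHom.injective (hH := hH) hF.1 Ψ.isom_form (fun α a b ha => ?_) fun α a ha => ?_
    · refine ⟨hgood.lattice.coord α b / hgood.lattice.coord α a,
        hgood.lattice.coord_injective α ?_⟩
      rw [map_smul, smul_eq_mul, div_mul_cancel₀]
      exact fun h => ha (hgood.lattice.coord_injective α (h.trans (map_zero _).symm))
    · rw [← ofAlg_of, hF.2] at ha
      have h0 : Ψ.toAlgHom (DirectSum.of hgood.lattice.toAHPair.comp α a) = 0 :=
        latHom_ofAlg_injective hH hgood (ha.trans (by dsimp only; rw [map_zero, map_zero]))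
      refine DirectSum.of_injective (β := hgood.lattice.toAHPair.comp) α ?_
      rw [← hΦΨ (DirectSum.of hgood.lattice.toAHPair.comp α a), h0, map_zero, map_zero]
  · refine (latHom hH hgood).range_le (LinearEquiv.refl ℂ H) (latHom_ofHeis hH hgood) _
      F.le_range fun α a => ?_
    rw [← ofAlg_of, ← hΨΦ (DirectSum.of hgood.lat.comp α a), ← hF.2]
    exact ⟨_, rfl⟩

end Embedding

end VHPairs

end

theorem mainTheorem4 {V : Type u} [AddCommGroup V] [Module ℂ V] [VertexAlgebra V]
    {H : Submodule ℂ V} (hH : IsHeisenberg H) (hgood : (Omega hH).IsGood) :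
    -- the embedding of `𝒱(Ω(V, H)^lat)` in `V` as a subVH pair
    ∃ ι : VHHom hgood.lat.heis H,
      Function.Injective ι.toLinearMap ∧
      (∀ h : H, ι.toLinearMap (hgood.lat.ofHeis h) = h) ∧
      (∀ (α : H) (a : hgood.lat.comp α),
        ι.toLinearMap (hgood.lat.ofAlg (DirectSum.of hgood.lat.comp α a)) =
          Omega.val hH α (hgood.latIncl α a)) ∧
      -- it is an `H`-lattice vertex algebra, namely `V_{L,H}` for the maximal lattice `L = L_{V,H}`
      ι.range.IsHLattice H ∧
      (∃ g : VHHom hgood.lattice.toAHPair.heis (ι.range.heis H),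
        Function.Bijective g.toLinearMap ∧
        ∀ h : H, (g.toLinearMap (hgood.lattice.toAHPair.ofHeis h) : V) = h) ∧
      -- it contains the image of every VH pair homomorphism from an `H`-lattice vertex algebra
      (∀ (H' : Type w) [AddCommGroup H'] [Module ℂ H'] [Module.Finite ℂ H']
        (B : LinearMap.BilinForm ℂ H') (_ : B.IsSymm) (_ : B.Nondegenerate) (L : EvenLattice B)
        (f : VHHom L.toAHPair.heis H), f.range.toSubmodule ≤ ι.range.toSubmodule) ∧
      -- it is characterized by these two properties
      (∀ W : VertexSubalgebra V, W.IsHLattice H →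
        (∀ (H' : Type u) [AddCommGroup H'] [Module ℂ H'] [Module.Finite ℂ H']
          (B : LinearMap.BilinForm ℂ H') (_ : B.IsSymm) (_ : B.Nondegenerate) (L : EvenLattice B)
          (f : VHHom L.toAHPair.heis H), f.range.toSubmodule ≤ W.toSubmodule) →
        W = ι.range) ∧
      -- the natural bijection, for some isomorphism `Φ : Ω(V, H)^lat ≅ A_{L_{V,H},H}` over `id_H`
      ∃ Φ : AHHom hgood.lat hgood.lattice.toAHPair,
        Function.Bijective Φ.toAlgHom ∧ Φ.isom = LinearEquiv.refl ℂ H ∧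
        ∀ (H' : Type w) [AddCommGroup H'] [Module ℂ H'] [Module.Finite ℂ H']
          (B : LinearMap.BilinForm ℂ H') (_ : B.IsSymm) (_ : B.Nondegenerate) (L : EvenLattice B),
          ∃ E : VHHom L.toAHPair.heis H ≃ AHHom L.toAHPair hgood.lattice.toAHPair,
            ∀ F : VHHom L.toAHPair.heis H,
              (∀ h : H', F.toLinearMap (L.toAHPair.ofHeis h) = (E F).isom h) ∧
              ∀ (x : L.toAHPair.Alg) (y : hgood.lat.Alg),
                (E F).toAlgHom x = Φ.toAlgHom y →
                  F.toLinearMap (L.toAHPair.ofAlg x) = ι.toLinearMap (hgood.lat.ofAlg y) := by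
  obtain ⟨F, hFinj, hFheis, hFrange⟩ := exists_lattice_embedding hH hgood
  let g := F.codRestrict (latHom hH hgood).range fun x => hFrange.le ⟨x, rfl⟩
  have hg : Function.Bijective g.toLinearMap :=
    ⟨fun x y hxy => hFinj (congrArg Subtype.val hxy), fun ⟨y, hy⟩ => by
      obtain ⟨x, hx⟩ := hFrange.ge hy
      exact ⟨x, Subtype.ext hx⟩⟩
  have hfin := hH.finite
  -- the image of `ι` is the lattice vertex algebra of the maximal lattice, via `g`
  refine ⟨latHom hH hgood, latHom_injective hH hgood, latHom_ofHeis hH hgood, fun α a => ?_,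
    ⟨(latHom hH hgood).le_range, H, inferInstance, inferInstance, heisForm hH, hgood.lattice, hfin,
      heisForm_symm hH, heisForm_nondeg hH, g, hg⟩,
    ⟨g, hg, hFheis⟩, fun K _ _ _ B _ hB L f => range_le_range_latHom hH hgood hB f, ?_, ?_⟩
  · -- `DirectSum.of` does not depend on the choice of the decidability instance
    have h : ∀ i : DecidableEq H, (latHom hH hgood).toLinearMap
        (hgood.lat.ofAlg (@DirectSum.of H hgood.lat.comp _ i α a)) = latVal hH hgood α a :=
      fun i => by
        rw [Subsingleton.elim i fun a b => Classical.propDecidable (a = b)]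
        exact latHom_ofAlg hH hgood α a
    exact h _
  · rintro W ⟨hW, K, _, _, B, L, _, _, hB, g', hg'⟩ hall
    refine VertexSubalgebra.ext (le_antisymm ?_ ?_)
    · rw [← VHHom.range_toAmbient hW g' hg'.2]
      exact range_le_range_latHom hH hgood hB _
    · rw [← hFrange]
      exact hall H (heisForm hH) (heisForm_symm hH) (heisForm_nondeg hH) hgood.lattice F
  · obtain ⟨Φ, Ψ, hΦ, hΨ, hΦΨ, hΨΦ⟩ := hgood.exists_iso
    refine ⟨Φ, ⟨Function.LeftInverse.injective hΨΦ, Function.RightInverse.surjective hΦΨ⟩, hΦ,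
      fun K _ _ _ B _ hB L => ?_⟩
    obtain ⟨E, hE⟩ := exists_equiv_isAdjunct hH hgood hB L
    refine ⟨E.trans (Φ.compEquiv Ψ (by rw [hΦ, hΨ]; rfl) hΦΨ hΨΦ),
      fun f => ⟨fun h => ?_, fun x y hxy => ?_⟩⟩
    · change f.toLinearMap _ = (Φ.isom ((E f).isom h) : H)
      rw [hΦ]
      exact (hE f).1 h
    · have h : (E f).toAlgHom x = y :=
        (hΨΦ _).symm.trans ((congrArg Ψ.toAlgHom hxy).trans (hΨΦ y))
      rw [(hE f).2, h]
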